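/- \textbf{Setting.} Let $d\ge 0$ be an integer, $\lambda_i\ge 0$ and $\mu_i>0$ for $1\le i\le d$, and for each $i$ let $(Q_{i,j})_{0\le j\le d}$ be a probability vector with $Q_{i,i}=0$, such that $$\lambda_i+\sum_{j=1}^d Q_{j,i}\,\mu_j<\mu_i\qquad(1\le i\le d).$$ For each $i$ with $\lambda_i>0$ let $F_i$ be the law of a nonnegative random variable $U_i$ with $E[U_i]=1/\lambda_i$, continuous distribution function and unbounded support. For each $i$ let $G_i$ be the law of a nonnegative random variable $V_i$ with $E[V_i]=1/\mu_i$ and continuous distribution function. Assume that there is $\delta>0$ with $\sup_{t\ge0}E[e^{\delta\lambda_i(U_i-t)}\mid U_i>t]<\infty$ for all $i$ with $\lambda_i>0$ and $\sup_{t\ge0}E[e^{\delta(V_i-t)}\mid V_i>t]<\infty$ for all $i$ (suprema over those $t$ for which the conditioning event has positive probability). \textbf{Autonomous queues.} The state $(y,a,b)$ consists of the queue lengths $y\in\mathbb N^d$, the remaining times $a_i>0$ to the next external arrival at each station $i$ with $\lambda_i>0$, and the remaining times $b_i>0$ to the next activity completion of each server $i$. From the state $(y,a,b)$, external arrivals at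 $i$ occur at the epochs of a renewal process $N_i$ with first epoch $a_i$ and subsequent i.i.d. intervals with law $F_i$ ($N_i\equiv0$ if $\lambda_i=0$); activity completions at $i$ occur at the epochs of a renewal process $D_i$ with first epoch $b_i$ and subsequent i.i.d. intervals with law $G_i$; each completion at $i$ carries an independent mark equal to $j$ with probability $Q_{i,j}$, and $D_{i,j}$ counts the completions at $i$ with mark $j$. All intervals and marks are independent of each other and of the initial state. The queue lengths solve $$dY'_i(t)=dN_i(t)+\sum_{j\ne i}dD_{j,i}(t)-\mathbf 1\{Y'_i(t-)>0\}\,dD_i(t),\qquad Y'_i(0)=y_i .$$ A stationary distribution of $Y'$ is a probability law $\pi$ of the state that is invariant: if the initial state has law $\pi$, then for every $t\ge0$ the state at time $t$ (queue lengths and remaining times) has law $\pi$. \textbf{Reversed process.} Let $\bar N_i$ (for $\lambda_i>0$) and $\bar D_i$ be two-sided time-stationary renewal point processes on $\mathbb R$ with interval laws $F_i$ and $G_i$, attach to the points of $\bar D_i$ i.i.d. marks with law $(Q_{i,j})_j$, all of these being mutually independent, and let $\bar D_{i,j}$ be the points of $\bar D_i$ with mark $j$. For each of these point processes $\bar M$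 put $\bar M(t)=\bar M([0,t])$ for $t\ge0$ and $\bar M(t)=-\bar M([t,0))$ for $t<0$; set $\bar N_i\equiv 0$ if $\lambda_i=0$, and $$\bar X_i(t)=\bar N_i(t)+\sum_{j\ne i}\bar D_{j,i}(t)-\bar D_i(t),\qquad \bar Y'_i(-t)=-\bar X_i(t)+\sup_{s\ge t}\bar X_i(s)\quad(t\ge0).$$ \textbf{Lemma.} (i) The autonomous queue $Y'$ has a unique stationary distribution $\pi$. (ii) Almost surely the suprema $\sup_{s\ge t}\bar X_i(s)$ are finite for all $i$ and all $t\ge0$, and $\{\bar Y'(-t):t\ge0\}$ is the time-reversed stationary version of $Y'$: if $Y'$ is the autonomous queue with initial state of law $\pi$, then for all $0\le T\le S$ the processes $\big(\bar Y'(-(S-s))\big)_{0\le s\le T}$ and $\big(Y'(s)\big)_{0\le s\le T}$ have the same finite-dimensional distributions. In particular $\bar Y'(0)$ has the law of the queue-length component under $\pi$. -/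

import Mathlib

open MeasureTheory ProbabilityTheory Filter Topology

noncomputable section

/-- Data of the system of autonomous queues with `d` stations.
* `lam i`: external arrival rate of station `i`; `lam i = 0` means no external arrivals at `i`.
* `mu i`: rate of the activities (services or vacations) of server `i`.
* `arrLaw`: the interarrival laws, at the stations that do have external arrivals.
* `actLaw i`: the law of the activity durations of server `i`.
* `route i`: the law of the routing marks of server `i`; the mark `0` means leaving the network and
  the mark `j.succ` means station `j`. -/
structure AutonomousNetwork (d : ℕ) where
  lam : Fin d → ℝ
  mu : Fin d → ℝ
  arrLaw : {i : Fin d // 0 < lam i} → ProbabilityMeasure ℝ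
  actLaw : Fin d → ProbabilityMeasure ℝ
  route : Fin d → PMF (Fin (d + 1))

/-- `sup_{t ≥ 0} E[exp (c (U - t)) | U > t] < ∞` for a random variable `U` with law `m`. -/
def UniformExpExcess (m : Measure ℝ) (c : ℝ) : Prop :=
  ∃ C : NNReal, ∀ t : ℝ, 0 ≤ t →
    ∫⁻ x, ENNReal.ofReal (Real.exp (c * (x - t))) ∂(ProbabilityTheory.cond m (Set.Ioi t)) ≤ C

/-- The law `m` is that of a nonnegative random variable with a continuous distribution function
and with finite mean `1 / rate`. -/
structure IsRenewalLaw (m : Measure ℝ) (rate : ℝ) : Prop where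
  nonneg : m (Set.Iio 0) = 0
  noAtoms : ∀ x : ℝ, m {x} = 0
  integrable : Integrable (fun x : ℝ => x) m
  mean : ∫ x, x ∂m = 1 / rate

namespace AutonomousNetwork

variable {d : ℕ}

/-- Stations with external arrivals. -/
abbrev Src (net : AutonomousNetwork d) : Type := {i : Fin d // 0 < net.lam i}

/-- The standing assumptions on the network, including the stability condition `λ < (I - Qᵀ) μ`. -/
structure Assumptions (net : AutonomousNetwork d) : Prop where
  lam_nonneg : ∀ i, 0 ≤ net.lam i
  mu_pos : ∀ i, 0 < net.mu i
  arr_law : ∀ e : net.Src, IsRenewalLaw (net.arrLaw e : Measure ℝ) (net.lam e)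
  act_law : ∀ i, IsRenewalLaw (net.actLaw i : Measure ℝ) (net.mu i)
  arr_unbounded : ∀ (e : net.Src) (x : ℝ), 0 < x → 0 < (net.arrLaw e : Measure ℝ) (Set.Ioi x)
  exp_excess : ∃ δ : ℝ, 0 < δ ∧
    (∀ e : net.Src, UniformExpExcess (net.arrLaw e : Measure ℝ) (δ * net.lam e)) ∧
    (∀ i, UniformExpExcess (net.actLaw i : Measure ℝ) δ)
  no_self_route : ∀ i, net.route i i.succ = 0
  stable : ∀ i, net.lam i + ∑ j, (net.route j i.succ).toReal * net.mu j < net.mu i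

/-! ### The autonomous queue as a Markov process -/

/-- State: queue lengths, remaining times to the next external arrivals, remaining times to the
next activity completions. -/
abbrev QState (net : AutonomousNetwork d) : Type :=
  (Fin d → ℕ) × (net.Src → ℝ) × (Fin d → ℝ)

/-- Future randomness: the interarrival times after the first arrival, the activity durations after
the first completion, and the routing marks of all completions. -/
abbrev Drive (net : AutonomousNetwork d) : Type :=
  (net.Src → ℕ → ℝ) × (Fin d → ℕ → ℝ) × (Fin d → ℕ → Fin (d + 1))

/-- All interarrival times, durations and marks are independent with their respective laws. -/
def driveLaw (net : AutonomousNetwork d) : Measure net.Drive :=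
  (Measure.pi fun e : net.Src => Measure.infinitePi fun _ : ℕ => (net.arrLaw e : Measure ℝ)).prod
    ((Measure.pi fun i : Fin d => Measure.infinitePi fun _ : ℕ => (net.actLaw i : Measure ℝ)).prod
      (Measure.pi fun i : Fin d => Measure.infinitePi fun _ : ℕ => (net.route i).toMeasure))

/-- The epochs `a, a + u 0, a + u 0 + u 1, …` of a renewal process with first epoch `a`. -/
def epoch (a : ℝ) (u : ℕ → ℝ) (n : ℕ) : ℝ := a + ∑ k ∈ Finset.range n, u k

/-- Number of epochs up to time `t`. -/
def countUpTo (e : ℕ → ℝ) (t : ℝ) : ℕ := {n : ℕ | e n ≤ t}.ncard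

/-- Time from `t` to the first epoch after `t`. -/
def residual (e : ℕ → ℝ) (t : ℝ) : ℝ := e (countUpTo e t) - t

/-- Epochs of the external arrivals at a station. -/
def arrEpoch (net : AutonomousNetwork d) (z : net.QState) (w : net.Drive) (e : net.Src) : ℕ → ℝ :=
  epoch (z.2.1 e) (w.1 e)

/-- Epochs of the activity completions of a server. -/
def actEpoch (net : AutonomousNetwork d) (z : net.QState) (w : net.Drive) (i : Fin d) : ℕ → ℝ :=
  epoch (z.2.2 i) (w.2.1 i)

/-- `N_i(t)`. -/
def extCount (net : AutonomousNetwork d) (z : net.QState) (w : net.Drive) (i : Fin d) (t : ℝ) : ℕ :=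
  if h : 0 < net.lam i then countUpTo (net.arrEpoch z w ⟨i, h⟩) t else 0

/-- `D_{j,i}(t)`. -/
def routeCount (net : AutonomousNetwork d) (z : net.QState) (w : net.Drive) (j i : Fin d) (t : ℝ) :
    ℕ :=
  {n : ℕ | net.actEpoch z w j n ≤ t ∧ w.2.2 j n = i.succ}.ncard

/-- The path `y` solves, on `[0, ∞)` and with initial queue lengths `z.1`, the equation
`dY_i(t) = dN_i(t) + ∑_{j ≠ i} dD_{j,i}(t) - 1(Y_i(t-) > 0) dD_i(t)`
(in integrated form; `1(Y_i(t-) > 0)` is read at the jump times of `D_i`). -/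
def IsSolution (net : AutonomousNetwork d) (z : net.QState) (w : net.Drive)
    (y : ℝ → Fin d → ℕ) : Prop :=
  ∀ t : ℝ, 0 ≤ t → ∀ i : Fin d,
    y t i + {n : ℕ | net.actEpoch z w i n ≤ t ∧
        ∀ᶠ s in 𝓝[<] (net.actEpoch z w i n), 0 < y s i}.ncard
      = z.1 i + net.extCount z w i t + ∑ j ∈ Finset.univ.erase i, net.routeCount z w j i t

/-- `Y` is the autonomous queue process whose initial state has law `π` and is independent of the
future interarrival times, durations and marks. -/
structure IsAutonomousQueue (net : AutonomousNetwork d) (π : Measure net.QState)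
    (Y : net.QState × net.Drive → ℝ → Fin d → ℕ) : Prop where
  measurable : ∀ t : ℝ, 0 ≤ t → Measurable fun p => Y p t
  solution : ∀ᵐ p ∂(π.prod net.driveLaw), net.IsSolution p.1 p.2 (Y p)

/-- The state at time `t`. -/
def stateAt (net : AutonomousNetwork d) (Y : net.QState × net.Drive → ℝ → Fin d → ℕ) (t : ℝ)
    (p : net.QState × net.Drive) : net.QState :=
  (Y p t, fun e => residual (net.arrEpoch p.1 p.2 e) t, fun i => residual (net.actEpoch p.1 p.2 i) t)

/-- `π` is a stationary (invariant) distribution of the autonomous queue. -/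
structure IsStationaryDistribution (net : AutonomousNetwork d) (π : Measure net.QState) : Prop where
  prob : IsProbabilityMeasure π
  clocks_pos : ∀ᵐ z ∂π, (∀ e, 0 < z.2.1 e) ∧ ∀ i, 0 < z.2.2 i
  invariant : ∃ Y : net.QState × net.Drive → ℝ → Fin d → ℕ, net.IsAutonomousQueue π Y ∧
    ∀ t : ℝ, 0 ≤ t → (π.prod net.driveLaw).map (net.stateAt Y t) = π

end AutonomousNetwork

/-! ### Two-sided stationary renewal processes and the reversed queue -/

/-- `… < A(-1) < 0 < A(0) < A(1) < …` are the points of a two-sided, time-stationary renewal point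
process with interarrival law `m`: the intervals between the points after `0` are i.i.d. with law
`m` and independent of the points up to `A(0)`, and the joint law of the numbers of points in
intervals is invariant under translation. -/
structure IsStationaryRenewal {Ω : Type*} [MeasurableSpace Ω] (P : Measure Ω) (m : Measure ℝ)
    (A : Ω → ℤ → ℝ) : Prop where
  measurable : ∀ n, Measurable fun ω => A ω n
  strictMono : ∀ᵐ ω ∂P, StrictMono (A ω)
  tendsto_atTop : ∀ᵐ ω ∂P, Tendsto (A ω) atTop atTop
  tendsto_atBot : ∀ᵐ ω ∂P, Tendsto (A ω) atBot atBot
  around_zero : ∀ᵐ ω ∂P, A ω (-1) < 0 ∧ 0 < A ω 0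
  interval_law : ∀ n : ℕ, P.map (fun ω => A ω (n + 1) - A ω n) = m
  interval_indep : iIndepFun (fun (n : ℕ) ω => A ω (n + 1) - A ω n) P
  indep_past : IndepFun (fun ω (n : ℕ) => A ω (-n)) (fun ω (n : ℕ) => A ω (n + 1) - A ω n) P
  stationary : ∀ h : ℝ,
    P.map (fun ω (I : ℝ × ℝ) => {n : ℤ | A ω n ∈ Set.Ioc (I.1 + h) (I.2 + h)}.ncard)
      = P.map (fun ω (I : ℝ × ℝ) => {n : ℤ | A ω n ∈ Set.Ioc I.1 I.2}.ncard)

/-- Number of the points `a n` with `p n` in `[0, t]` if `t ≥ 0`, and minus their number in `[t, 0)`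
if `t < 0`. -/
def twoSidedCount (a : ℤ → ℝ) (p : ℤ → Prop) (t : ℝ) : ℤ :=
  if 0 ≤ t then ({n : ℤ | a n ∈ Set.Icc 0 t ∧ p n}.ncard : ℤ)
  else -({n : ℤ | a n ∈ Set.Ico t 0 ∧ p n}.ncard : ℤ)

namespace AutonomousNetwork

variable {d : ℕ}

/-- Two-sided stationary input: stationary renewal processes `A e` and `B i` of external arrivals
and activity completions, with i.i.d. routing marks `r i n` attached to the points `B i n`,
everything mutually independent. -/
structure IsStationaryInput (net : AutonomousNetwork d) {Ω : Type*} [MeasurableSpace Ω]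
    (P : Measure Ω) (A : net.Src → Ω → ℤ → ℝ) (B : Fin d → Ω → ℤ → ℝ)
    (r : Fin d → Ω → ℤ → Fin (d + 1)) : Prop where
  arr : ∀ e, IsStationaryRenewal P (net.arrLaw e : Measure ℝ) (A e)
  act : ∀ i, IsStationaryRenewal P (net.actLaw i : Measure ℝ) (B i)
  mark_measurable : ∀ i n, Measurable fun ω => r i ω n
  mark_law : ∀ i n, P.map (fun ω => r i ω n) = (net.route i).toMeasure
  arr_indep : iIndepFun A P
  act_indep : iIndepFun B P
  mark_indep : iIndepFun (fun (k : Fin d × ℤ) ω => r k.1 ω k.2) P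
  act_mark_indep : IndepFun (fun ω i => B i ω) (fun ω i => r i ω) P
  arr_rest_indep :
    IndepFun (fun ω e => A e ω) (fun ω => ((fun i => B i ω), (fun i => r i ω))) P

/-- `X̄_i(t) = N̄_i(t) + ∑_{j ≠ i} D̄_{j,i}(t) - D̄_i(t)` for one realization of the two-sided
input. -/
def Xbar (net : AutonomousNetwork d) (a : net.Src → ℤ → ℝ) (b : Fin d → ℤ → ℝ)
    (r : Fin d → ℤ → Fin (d + 1)) (i : Fin d) (t : ℝ) : ℤ :=
  (if h : 0 < net.lam i then twoSidedCount (a ⟨i, h⟩) (fun _ => True) t else 0)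
    + ∑ j ∈ Finset.univ.erase i, twoSidedCount (b j) (fun n => r j n = i.succ) t
    - twoSidedCount (b i) (fun _ => True) t

/-- `Ȳ'_i(-t) = -X̄_i(t) + sup_{s ≥ t} X̄_i(s)`. -/
def YbarRev (net : AutonomousNetwork d) (a : net.Src → ℤ → ℝ) (b : Fin d → ℤ → ℝ)
    (r : Fin d → ℤ → Fin (d + 1)) (t : ℝ) (i : Fin d) : ℤ :=
  -net.Xbar a b r i t + sSup (net.Xbar a b r i '' Set.Ici t)

end AutonomousNetwork

end

/-!
# Stationary distribution and time reversal of a network of autonomous queues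

Every station is driven by renewal clocks, one for its external arrivals and one for its activity
completions, and the completions carry independent routing marks. The clocks do not depend on the
queue lengths. Hence, given the clocks, the queue at `i` is the reflection at `0` of the net input
`X_i` (arrivals and routed completions minus own completions), see `QueueInput.solution_iff` and
`isSolution_iff`; the equation of the queues has exactly one solution, given by a running supremum.

*Stationary clocks.* The residual times of independent clocks have exactly one invariant law, the
product of the equilibrium laws with density `rate * m (x, ∞)`
(`eq_pi_equilibriumLaw_of_invariant`). This needs that bounded Lipschitz solutions `G` of the renewal
equation converge (`tendsto_harmonic_of_lipschitz`). An energy estimate (`integrable_energy`) shows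
that `∫ (G (s - u) - G (s - v))² ds` is finite for almost all pairs of intervals `u`, `v`, so that
`u - v` is an asymptotic period of `G`. The asymptotic periods form a group, which is not countable
since the interval law has no atoms, hence is dense, and by the Lipschitz bound all shifts are
asymptotic periods. A conserved window integral then identifies the limit.

*Markov property.* Splicing fresh intervals and marks after the epochs up to time `t` preserves the
law of the clocks (`measurePreserving_spliceClock`), and the evolution over `t + s` splits accordingly
(`evolve_splicePaths`). This gives the Markov property `Assumptions.map_markov`.

*Time reversal.* A stationary marked clock, recorded together with the interval that covers `0`, is
invariant under reversal of `[0, L]` (`measurePreserving_reverseClock`). Under this reversal, the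
length at time `L - c` of the queue started empty becomes the supremum of `X_i s - X_i c` over
`s ∈ [c, L]` (`queuesAt_reverse_le_iff`). By the law of large numbers and the stability condition,
`X_i` tends to `-∞` (`Assumptions.ae_tendsto_netPath`), so that for large `L` this is the supremum
over all `s ≥ c`, and stays constant in `L` (`Typical.eventually_queuesAt`). No convergence of
functionals is needed, as all limits are of eventually constant sequences
(`eq_of_eventually_eq`).

*Conclusion.* The law of the limit state is invariant (`Assumptions.evolveLaw_equilibriumState`). It
is the only invariant law: the clocks of another one are stationary as well, and the queues forget
their initial lengths as soon as the net input has fallen far enough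
(`Invariant.eq_equilibriumState`). The same comparison at times `L + s_j` yields the
finite-dimensional laws of the stationary queue in terms of suprema of the net input
(`Invariant.map_queuesAt`). Finally, the two-sided stationary input restricted to `[0, ∞)` consists
of equilibrium clocks (`IsStationaryInput.measurePreserving`), and its suprema are those of the
reversed process (`IsStationaryInput.identDistrib`).
-/

noncomputable section

/-! ### A renewal theorem without lattice analysis -/

section Renewal

/-- A nonnegative Lipschitz function that is integrable on `(0, ∞)` vanishes at infinity. -/
lemma tendsto_zero_of_lipschitz_of_integrableOn {φ : ℝ → ℝ} {C : ℝ} (h0 : ∀ s, 0 ≤ φ s)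
    (hC : ∀ s r, |φ s - φ r| ≤ C * |s - r|) (hint : IntegrableOn φ (Set.Ioi 0)) :
    Tendsto φ atTop (𝓝 0) := by
  have hcont : Continuous φ := by
    have : LipschitzWith (Real.toNNReal C) φ := LipschitzWith.of_dist_le' (fun s r => by
      simpa [Real.dist_eq] using hC s r)
    exact this.continuous
  have hC0 : 0 ≤ C := by
    have := (abs_nonneg _).trans (hC 1 0)
    simpa using this
  rw [Metric.tendsto_atTop]
  intro ε hε
  obtain ⟨δ, hδ, hδC⟩ : ∃ δ : ℝ, 0 < δ ∧ C * δ < ε / 2 := by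
    refine ⟨ε / (2 * (C + 1)), by positivity, ?_⟩
    rw [mul_div_assoc', div_lt_div_iff₀ (by positivity) (by norm_num)]
    nlinarith
  have hF : Tendsto (fun s : ℝ => ∫ r in (0 : ℝ)..s, φ r) atTop (𝓝 (∫ r in Set.Ioi 0, φ r)) :=
    intervalIntegral_tendsto_integral_Ioi 0 hint tendsto_id
  have hF2 : Tendsto (fun s : ℝ => (∫ r in (0 : ℝ)..(s + δ), φ r) - ∫ r in (0 : ℝ)..s, φ r)
      atTop (𝓝 0) := by
    have := (hF.comp (tendsto_atTop_add_const_right _ δ tendsto_id)).sub hF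
    simpa using this
  have hev := hF2.eventually (gt_mem_nhds (show 0 < δ * (ε / 2) by positivity))
  obtain ⟨N, hN⟩ := eventually_atTop.1 hev
  refine ⟨N, fun s hs => ?_⟩
  rw [Real.dist_eq, sub_zero, abs_of_nonneg (h0 s)]
  have h1 := hN s hs
  rw [intervalIntegral.integral_interval_sub_left (hcont.intervalIntegrable _ _)
    (hcont.intervalIntegrable _ _)] at h1
  have h2 : ∫ r in s..(s + δ), (φ s - C * δ) ≤ ∫ r in s..(s + δ), φ r := by
    apply intervalIntegral.integral_mono_on (by linarith) (by simp) (hcont.intervalIntegrable _ _)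
    intro r hr
    have := (abs_le.1 (hC s r)).2
    have h3 : |s - r| ≤ δ := by rw [abs_le]; constructor <;> linarith [hr.1, hr.2]
    nlinarith
  rw [intervalIntegral.integral_const, smul_eq_mul] at h2
  have h3 : δ * (φ s - C * δ) < δ * (ε / 2) := by
    have : (s + δ - s) = δ := by ring
    rw [this] at h2
    linarith
  have := lt_of_mul_lt_mul_left h3 hδ.le
  linarith

variable {m : Measure ℝ} [IsProbabilityMeasure m]

lemma integrable_of_bdd {α : Type*} [MeasurableSpace α] {ν : Measure α} [IsFiniteMeasure ν]
    {g : α → ℝ} {K : ℝ} (hg : Measurable g) (hb : ∀ s, |g s| ≤ K) : Integrable g ν :=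
  Integrable.of_bound hg.aestronglyMeasurable K (Eventually.of_forall hb)

lemma intervalIntegrable_of_bdd {g : ℝ → ℝ} {K : ℝ} (hg : Measurable g) (hb : ∀ s, |g s| ≤ K)
    (a b : ℝ) : IntervalIntegrable g volume a b :=
  ⟨integrable_of_bdd hg hb, integrable_of_bdd hg hb⟩

lemma abs_intervalIntegral_le_of_bdd {g : ℝ → ℝ} {K : ℝ} (hb : ∀ s, |g s| ≤ K)
    (a b : ℝ) : |∫ s in a..b, g s| ≤ K * |b - a| := by
  rw [← Real.norm_eq_abs]
  exact intervalIntegral.norm_integral_le_of_norm_le_const fun x _ => hb x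

lemma measurable_intervalIntegral_sub {g : ℝ → ℝ} {K : ℝ} (hg : Measurable g)
    (hb : ∀ s, |g s| ≤ K) (t : ℝ) : Measurable fun u => ∫ s in (t - u)..t, g s := by
  have h : Continuous fun u => ∫ s in t..u, g s :=
    intervalIntegral.continuous_primitive (fun a b => intervalIntegrable_of_bdd hg hb a b) t
  have h2 : (fun u => ∫ s in (t - u)..t, g s) = fun u => - ∫ s in t..(t - u), g s := by
    ext u; rw [intervalIntegral.integral_symm]
  rw [h2]
  exact (h.comp (by fun_prop : Continuous fun u : ℝ => t - u)).neg.measurable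

omit [IsProbabilityMeasure m] in
lemma integrable_intervalIntegral_sub (hint : Integrable (fun x : ℝ => x) m) {g : ℝ → ℝ} {K : ℝ}
    (hg : Measurable g) (hb : ∀ s, |g s| ≤ K) (t : ℝ) :
    Integrable (fun u => ∫ s in (t - u)..t, g s) m := by
  refine (hint.norm.const_mul K).mono' (measurable_intervalIntegral_sub hg hb t).aestronglyMeasurable
    (Eventually.of_forall fun u => ?_)
  have := abs_intervalIntegral_le_of_bdd hb (t - u) t
  simpa using this

/-- The balance between the averages of `g` over the two windows of random length `U` that end at
`0` and at `T`. -/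
lemma integral_shift_sub (hint : Integrable (fun x : ℝ => x) m) {g : ℝ → ℝ} {K : ℝ}
    (hg : Measurable g) (hb : ∀ s, |g s| ≤ K) (T : ℝ) :
    ∫ s in (0 : ℝ)..T, ((∫ u, g (s - u) ∂m) - g s)
      = (∫ u, (∫ s in (0 - u)..0, g s) ∂m) - ∫ u, (∫ s in (T - u)..T, g s) ∂m := by
  have hm2 : Measurable fun p : ℝ × ℝ => g (p.1 - p.2) := hg.comp (by fun_prop)
  have hmE : Measurable fun s => ∫ u, g (s - u) ∂m :=
    (hm2.stronglyMeasurable.integral_prod_right (ν := m)).measurable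
  have hbE : ∀ s, |∫ u, g (s - u) ∂m| ≤ K := fun s => by
    have := norm_integral_le_of_norm_le_const (μ := m) (f := fun u => g (s - u)) (C := K)
      (Eventually.of_forall fun u => hb _)
    simpa using this
  rw [intervalIntegral.integral_sub (intervalIntegrable_of_bdd hmE hbE _ _)
    (intervalIntegrable_of_bdd hg hb _ _)]
  have : IsFiniteMeasure (volume.restrict (Set.uIoc (0 : ℝ) T)) := by
    rw [Set.uIoc]; infer_instance
  rw [intervalIntegral_integral_swap (integrable_of_bdd hm2 fun p => hb _)]
  have h1 : ∀ u, ∫ s in (0 : ℝ)..T, g (s - u)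
      = (∫ s in (0 - u)..0, g s) + (∫ s in (0 : ℝ)..T, g s) - ∫ s in (T - u)..T, g s := by
    intro u
    rw [intervalIntegral.integral_comp_sub_right g u]
    have i := intervalIntegrable_of_bdd hg hb
    rw [intervalIntegral.integral_add_adjacent_intervals (i _ _) (i _ _),
      ← intervalIntegral.integral_add_adjacent_intervals (i (0 - u) (T - u)) (i (T - u) T)]
    ring
  simp_rw [h1]
  rw [integral_sub, integral_add]
  · simp only [integral_const, probReal_univ, one_smul]
    ring
  · exact integrable_intervalIntegral_sub hint hg hb 0
  · exact integrable_const _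
  · exact (integrable_intervalIntegral_sub hint hg hb 0).add (integrable_const _)
  · exact integrable_intervalIntegral_sub hint hg hb T

/-- Spatial average of a harmonic function over a window of length `U`: it does not move. -/
lemma integral_window_const (hint : Integrable (fun x : ℝ => x) m) {G : ℝ → ℝ} {K : ℝ}
    (hg : Measurable G) (hb : ∀ s, |G s| ≤ K) (harm : ∀ s, 0 ≤ s → G s = ∫ u, G (s - u) ∂m)
    {T : ℝ} (hT : 0 ≤ T) :
    ∫ u, (∫ s in (T - u)..T, G s) ∂m = ∫ u, (∫ s in (0 - u)..0, G s) ∂m := by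
  have h := integral_shift_sub hint hg hb T
  have h0 : ∫ s in (0 : ℝ)..T, ((∫ u, G (s - u) ∂m) - G s) = 0 := by
    rw [intervalIntegral.integral_congr (g := fun _ => 0)]
    · simp
    · intro s hs
      rw [Set.uIcc_of_le hT] at hs
      simp only
      rw [← harm s hs.1, sub_self]
  linarith

/-- Energy estimate: the time integral of the variance of `G (s - U)` is finite. -/
lemma integrable_energy (hint : Integrable (fun x : ℝ => x) m) {G : ℝ → ℝ} {K : ℝ}
    (hg : Measurable G) (hb : ∀ s, |G s| ≤ K) (harm : ∀ s, 0 ≤ s → G s = ∫ u, G (s - u) ∂m) :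
    Integrable (fun p : ℝ × (ℝ × ℝ) => (G (p.1 - p.2.1) - G (p.1 - p.2.2)) ^ 2)
      ((volume.restrict (Set.Ioi (0 : ℝ))).prod (m.prod m)) := by
  have hK : 0 ≤ K := (abs_nonneg _).trans (hb 0)
  have hmeas : Measurable fun p : ℝ × (ℝ × ℝ) => (G (p.1 - p.2.1) - G (p.1 - p.2.2)) ^ 2 := by
    have h1 : Measurable fun p : ℝ × (ℝ × ℝ) => G (p.1 - p.2.1) := hg.comp (by fun_prop)
    have h2 : Measurable fun p : ℝ × (ℝ × ℝ) => G (p.1 - p.2.2) := hg.comp (by fun_prop)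
    exact (h1.sub h2).pow_const 2
  have hbd : ∀ p : ℝ × (ℝ × ℝ), |(G (p.1 - p.2.1) - G (p.1 - p.2.2)) ^ 2| ≤ (2 * K) ^ 2 := by
    intro p
    rw [abs_pow]
    have : |G (p.1 - p.2.1) - G (p.1 - p.2.2)| ≤ 2 * K := by
      have := abs_sub (G (p.1 - p.2.1)) (G (p.1 - p.2.2))
      linarith [hb (p.1 - p.2.1), hb (p.1 - p.2.2)]
    gcongr
  rw [integrable_prod_iff hmeas.aestronglyMeasurable]
  refine ⟨Eventually.of_forall fun s => integrable_of_bdd (K := (2 * K) ^ 2)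
    (hmeas.comp measurable_prodMk_left) (fun p => hbd (s, p)), ?_⟩
  have hnorm : ∀ s : ℝ, ∀ y : ℝ × ℝ, ‖(G (s - y.1) - G (s - y.2)) ^ 2‖
      = (G (s - y.1) - G (s - y.2)) ^ 2 := fun s y => by
    rw [Real.norm_eq_abs, abs_of_nonneg (sq_nonneg _)]
  simp_rw [hnorm]
  set E : ℝ → ℝ := fun s => ∫ y : ℝ × ℝ, (G (s - y.1) - G (s - y.2)) ^ 2 ∂(m.prod m) with hE
  have hEm : Measurable E :=
    (hmeas.stronglyMeasurable.integral_prod_right (ν := m.prod m)).measurable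
  have hEb : ∀ s, |E s| ≤ (2 * K) ^ 2 := fun s => by
    have := norm_integral_le_of_norm_le_const (μ := m.prod m)
      (f := fun y : ℝ × ℝ => (G (s - y.1) - G (s - y.2)) ^ 2) (C := (2 * K) ^ 2)
      (Eventually.of_forall fun u => hbd (s, u))
    simpa using this
  have hE0 : ∀ s, 0 ≤ E s := fun s => integral_nonneg fun y => sq_nonneg _
  have hgs : ∀ s, Measurable fun u => G (s - u) := fun s => hg.comp (by fun_prop)
  have hgi : ∀ s, Integrable (fun u => G (s - u)) m := fun s =>
    integrable_of_bdd (hgs s) fun u => hb _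
  have hG2m : Measurable fun s => (G s) ^ 2 := hg.pow_const 2
  have hG2b : ∀ s, |(G s) ^ 2| ≤ K ^ 2 := fun s => by
    rw [abs_pow]; exact pow_le_pow_left₀ (abs_nonneg _) (hb s) 2
  have hg2i : ∀ s, Integrable (fun u => (G (s - u)) ^ 2) m := fun s =>
    integrable_of_bdd (hG2m.comp (by fun_prop)) fun u => hG2b _
  -- the variance identity, with two independent copies of `U`
  have hvar : ∀ s, 0 ≤ s → E s = 2 * ((∫ u, (G (s - u)) ^ 2 ∂m) - (G s) ^ 2) := by
    intro s hs
    have hexp : ∀ y : ℝ × ℝ, (G (s - y.1) - G (s - y.2)) ^ 2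
        = (G (s - y.1)) ^ 2 + (G (s - y.2)) ^ 2 - 2 * (G (s - y.1) * G (s - y.2)) := by
      intro y; ring
    simp only [hE]
    simp_rw [hexp]
    rw [integral_sub, integral_add, integral_const_mul,
      integral_fun_fst (fun u => G (s - u) ^ 2),
      integral_fun_snd (fun u => G (s - u) ^ 2),
      integral_prod_mul (fun u => G (s - u)) (fun u => G (s - u)), ← harm s hs]
    · simp; ring
    · exact (hg2i s).comp_fst m
    · exact (hg2i s).comp_snd m
    · exact ((hg2i s).comp_fst m).add ((hg2i s).comp_snd m)
    · exact ((hgi s).mul_prod (hgi s)).const_mul 2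
  refine integrableOn_Ioi_of_intervalIntegral_norm_bounded (4 * (K ^ 2 * ∫ u, |u| ∂m)) 0
    (fun n : ℝ => integrable_of_bdd hEm hEb) tendsto_id ?_
  filter_upwards [eventually_ge_atTop 0] with T hT
  simp only [id]
  have h1 : ∫ s in (0 : ℝ)..T, ‖E s‖
      = 2 * ∫ s in (0 : ℝ)..T, ((∫ u, (G (s - u)) ^ 2 ∂m) - (G s) ^ 2) := by
    rw [← intervalIntegral.integral_const_mul]
    apply intervalIntegral.integral_congr
    intro s hs
    rw [Set.uIcc_of_le hT] at hs
    simp only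
    rw [Real.norm_eq_abs, abs_of_nonneg (hE0 s), hvar s hs.1]
  rw [h1, integral_shift_sub hint hG2m hG2b T]
  have hlast : (∫ u, (∫ s in (0 - u)..0, (G s) ^ 2) ∂m) - ∫ u, (∫ s in (T - u)..T, (G s) ^ 2) ∂m
      ≤ 2 * (K ^ 2 * ∫ u, |u| ∂m) := by
    have hA : ∀ t, |∫ u, (∫ s in (t - u)..t, (G s) ^ 2) ∂m| ≤ K ^ 2 * ∫ u, |u| ∂m := by
      intro t
      rw [← integral_const_mul, ← Real.norm_eq_abs]
      refine norm_integral_le_of_norm_le (hint.abs.const_mul _) (Eventually.of_forall fun u => ?_)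
      have := abs_intervalIntegral_le_of_bdd hG2b (t - u) t
      simpa using this
    linarith [(abs_le.1 (hA 0)).2, (abs_le.1 (hA T)).1]
  linarith

/-- Convergence of harmonic functions of the renewal process. The energy estimate makes
`G (s + δ) - G s` vanish at infinity for all differences `δ` of interval lengths; since these do not
live on a countable subgroup, all `δ` are reached. -/
theorem tendsto_harmonic_of_lipschitz (hint : Integrable (fun x : ℝ => x) m)
    (hatom : ∀ x, m {x} = 0) (hmean : 0 < ∫ x, x ∂m) {G : ℝ → ℝ} {K C : ℝ}
    (hLip : ∀ s r, |G s - G r| ≤ C * |s - r|) (hb : ∀ s, |G s| ≤ K)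
    (harm : ∀ s, 0 ≤ s → G s = ∫ u, G (s - u) ∂m) :
    Tendsto G atTop (𝓝 ((∫ u, (∫ s in (0 - u)..0, G s) ∂m) / ∫ x, x ∂m)) := by
  have hK : 0 ≤ K := (abs_nonneg _).trans (hb 0)
  have hC0 : 0 ≤ C := by simpa using (abs_nonneg _).trans (hLip 1 0)
  have hcont : Continuous G := by
    have : LipschitzWith (Real.toNNReal C) G := LipschitzWith.of_dist_le' (fun s r => by
      simpa [Real.dist_eq] using hLip s r)
    exact this.continuous
  have hg : Measurable G := hcont.measurable
  -- `S` is the group of asymptotic periods of `G`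
  let S : AddSubgroup ℝ :=
    { carrier := {δ | Tendsto (fun s => G (s + δ) - G s) atTop (𝓝 0)}
      zero_mem' := by simp
      add_mem' := by
        intro a b ha hb'
        have h1 := (ha.comp (tendsto_atTop_add_const_right _ b tendsto_id)).add hb'
        simp only [Set.mem_ofPred_eq]
        convert h1 using 2 with s
        · simp only [Function.comp_apply, id]
          rw [show s + b + a = s + (a + b) by ring]; ring
        · simp
      neg_mem' := by
        intro a ha
        have h1 := (ha.comp (tendsto_atTop_add_const_right _ (-a) tendsto_id)).neg
        simp only [Set.mem_ofPred_eq]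
        convert h1 using 2 with s
        · simp
        · simp }
  have hmemS : ∀ δ, δ ∈ S ↔ Tendsto (fun s => G (s + δ) - G s) atTop (𝓝 0) := fun δ => Iff.rfl
  -- by the energy estimate the difference of two independent intervals is an asymptotic period
  have hae : ∀ᵐ p : ℝ × ℝ ∂(m.prod m), p.1 - p.2 ∈ S := by
    have h1 := (integrable_energy hint hg hb harm).prod_left_ae
    filter_upwards [h1] with p hp
    have hD : ∀ s, |G (s - p.1) - G (s - p.2)| ≤ 2 * K := fun s => by
      have := abs_sub (G (s - p.1)) (G (s - p.2))
      linarith [hb (s - p.1), hb (s - p.2)]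
    have h2 : Tendsto (fun s => (G (s - p.1) - G (s - p.2)) ^ 2) atTop (𝓝 0) := by
      refine tendsto_zero_of_lipschitz_of_integrableOn (C := (4 * K) * (2 * C))
        (fun s => sq_nonneg _) (fun s r => ?_) hp
      have e : (G (s - p.1) - G (s - p.2)) ^ 2 - (G (r - p.1) - G (r - p.2)) ^ 2
          = ((G (s - p.1) - G (s - p.2)) + (G (r - p.1) - G (r - p.2)))
            * ((G (s - p.1) - G (r - p.1)) - (G (s - p.2) - G (r - p.2))) := by ring
      rw [e, abs_mul, mul_assoc]
      refine mul_le_mul ?_ ?_ (abs_nonneg _) (by positivity)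
      · have := abs_add_le (G (s - p.1) - G (s - p.2)) (G (r - p.1) - G (r - p.2))
        linarith [hD s, hD r]
      · have h3 := hLip (s - p.1) (r - p.1)
        have h4 := hLip (s - p.2) (r - p.2)
        rw [show s - p.1 - (r - p.1) = s - r by ring] at h3
        rw [show s - p.2 - (r - p.2) = s - r by ring] at h4
        have := abs_sub (G (s - p.1) - G (r - p.1)) (G (s - p.2) - G (r - p.2))
        linarith
    have h3 : Tendsto (fun s => G (s - p.1) - G (s - p.2)) atTop (𝓝 0) := by
      rw [tendsto_zero_iff_abs_tendsto_zero]
      have := (Real.continuous_sqrt.tendsto 0).comp h2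
      simpa [Function.comp_def, Real.sqrt_sq_eq_abs] using this
    have h4 := (h3.comp (tendsto_atTop_add_const_right _ p.1 tendsto_id)).neg
    rw [hmemS]
    convert h4 using 2 with s
    · simp only [Function.comp_apply, id]
      rw [show s + p.1 - p.1 = s by ring, show s + p.1 - p.2 = s + (p.1 - p.2) by ring]; ring
    · simp
  -- such a difference has no atoms, so a countable group would have probability zero
  have hnc : ¬ (S : Set ℝ).Countable := by
    intro hc
    have hms : MeasurableSet {p : ℝ × ℝ | p.1 - p.2 ∈ (S : Set ℝ)} :=
      (measurable_fst.sub measurable_snd) hc.measurableSet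
    have h0 : m.prod m {p : ℝ × ℝ | p.1 - p.2 ∈ (S : Set ℝ)} = 0 := by
      rw [Measure.measure_prod_null hms]
      refine Eventually.of_forall fun x => ?_
      have h5 : (Prod.mk x ⁻¹' {p : ℝ × ℝ | p.1 - p.2 ∈ (S : Set ℝ)}).Countable := by
        refine (hc.preimage_of_injOn (f := fun y => x - y) ?_)
        intro a _ b _ hab
        simpa using hab
      have : ∀ A : Set ℝ, A.Countable → m A = 0 := by
        intro A hA
        rw [← Set.biUnion_of_singleton A]
        exact (measure_biUnion_null_iff hA).2 fun x _ => hatom x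
      exact this _ h5
    have h3 : (m.prod m) Set.univ ≤ 0 := by
      rw [← Set.union_compl_self {p : ℝ × ℝ | p.1 - p.2 ∈ (S : Set ℝ)}]
      refine (measure_union_le _ _).trans ?_
      rw [h0, zero_add]
      exact (ae_iff.1 hae).le
    simp at h3
  -- a subgroup of the line is dense or cyclic
  have hdense : Dense (S : Set ℝ) := by
    rcases S.dense_or_cyclic with h | ⟨a, ha⟩
    · exact h
    · exfalso
      apply hnc
      rw [ha, ← AddSubgroup.zmultiples_eq_closure]
      exact Set.countable_range _
  -- by the Lipschitz bound the asymptotic periods form a closed set, hence are all of `ℝ`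
  have hall : ∀ δ, Tendsto (fun s => G (s + δ) - G s) atTop (𝓝 0) := by
    intro δ
    rw [Metric.tendsto_atTop]
    intro ε hε
    obtain ⟨δ', hδ', hd⟩ := hdense.exists_dist_lt δ (show 0 < ε / (2 * (C + 1)) by positivity)
    obtain ⟨N, hN⟩ := (Metric.tendsto_atTop.1 ((hmemS δ').1 hδ')) (ε / 2) (by positivity)
    refine ⟨N, fun s hs => ?_⟩
    have h1 := hN s hs
    rw [Real.dist_eq, sub_zero] at h1 ⊢
    have h2 := hLip (s + δ) (s + δ')
    rw [show s + δ - (s + δ') = δ - δ' by ring, ← Real.dist_eq] at h2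
    have h3 : C * dist δ δ' < ε / 2 := by
      have : C * dist δ δ' ≤ C * (ε / (2 * (C + 1))) := by gcongr
      refine this.trans_lt ?_
      rw [mul_div_assoc', div_lt_div_iff₀ (by positivity) (by norm_num)]
      nlinarith
    have := abs_add_le (G (s + δ) - G (s + δ')) (G (s + δ') - G s)
    rw [show G (s + δ) - G (s + δ') + (G (s + δ') - G s) = G (s + δ) - G s by ring] at this
    rw [Real.dist_eq] at h2 h3
    linarith
  -- compare the window average of `G` with its value at the end of the window
  have hdiff : Tendsto (fun t => ∫ u, (∫ s in (t - u)..t, (G s - G t)) ∂m) atTop (𝓝 0) := by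
    have h0 : ∀ u, Tendsto (fun t => ∫ s in (t - u)..t, (G s - G t)) atTop (𝓝 0) := by
      intro u
      have h1 : ∀ t, ∫ s in (t - u)..t, (G s - G t) = ∫ s in (-u)..0, (G (t + s) - G t) := by
        intro t
        rw [intervalIntegral.integral_comp_add_left (fun s => G s - G t) t]
        simp [sub_eq_add_neg]
      simp_rw [h1]
      have h2 := intervalIntegral.tendsto_integral_filter_of_dominated_convergence
        (μ := volume) (a := -u) (b := 0) (l := atTop) (F := fun t s => G (t + s) - G t)
        (f := fun _ => 0)
        (fun _ => 2 * K) (Eventually.of_forall fun t =>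
          (by fun_prop : Continuous fun s => G (t + s) - G t).aestronglyMeasurable)
        (Eventually.of_forall fun t => Eventually.of_forall fun s _ => by
          have := abs_sub (G (t + s)) (G t)
          rw [Real.norm_eq_abs]
          linarith [hb (t + s), hb t]) (by simp)
        (Eventually.of_forall fun s _ => hall s)
      simpa using h2
    have hbG : ∀ t s, |G s - G t| ≤ 2 * K := fun t s => by
      have := abs_sub (G s) (G t)
      linarith [hb s, hb t]
    have h2 := tendsto_integral_filter_of_dominated_convergence (μ := m) (l := atTop)
      (F := fun t u => ∫ s in (t - u)..t, (G s - G t)) (f := fun _ => 0)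
      (fun u => 2 * K * |u|) (Eventually.of_forall fun t =>
        (measurable_intervalIntegral_sub (hg.sub_const (G t)) (hbG t) t).aestronglyMeasurable)
      (Eventually.of_forall fun t => Eventually.of_forall fun u => by
        have := abs_intervalIntegral_le_of_bdd (hbG t) (t - u) t
        simpa using this) (hint.norm.const_mul _) (Eventually.of_forall fun u => h0 u)
    simpa using h2
  set M := ∫ u, (∫ s in (0 - u)..0, G s) ∂m with hM
  have hcomb : ∀ t, 0 ≤ t → ∫ u, (∫ s in (t - u)..t, (G s - G t)) ∂m = M - G t * ∫ x, x ∂m := by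
    intro t ht
    have h1 : ∀ u, ∫ s in (t - u)..t, (G s - G t) = (∫ s in (t - u)..t, G s) - G t * u := by
      intro u
      rw [intervalIntegral.integral_sub (hcont.intervalIntegrable _ _) (by simp)]
      simp [mul_comm]
    simp_rw [h1]
    rw [integral_sub (integrable_intervalIntegral_sub hint hg hb t) (hint.const_mul _),
      integral_window_const hint hg hb harm ht, integral_const_mul]
  have h1 : Tendsto (fun t => (M - (M - G t * ∫ x, x ∂m)) / ∫ x, x ∂m) atTop
      (𝓝 ((M - 0) / ∫ x, x ∂m)) := by
    refine (tendsto_const_nhds.sub (hdiff.congr' ?_)).div_const _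
    filter_upwards [eventually_ge_atTop 0] with t ht using hcomb t ht
  rw [sub_zero] at h1
  refine h1.congr fun t => ?_
  rw [sub_sub_cancel, mul_div_assoc, div_self hmean.ne', mul_one]

/-- Forward moving average over a window of length `ε`. -/
def movingAverage (ε : ℝ) (G : ℝ → ℝ) (s : ℝ) : ℝ := ε⁻¹ * ∫ r in (0 : ℝ)..ε, G (s + r)

lemma measurable_movingAverage {ε : ℝ} (hε : 0 < ε) {G : ℝ → ℝ} (hG : Measurable G) :
    Measurable (movingAverage ε G) := by
  unfold movingAverage
  simp_rw [intervalIntegral.integral_of_le hε.le]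
  have h : Measurable fun p : ℝ × ℝ => G (p.1 + p.2) := hG.comp (by fun_prop)
  exact (h.stronglyMeasurable.integral_prod_right
    (ν := volume.restrict (Set.Ioc 0 ε))).measurable.const_mul _

lemma abs_movingAverage_le {ε : ℝ} (hε : 0 < ε) {G : ℝ → ℝ} {K : ℝ} (hb : ∀ s, |G s| ≤ K)
    (s : ℝ) : |movingAverage ε G s| ≤ K := by
  rw [movingAverage, abs_mul, abs_of_pos (inv_pos.2 hε)]
  have h1 := abs_intervalIntegral_le_of_bdd (fun r => hb (s + r)) 0 ε
  rw [sub_zero, abs_of_pos hε] at h1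
  calc _ ≤ ε⁻¹ * (K * ε) := by gcongr
    _ = K := by field_simp

lemma movingAverage_harmonic {ε : ℝ} (hε : 0 < ε) {G : ℝ → ℝ} {K : ℝ} (hg : Measurable G)
    (hb : ∀ s, |G s| ≤ K) (harm : ∀ s, 0 ≤ s → G s = ∫ u, G (s - u) ∂m) {s : ℝ} (hs : 0 ≤ s) :
    movingAverage ε G s = ∫ u, movingAverage ε G (s - u) ∂m := by
  unfold movingAverage
  rw [integral_const_mul]
  congr 1
  have : IsFiniteMeasure (volume.restrict (Set.uIoc (0 : ℝ) ε)) := by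
    rw [Set.uIoc]; infer_instance
  have hm2 : Measurable fun p : ℝ × ℝ => G (s - p.2 + p.1) := hg.comp (by fun_prop)
  rw [← intervalIntegral_integral_swap (f := fun r u => G (s - u + r))
    (integrable_of_bdd hm2 fun p => hb _)]
  apply intervalIntegral.integral_congr
  intro r hr
  rw [Set.uIcc_of_le hε.le] at hr
  simp only
  rw [harm (s + r) (by linarith [hr.1])]
  congr 1
  ext u
  rw [show s + r - u = s - u + r by ring]

/-- The moving averages of a bounded harmonic function converge, and their limit is the one of the
window averages. -/
theorem tendsto_movingAverage_harmonic (hint : Integrable (fun x : ℝ => x) m)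
    (hatom : ∀ x, m {x} = 0) (hmean : 0 < ∫ x, x ∂m) {G : ℝ → ℝ} {K : ℝ}
    (hg : Measurable G) (hb : ∀ s, |G s| ≤ K)
    (harm : ∀ s, 0 ≤ s → G s = ∫ u, G (s - u) ∂m) {ε : ℝ} (hε : 0 < ε) :
    Tendsto (movingAverage ε G) atTop
      (𝓝 ((∫ u, (∫ s in (0 - u)..0, movingAverage ε G s) ∂m) / ∫ x, x ∂m)) := by
  have hi := intervalIntegrable_of_bdd hg hb
  have hsh : ∀ t, ∫ r in (0 : ℝ)..ε, G (t + r) = ∫ r in t..(t + ε), G r := fun t => by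
    rw [intervalIntegral.integral_comp_add_left]; simp
  refine tendsto_harmonic_of_lipschitz (K := K) (C := ε⁻¹ * (2 * K)) hint hatom hmean ?_
    (abs_movingAverage_le hε hb) fun s hs => movingAverage_harmonic hε hg hb harm hs
  intro s r
  unfold movingAverage
  rw [← mul_sub, abs_mul, abs_of_pos (inv_pos.2 hε), mul_assoc]
  refine mul_le_mul_of_nonneg_left ?_ (inv_pos.2 hε).le
  rw [hsh, hsh]
  have e : (∫ x in s..(s + ε), G x) - ∫ x in r..(r + ε), G x
      = (∫ x in (r + ε)..(s + ε), G x) - ∫ x in r..s, G x := by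
    have h1 := intervalIntegral.integral_add_adjacent_intervals (hi r s) (hi s (s + ε))
    have h2 := intervalIntegral.integral_add_adjacent_intervals (hi r (r + ε)) (hi (r + ε) (s + ε))
    linarith
  rw [e]
  have h1 := abs_intervalIntegral_le_of_bdd hb (r + ε) (s + ε)
  have h2 := abs_intervalIntegral_le_of_bdd hb r s
  rw [show s + ε - (r + ε) = s - r by ring] at h1
  have := abs_sub (∫ x in (r + ε)..(s + ε), G x) (∫ x in r..s, G x)
  linarith

end Renewal

/-! ### Independent sequences -/

section Sequences

variable {α : Type*} [MeasurableSpace α]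

/-- The law of an i.i.d. sequence with marginal law `m`. -/
abbrev seqLaw (m : Measure α) : Measure (ℕ → α) := Measure.infinitePi fun _ : ℕ => m

/-- The sequence that follows `p.1` on the indices below `n` and then starts reading `p.2`. -/
def spliceAt {α : Type*} (n : ℕ) (p : (ℕ → α) × (ℕ → α)) : ℕ → α :=
  fun k => if k < n then p.1 k else p.2 (k - n)

lemma spliceAt_of_lt {α : Type*} {n k : ℕ} (h : k < n) (p : (ℕ → α) × (ℕ → α)) :
    spliceAt n p k = p.1 k := by simp [spliceAt, h]

lemma spliceAt_add {α : Type*} (n k : ℕ) (p : (ℕ → α) × (ℕ → α)) :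
    spliceAt n p (n + k) = p.2 k := by simp [spliceAt]

lemma measurable_spliceAt (n : ℕ) :
    Measurable (spliceAt n : (ℕ → α) × (ℕ → α) → ℕ → α) := by
  refine measurable_pi_lambda _ fun k => ?_
  by_cases h : k < n
  · simp only [spliceAt, h, if_true]; fun_prop
  · simp only [spliceAt, h, if_false]; fun_prop

/-- Replacing the terms of an i.i.d. sequence from a fixed index on by an independent copy does not
change its law. -/
lemma measurePreserving_spliceAt (m : Measure α) [IsProbabilityMeasure m] (n : ℕ) :
    MeasurePreserving (spliceAt n) ((seqLaw m).prod (seqLaw m)) (seqLaw m) := by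
  refine ⟨measurable_spliceAt n, ?_⟩
  apply Measure.eq_infinitePi
  intro s t ht
  rw [Measure.map_apply (measurable_spliceAt n) (MeasurableSet.pi s.countable_toSet fun i _ => ht i)]
  have hpre : spliceAt n ⁻¹' (Set.pi s t)
      = (Set.pi ((s.filter (· < n) : Finset ℕ) : Set ℕ) t) ×ˢ
        (Set.pi (((s.filter (¬ · < n)).image (· - n) : Finset ℕ) : Set ℕ) fun k => t (n + k)) := by
    ext p
    simp only [Set.mem_preimage, Set.mem_pi, Set.mem_prod, Finset.mem_coe, Finset.mem_filter,
      Finset.mem_image]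
    constructor
    · intro h
      refine ⟨fun i hi => ?_, ?_⟩
      · have := h i hi.1
        rwa [spliceAt_of_lt hi.2] at this
      · rintro _ ⟨i, hi, rfl⟩
        have := h i hi.1
        have e : i = n + (i - n) := by omega
        rw [e, spliceAt_add] at this
        exact this
    · rintro ⟨h1, h2⟩ i hi
      by_cases hn : i < n
      · rw [spliceAt_of_lt hn]; exact h1 i ⟨hi, hn⟩
      · have e : i = n + (i - n) := by omega
        rw [e, spliceAt_add]
        exact h2 _ ⟨i, ⟨hi, hn⟩, rfl⟩
  rw [hpre, Measure.prod_prod, Measure.infinitePi_pi _ fun i _ => ht i,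
    Measure.infinitePi_pi _ fun i _ => ht _, Finset.prod_image]
  · rw [← Finset.prod_filter_mul_prod_filter_not s (· < n)]
    congr 1
    refine Finset.prod_congr rfl fun i hi => ?_
    have : n + (i - n) = i := by have := (Finset.mem_filter.1 hi).2; omega
    rw [this]
  · intro i hi j hj hij
    have h1 := (Finset.mem_filter.1 hi).2
    have h2 := (Finset.mem_filter.1 hj).2
    simp only at hij
    omega

lemma measurePreserving_eval_seqLaw (m : Measure α) [IsProbabilityMeasure m] (n : ℕ) :
    MeasurePreserving (fun u : ℕ → α => u n) (seqLaw m) m :=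
  measurePreserving_eval_infinitePi (fun _ : ℕ => m) n

lemma measurePreserving_reindex_seqLaw (m : Measure α) [IsProbabilityMeasure m] {f : ℕ → ℕ}
    (hf : Function.Injective f) :
    MeasurePreserving (fun (u : ℕ → α) n => u (f n)) (seqLaw m) (seqLaw m) :=
  ⟨by fun_prop, Measure.map_infinitePi_infinitePi_of_inj (P := fun _ : ℕ => m) hf⟩

/-- The cardinality of a random set of indices is measurable. -/
lemma measurable_ncard_setOf {Ω ι : Type*} [MeasurableSpace Ω] [Countable ι] {p : Ω → ι → Prop}
    (hp : ∀ n, MeasurableSet {ω | p ω n}) : Measurable fun ω => {n | p ω n}.ncard := by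
  refine measurable_ncard.comp (measurable_set_iff.2 fun n => ?_)
  exact measurableSet_setOfPred.1 (hp n)

end Sequences

/-! ### Epochs, counts and residual times -/

section Epochs

open AutonomousNetwork

/-- Strictly increasing epochs that tend to infinity. -/
structure GoodEpochs (e : ℕ → ℝ) : Prop where
  strictMono : StrictMono e
  tendsto : Tendsto e atTop atTop

/-- Positive intervals whose sum is infinite. -/
structure GoodIntervals (u : ℕ → ℝ) : Prop where
  pos : ∀ n, 0 < u n
  tendsto : Tendsto (fun n => ∑ k ∈ Finset.range n, u k) atTop atTop

lemma epoch_succ (a : ℝ) (u : ℕ → ℝ) (n : ℕ) : epoch a u (n + 1) = epoch a u n + u n := by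
  simp [epoch, Finset.sum_range_succ, add_assoc]

@[simp] lemma epoch_zero (a : ℝ) (u : ℕ → ℝ) : epoch a u 0 = a := by simp [epoch]

lemma GoodIntervals.goodEpochs {u : ℕ → ℝ} (hu : GoodIntervals u) (a : ℝ) :
    GoodEpochs (epoch a u) where
  strictMono := strictMono_nat_of_lt_succ fun n => by rw [epoch_succ]; linarith [hu.pos n]
  tendsto := tendsto_atTop_add_const_left _ a hu.tendsto

lemma GoodEpochs.exists_lt {e : ℕ → ℝ} (he : GoodEpochs e) (t : ℝ) : ∃ n, t < e n :=
  (he.tendsto.eventually_gt_atTop t).exists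

lemma GoodEpochs.finite {e : ℕ → ℝ} (he : GoodEpochs e) (t : ℝ) : {n | e n ≤ t}.Finite := by
  obtain ⟨N, hN⟩ := he.exists_lt t
  refine (Set.finite_Iio N).subset fun n hn => ?_
  by_contra h
  have := he.strictMono.monotone (not_lt.1 h)
  have h2 : e n ≤ t := hn
  linarith

lemma GoodEpochs.countUpTo_eq {e : ℕ → ℝ} (he : GoodEpochs e) {t : ℝ} {n : ℕ}
    (h1 : ∀ k < n, e k ≤ t) (h2 : t < e n) : countUpTo e t = n := by
  have : {k : ℕ | e k ≤ t} = Set.Iio n := by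
    ext k
    refine ⟨fun hk => ?_, fun hk => h1 k hk⟩
    by_contra h
    have := he.strictMono.monotone (not_lt.1 h)
    have h3 : e k ≤ t := hk
    linarith
  rw [countUpTo, this, ← Finset.coe_range, Set.ncard_coe_finset, Finset.card_range]

lemma GoodEpochs.lt_countUpTo_iff {e : ℕ → ℝ} (he : GoodEpochs e) {t : ℝ} {n : ℕ} :
    n < countUpTo e t ↔ e n ≤ t := by
  classical
  have hN := Nat.find_spec (he.exists_lt t)
  have h1 : ∀ k < Nat.find (he.exists_lt t), e k ≤ t := fun k hk =>
    not_lt.1 (Nat.find_min (he.exists_lt t) hk)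
  rw [he.countUpTo_eq h1 hN]
  refine ⟨h1 n, fun h => ?_⟩
  by_contra h'
  have := he.strictMono.monotone (not_lt.1 h')
  linarith

lemma GoodEpochs.lt_epoch_countUpTo {e : ℕ → ℝ} (he : GoodEpochs e) (t : ℝ) :
    t < e (countUpTo e t) := by
  by_contra h
  exact lt_irrefl _ (he.lt_countUpTo_iff.2 (not_lt.1 h))

lemma GoodEpochs.residual_pos {e : ℕ → ℝ} (he : GoodEpochs e) (t : ℝ) : 0 < residual e t :=
  sub_pos.2 (he.lt_epoch_countUpTo t)

lemma countUpTo_epoch (z : ℝ) (u : ℕ → ℝ) (t : ℝ) :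
    countUpTo (epoch z u) t = countUpTo (epoch 0 u) (t - z) := by
  unfold countUpTo epoch
  congr 1
  ext n
  simp only [Set.mem_ofPred_eq]
  constructor <;> intro h <;> linarith

lemma residual_epoch (z : ℝ) (u : ℕ → ℝ) (t : ℝ) :
    residual (epoch z u) t = residual (epoch 0 u) (t - z) := by
  unfold AutonomousNetwork.residual
  rw [countUpTo_epoch]
  unfold epoch
  ring

lemma epoch_spliceAt_of_le (a : ℝ) (u u' : ℕ → ℝ) {n k : ℕ} (h : k ≤ n) :
    epoch a (spliceAt n (u, u')) k = epoch a u k := by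
  unfold epoch
  congr 1
  refine Finset.sum_congr rfl fun j hj => ?_
  rw [spliceAt_of_lt (lt_of_lt_of_le (Finset.mem_range.1 hj) h)]

lemma epoch_spliceAt_add (a t : ℝ) (u u' : ℕ → ℝ) (n k : ℕ) :
    epoch a (spliceAt n (u, u')) (n + k) = t + epoch (epoch a u n - t) u' k := by
  have h := epoch_spliceAt_of_le a u u' (le_refl n)
  unfold epoch at h ⊢
  rw [Finset.sum_range_add, ← add_assoc, h]
  simp_rw [spliceAt_add]
  ring

lemma goodIntervals_spliceAt {u u' : ℕ → ℝ} (hu : GoodIntervals u) (hu' : GoodIntervals u')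
    (n : ℕ) : GoodIntervals (spliceAt n (u, u')) where
  pos k := by
    by_cases h : k < n
    · rw [spliceAt_of_lt h]; exact hu.pos k
    · simp only [spliceAt, h, if_false]; exact hu'.pos _
  tendsto := by
    rw [← tendsto_add_atTop_iff_nat n]
    have h : ∀ k, ∑ j ∈ Finset.range (k + n), spliceAt n (u, u') j
        = epoch (∑ j ∈ Finset.range n, u j) u' k := by
      intro k
      have := epoch_spliceAt_add 0 0 u u' n k
      rw [add_comm n k] at this
      simpa [epoch] using this
    simp_rw [h]
    exact (hu'.goodEpochs _).tendsto

/-- Splitting the points up to a time `T` into the first `n` ones and the others. -/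
lemma ncard_split {E : ℕ → ℝ} {Q : ℕ → Prop} {T : ℝ} {n : ℕ} (h : ∀ k < n, E k ≤ T)
    (hfin : {k | E k ≤ T}.Finite) :
    {k | E k ≤ T ∧ Q k}.ncard
      = {k | k < n ∧ Q k}.ncard + {k | E (n + k) ≤ T ∧ Q (n + k)}.ncard := by
  have himg : ((n + ·) '' {k | E (n + k) ≤ T ∧ Q (n + k)}).ncard
      = {k | E (n + k) ≤ T ∧ Q (n + k)}.ncard :=
    Set.ncard_image_of_injective _ (add_right_injective n)
  have hf1 : {k | k < n ∧ Q k}.Finite := (Set.finite_Iio n).subset fun k hk => hk.1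
  have hsub : (n + ·) '' {k | E (n + k) ≤ T ∧ Q (n + k)} ⊆ {k | E k ≤ T} := by
    rintro _ ⟨k, hk, rfl⟩; exact hk.1
  rw [← himg, ← Set.ncard_union_eq _ hf1 (hfin.subset hsub)]
  · congr 1
    ext k
    simp only [Set.mem_ofPred_eq, Set.mem_union, Set.mem_image]
    constructor
    · rintro ⟨h1, h2⟩
      by_cases hk : k < n
      · exact Or.inl ⟨hk, h2⟩
      · exact Or.inr ⟨k - n, by rw [Nat.add_sub_cancel' (not_lt.1 hk)]; exact ⟨h1, h2⟩,
          Nat.add_sub_cancel' (not_lt.1 hk)⟩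
    · rintro (⟨h1, h2⟩ | ⟨j, hj, rfl⟩)
      · exact ⟨h k h1, h2⟩
      · exact hj
  · rw [Set.disjoint_left]
    rintro _ ⟨hk, _⟩ ⟨j, _, rfl⟩
    simp only at hk
    omega

lemma countUpTo_eq_ncard (e : ℕ → ℝ) (t : ℝ) : countUpTo e t = {n | e n ≤ t ∧ True}.ncard := by
  simp [countUpTo]

/-- Marked counts of spliced sequences. -/
lemma ncard_spliceAt {M : Type*} {a t s : ℝ} {u u' : ℕ → ℝ} (hu : GoodIntervals u)
    (hu' : GoodIntervals u') {n : ℕ} (h1 : ∀ k < n, epoch a u k ≤ t) (hs : 0 ≤ s)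
    (Q : M → Prop) (r r' : ℕ → M) :
    {k | epoch a (spliceAt n (u, u')) k ≤ t + s ∧ Q (spliceAt n (r, r') k)}.ncard
      = {k | k < n ∧ Q (r k)}.ncard + {k | epoch (epoch a u n - t) u' k ≤ s ∧ Q (r' k)}.ncard := by
  have hg := (goodIntervals_spliceAt hu hu' n).goodEpochs a
  rw [ncard_split (n := n) (fun k hk => ?_) (hg.finite _)]
  · congr 2
    · ext k
      simp only [Set.mem_ofPred_eq]
      refine and_congr_right fun hk => ?_
      rw [spliceAt_of_lt hk]
    · ext k
      simp only [Set.mem_ofPred_eq]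
      rw [spliceAt_add, epoch_spliceAt_add a t]
      simp
  · rw [epoch_spliceAt_of_le a u u' hk.le]
    linarith [h1 k hk]

lemma countUpTo_spliceAt {a t s : ℝ} {u u' : ℕ → ℝ} (hu : GoodIntervals u)
    (hu' : GoodIntervals u') {n : ℕ} (h1 : ∀ k < n, epoch a u k ≤ t) (hs : 0 ≤ s) :
    countUpTo (epoch a (spliceAt n (u, u'))) (t + s)
      = n + countUpTo (epoch (epoch a u n - t) u') s := by
  have := ncard_spliceAt hu hu' h1 hs (fun _ : Unit => True) (fun _ => ()) (fun _ => ())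
  rw [countUpTo_eq_ncard, this, countUpTo_eq_ncard]
  congr 1
  have : {k : ℕ | k < n ∧ True} = ((Finset.range n : Finset ℕ) : Set ℕ) := by ext; simp
  rw [this, Set.ncard_coe_finset, Finset.card_range]

lemma residual_spliceAt {a t s : ℝ} {u u' : ℕ → ℝ} (hu : GoodIntervals u)
    (hu' : GoodIntervals u') {n : ℕ} (h1 : ∀ k < n, epoch a u k ≤ t) (hs : 0 ≤ s) :
    residual (epoch a (spliceAt n (u, u'))) (t + s)
      = residual (epoch (epoch a u n - t) u') s := by
  unfold AutonomousNetwork.residual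
  rw [countUpTo_spliceAt hu hu' h1 hs, epoch_spliceAt_add a t]
  ring

lemma measurable_epoch {Ω : Type*} [MeasurableSpace Ω] {a : Ω → ℝ} {u : Ω → ℕ → ℝ}
    (ha : Measurable a) (hu : Measurable u) (n : ℕ) : Measurable fun ω => epoch (a ω) (u ω) n := by
  unfold epoch
  exact ha.add (Finset.measurable_sum _ fun k _ => (measurable_pi_apply k).comp hu)

lemma measurable_countUpTo_epoch {Ω : Type*} [MeasurableSpace Ω] {a : Ω → ℝ} {u : Ω → ℕ → ℝ}
    {t : Ω → ℝ} (ha : Measurable a) (hu : Measurable u) (ht : Measurable t) :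
    Measurable fun ω => countUpTo (epoch (a ω) (u ω)) (t ω) :=
  measurable_ncard_setOf fun n => measurableSet_le (measurable_epoch ha hu n) ht

lemma measurable_epoch_index {Ω : Type*} [MeasurableSpace Ω] {a : Ω → ℝ} {u : Ω → ℕ → ℝ}
    {N : Ω → ℕ} (ha : Measurable a) (hu : Measurable u) (hN : Measurable N) :
    Measurable fun ω => epoch (a ω) (u ω) (N ω) := by
  have : Measurable fun p : Ω × ℕ => epoch (a p.1) (u p.1) p.2 :=
    measurable_from_prod_countable_left fun n => measurable_epoch ha hu n
  exact this.comp (measurable_id.prodMk hN)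

lemma measurable_residual_epoch {Ω : Type*} [MeasurableSpace Ω] {a : Ω → ℝ} {u : Ω → ℕ → ℝ}
    {t : Ω → ℝ} (ha : Measurable a) (hu : Measurable u) (ht : Measurable t) :
    Measurable fun ω => residual (epoch (a ω) (u ω)) (t ω) :=
  (measurable_epoch_index ha hu (measurable_countUpTo_epoch ha hu ht)).sub ht

end Epochs

/-! ### Renewal sequences -/

section RenewalSequences

variable {m : Measure ℝ} [IsProbabilityMeasure m] {rate : ℝ}

omit [IsProbabilityMeasure m] in
lemma IsRenewalLaw.ae_pos (hm : IsRenewalLaw m rate) : ∀ᵐ x ∂m, 0 < x := by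
  have h : m (Set.Iic 0) = 0 := by
    rw [← Set.Iio_union_right]
    exact measure_union_null hm.nonneg (hm.noAtoms 0)
  rw [ae_iff]
  convert h using 2
  ext x; simp

/-- Strong law of large numbers for an i.i.d. sequence. -/
lemma seqLaw_strongLaw {α : Type*} [MeasurableSpace α] (m : Measure α) [IsProbabilityMeasure m]
    {f : α → ℝ} (hfm : Measurable f) (hf : Integrable f m) :
    ∀ᵐ u ∂(seqLaw m), Tendsto (fun n : ℕ => (∑ k ∈ Finset.range n, f (u k)) / n) atTop
      (𝓝 (∫ x, f x ∂m)) := by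
  have hmp := fun n => measurePreserving_eval_seqLaw m n
  have hind : iIndepFun (fun (n : ℕ) (u : ℕ → α) => f (u n)) (seqLaw m) :=
    iIndepFun_infinitePi (P := fun _ : ℕ => m) (X := fun _ => f) (fun _ => hfm)
  have h := strong_law_ae_real (μ := seqLaw m) (fun n u => f (u n))
    ((hmp 0).integrable_comp_of_integrable hf) (fun i j hij => hind.indepFun hij) (fun n => ?_)
  · have e : ∫ u, f (u 0) ∂(seqLaw m) = ∫ x, f x ∂m := by
      have h1 := integral_map (μ := seqLaw m) (hmp 0).measurable.aemeasurable
        hfm.aestronglyMeasurable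
      rw [(hmp 0).map_eq] at h1
      exact h1.symm
    rw [e] at h
    exact h
  · refine ⟨((hfm.comp (measurable_pi_apply n))).aemeasurable,
      ((hfm.comp (measurable_pi_apply 0))).aemeasurable, ?_⟩
    have : ∀ n, (seqLaw m).map (fun u => f (u n)) = m.map f := fun n => by
      have h1 := Measure.map_map (μ := seqLaw m) hfm (hmp n).measurable
      rw [(hmp n).map_eq] at h1
      exact h1.symm
    rw [this n, this 0]

lemma IsRenewalLaw.ae_goodIntervals (hm : IsRenewalLaw m rate) (hr : 0 < rate) :
    ∀ᵐ u ∂(seqLaw m), GoodIntervals u := by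
  have h1 : ∀ᵐ u ∂(seqLaw m), ∀ n, 0 < u n := by
    rw [ae_all_iff]
    intro n
    exact (measurePreserving_eval_seqLaw m n).quasiMeasurePreserving.ae hm.ae_pos
  filter_upwards [h1, seqLaw_strongLaw m measurable_id hm.integrable] with u hu hlim
  refine ⟨hu, ?_⟩
  have hpos : 0 < ∫ x, x ∂m := by rw [hm.mean]; positivity
  have h2 := hlim.pos_mul_atTop hpos tendsto_natCast_atTop_atTop
  refine h2.congr' ?_
  filter_upwards [eventually_gt_atTop 0] with n hn
  simp only [id]
  field_simp

end RenewalSequences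

/-! ### The equilibrium law of a renewal process -/

section Equilibrium

/-- The law with density `rate * P(U > x)` on `[0, ∞)`, for `U` with law `m`, as the first
coordinate of a point chosen under the graph of `U`. -/
def equilibriumLaw (m : Measure ℝ) (rate : ℝ) : Measure ℝ :=
  (ENNReal.ofReal rate • (volume.prod m).restrict {p | 0 ≤ p.1 ∧ p.1 < p.2}).map Prod.fst

lemma measurableSet_window : MeasurableSet {p : ℝ × ℝ | 0 ≤ p.1 ∧ p.1 < p.2} :=
  (measurableSet_le measurable_const measurable_fst).inter
    (measurableSet_lt measurable_fst measurable_snd)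

variable {m : Measure ℝ} [IsProbabilityMeasure m] {rate : ℝ}

lemma equilibriumLaw_apply {s : Set ℝ} (hs : MeasurableSet s) :
    equilibriumLaw m rate s = ENNReal.ofReal rate * ∫⁻ u, volume (Set.Ico 0 u ∩ s) ∂m := by
  rw [equilibriumLaw, Measure.map_apply measurable_fst hs, Measure.smul_apply,
    Measure.restrict_apply (measurable_fst hs), Measure.prod_apply_symm
      ((measurable_fst hs).inter measurableSet_window), smul_eq_mul]
  congr 2
  ext u
  congr 1
  ext x
  simp [and_comm]

lemma isProbabilityMeasure_equilibriumLaw (hm : IsRenewalLaw m rate) (hr : 0 < rate) :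
    IsProbabilityMeasure (equilibriumLaw m rate) := by
  constructor
  rw [equilibriumLaw_apply MeasurableSet.univ]
  simp only [Set.inter_univ, Real.volume_Ico, sub_zero]
  rw [← ofReal_integral_eq_lintegral_ofReal hm.integrable
    (hm.ae_pos.mono fun x hx => hx.le), hm.mean, ← ENNReal.ofReal_mul hr.le,
    mul_one_div_cancel hr.ne', ENNReal.ofReal_one]

omit [IsProbabilityMeasure m] in
lemma equilibriumLaw_absolutelyContinuous [SFinite m] : equilibriumLaw m rate ≪ volume := by
  refine Measure.AbsolutelyContinuous.mk fun s hs h0 => ?_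
  rw [equilibriumLaw, Measure.map_apply measurable_fst hs, Measure.smul_apply, smul_eq_mul]
  refine mul_eq_zero_of_right _ ?_
  refine measure_mono_null (t := Prod.fst ⁻¹' s) subset_rfl ?_
  refine Measure.absolutelyContinuous_of_le Measure.restrict_le_self ?_
  rw [← Set.prod_univ, Measure.prod_prod, h0, zero_mul]

instance [SFinite m] : NullSingletonClass (equilibriumLaw m rate) :=
  ⟨fun x => equilibriumLaw_absolutelyContinuous (by simp)⟩

lemma equilibriumLaw_ae_pos : ∀ᵐ x ∂(equilibriumLaw m rate), 0 < x := by
  have h : equilibriumLaw m rate (Set.Iic 0) = 0 := by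
    rw [equilibriumLaw_apply measurableSet_Iic]
    refine mul_eq_zero_of_right _ ?_
    rw [lintegral_eq_zero_iff' (by
      have : ∀ u : ℝ, Set.Ico 0 u ∩ Set.Iic 0 = if 0 < u then {0} else ∅ := fun u => by
        ext x; split_ifs with h
        · simp only [Set.mem_inter_iff, Set.mem_Ico, Set.mem_Iic, Set.mem_singleton_iff]
          constructor
          · rintro ⟨⟨h1, _⟩, h3⟩; linarith
          · rintro rfl; exact ⟨⟨le_rfl, h⟩, le_rfl⟩
        · simp only [Set.mem_inter_iff, Set.mem_Ico, Set.mem_Iic, Set.mem_empty_iff_false,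
            iff_false]
          rintro ⟨⟨h1, h2⟩, h3⟩; linarith
      have h2 : (fun u : ℝ => volume (Set.Ico 0 u ∩ Set.Iic 0)) = fun _ => 0 := by
        ext u; rw [this]; split_ifs <;> simp
      rw [h2]; exact aemeasurable_const)]
    refine Eventually.of_forall fun u => ?_
    refine measure_mono_null (t := {0}) ?_ (by simp)
    rintro x ⟨⟨h1, _⟩, h3⟩
    exact le_antisymm h3 h1
  rw [ae_iff]
  convert h using 2
  ext x; simp

end Equilibrium

/-! ### Uniqueness of the stationary law of independent renewal clocks -/

section ClockUniqueness

open AutonomousNetwork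

variable {m : Measure ℝ} [IsProbabilityMeasure m] {rate : ℝ}

/-- The expected value of `f` at the residual time at `s` of the renewal process with a point at `0`
and interval law `m`; for `s < 0` this is `f (-s)`. -/
def residualMean (m : Measure ℝ) (f : ℝ → ℝ) (s : ℝ) : ℝ :=
  ∫ u, f (residual (epoch 0 u) s) ∂(seqLaw m)

lemma measurable_residual_zero :
    Measurable fun p : ℝ × (ℕ → ℝ) => residual (epoch 0 p.2) p.1 :=
  measurable_residual_epoch measurable_const measurable_snd measurable_fst

lemma measurable_residualMean {f : ℝ → ℝ} (hf : Measurable f) :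
    Measurable (residualMean m f) :=
  ((hf.comp measurable_residual_zero).stronglyMeasurable.integral_prod_right'
    (ν := seqLaw m)).measurable

lemma abs_residualMean_le {f : ℝ → ℝ} {K : ℝ} (hb : ∀ x, |f x| ≤ K) (s : ℝ) :
    |residualMean m f s| ≤ K := by
  have := norm_integral_le_of_norm_le_const (μ := seqLaw m)
    (f := fun u => f (residual (epoch 0 u) s)) (C := K) (Eventually.of_forall fun u => hb _)
  simpa [residualMean] using this

lemma residualMean_of_neg (hm : IsRenewalLaw m rate) (hr : 0 < rate) (f : ℝ → ℝ) {s : ℝ}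
    (hs : s < 0) : residualMean m f s = f (-s) := by
  rw [residualMean, integral_congr_ae (g := fun _ => f (-s))]
  · simp
  · filter_upwards [hm.ae_goodIntervals hr] with u hu
    have h : countUpTo (epoch 0 u) s = 0 :=
      (hu.goodEpochs 0).countUpTo_eq (by simp) (by simpa using hs)
    simp [AutonomousNetwork.residual, h]

/-- The renewal equation, obtained by conditioning on the first interval. -/
lemma residualMean_harmonic (hm : IsRenewalLaw m rate) (hr : 0 < rate) {f : ℝ → ℝ} {K : ℝ}
    (hf : Measurable f) (hb : ∀ x, |f x| ≤ K) {s : ℝ} (hs : 0 ≤ s) :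
    residualMean m f s = ∫ x, residualMean m f (s - x) ∂m := by
  have hsp := measurePreserving_spliceAt m 1
  have hmeas : ∀ s, Measurable fun u : ℕ → ℝ => f (residual (epoch 0 u) s) := fun s =>
    hf.comp (measurable_residual_epoch measurable_const measurable_id measurable_const)
  have h1 : residualMean m f s
      = ∫ p, f (residual (epoch 0 (spliceAt 1 p)) s) ∂((seqLaw m).prod (seqLaw m)) := by
    have := integral_map (μ := (seqLaw m).prod (seqLaw m)) hsp.measurable.aemeasurable
      (hmeas s).aestronglyMeasurable
    rw [hsp.map_eq] at this
    exact this
  have h2 : ∀ᵐ p ∂((seqLaw m).prod (seqLaw m)),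
      f (residual (epoch 0 (spliceAt 1 p)) s) = f (residual (epoch 0 p.2) (s - p.1 0)) := by
    have g := hm.ae_goodIntervals hr
    filter_upwards [Measure.quasiMeasurePreserving_fst.ae g,
      Measure.quasiMeasurePreserving_snd.ae g] with p hp1 hp2
    have := residual_spliceAt (a := 0) (t := 0) hp1 hp2 (n := 1)
      (fun k hk => by simp [Nat.lt_one_iff.1 hk]) hs
    rw [zero_add] at this
    rw [this, residual_epoch]
    simp [epoch]
  have hm2 : Measurable fun p : (ℕ → ℝ) × (ℕ → ℝ) => f (residual (epoch 0 p.2) (s - p.1 0)) :=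
    hf.comp (measurable_residual_epoch measurable_const measurable_snd (by fun_prop))
  rw [h1, integral_congr_ae h2, integral_prod _ (integrable_of_bdd hm2 fun p => hb _)]
  have h3 := integral_map (μ := seqLaw m) (measurePreserving_eval_seqLaw m 0).measurable.aemeasurable
    (f := fun x => residualMean m f (s - x))
    ((measurable_residualMean hf).comp (by fun_prop : Measurable fun x : ℝ => s - x)).aestronglyMeasurable
  rw [(measurePreserving_eval_seqLaw m 0).map_eq] at h3
  exact h3.symm

/-- A bounded solution of the homogeneous renewal equation that vanishes on the negative half-line
vanishes identically. -/
lemma eq_zero_of_harmonic (hm : IsRenewalLaw m rate) {h : ℝ → ℝ} {K : ℝ}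
    (hb : ∀ x, |h x| ≤ K) (hneg : ∀ s < 0, h s = 0)
    (harm : ∀ s, 0 ≤ s → h s = ∫ x, h (s - x) ∂m) (s : ℝ) : h s = 0 := by
  have hK : 0 ≤ K := (abs_nonneg _).trans (hb 0)
  -- The equation contracts the weighted bound `|h s| ≤ K * exp s` by the Laplace transform of `m`
  -- at `1`; the minimum with `1` bounds the integrand everywhere and is harmless for `x > 0`.
  set q : ℝ := ∫ x, min 1 (Real.exp (-x)) ∂m with hq
  have hmm : Measurable fun x : ℝ => min 1 (Real.exp (-x)) := by fun_prop
  have hmb : ∀ x : ℝ, |min 1 (Real.exp (-x))| ≤ 1 := fun x => by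
    rw [abs_of_nonneg (by positivity)]; exact min_le_left _ _
  have hqi : Integrable (fun x : ℝ => min 1 (Real.exp (-x))) m := integrable_of_bdd hmm hmb
  have hlt : ∀ᵐ x ∂m, min 1 (Real.exp (-x)) < 1 := by
    filter_upwards [hm.ae_pos] with x hx
    exact min_lt_of_right_lt (by simpa using hx)
  have hq0 : 0 ≤ q := integral_nonneg fun x => by positivity
  have hq1 : q < 1 := by
    have h1 : 0 < ∫ x, (1 - min 1 (Real.exp (-x))) ∂m := by
      rw [integral_pos_iff_support_of_nonneg_ae]
      · have : Function.support (fun x : ℝ => 1 - min 1 (Real.exp (-x))) =ᵐ[m] Set.univ := by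
          filter_upwards [hlt] with x hx
          refine eq_iff_iff.2 ⟨fun _ => trivial, fun _ => ?_⟩
          exact (sub_pos.2 hx).ne'
        rw [measure_congr this]; simp
      · exact Eventually.of_forall fun x => sub_nonneg.2 (min_le_left _ _)
      · exact (integrable_const _).sub hqi
    rw [integral_sub (integrable_const _) hqi] at h1
    simp only [integral_const, probReal_univ, smul_eq_mul, mul_one] at h1
    linarith
  have key : ∀ n : ℕ, ∀ s, |h s| ≤ K * q ^ n * Real.exp s := by
    intro n
    induction n with
    | zero =>
      intro s
      by_cases hs : s < 0
      · rw [hneg s hs]; simp; positivity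
      · have : 1 ≤ Real.exp s := Real.one_le_exp (not_lt.1 hs)
        calc |h s| ≤ K := hb s
          _ ≤ K * q ^ 0 * Real.exp s := by simpa using le_mul_of_one_le_right hK this
    | succ n ih =>
      intro s
      by_cases hs : s < 0
      · rw [hneg s hs]; simp; positivity
      · rw [harm s (not_lt.1 hs), ← Real.norm_eq_abs]
        have h1 : ‖∫ x, h (s - x) ∂m‖
            ≤ ∫ x, (K * q ^ n * Real.exp s) * min 1 (Real.exp (-x)) ∂m := by
          refine norm_integral_le_of_norm_le (hqi.const_mul _) ?_
          filter_upwards [hm.ae_pos] with x hx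
          have h2 := ih (s - x)
          have h3 : Real.exp (-x) ≤ 1 := by simpa using hx.le
          rw [min_eq_right h3, Real.norm_eq_abs, mul_assoc, ← Real.exp_add, ← sub_eq_add_neg]
          exact h2
        rw [integral_const_mul] at h1
        refine h1.trans (le_of_eq ?_)
        rw [← hq, pow_succ]; ring
  have hlim : Tendsto (fun n : ℕ => K * q ^ n * Real.exp s) atTop (𝓝 (K * 0 * Real.exp s)) :=
    ((tendsto_pow_atTop_nhds_zero_of_lt_one hq0 hq1).const_mul K).mul_const _
  have h1 := ge_of_tendsto' hlim (fun n => key n s)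
  rw [mul_zero, zero_mul] at h1
  exact abs_nonpos_iff.1 h1

/-- Markov property of the residual time, for moving averages: averaging over the future of the
residual time amounts to moving the window. -/
lemma residualMean_movingAverage (hm : IsRenewalLaw m rate) (hr : 0 < rate) {ε : ℝ} (hε : 0 < ε)
    {f : ℝ → ℝ} {K : ℝ} (hf : Measurable f) (hb : ∀ x, |f x| ≤ K) (s : ℝ) :
    residualMean m (fun z => movingAverage ε (residualMean m f) (-z)) s
      = movingAverage ε (residualMean m f) s := by
  have hG := measurable_residualMean (m := m) hf
  have hGb := abs_residualMean_le (m := m) hb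
  have hA := measurable_movingAverage hε hG
  have hAb := abs_movingAverage_le hε hGb
  have hA' : Measurable fun z => movingAverage ε (residualMean m f) (-z) := hA.comp measurable_neg
  have hAb' : ∀ z, |movingAverage ε (residualMean m f) (-z)| ≤ K := fun z => hAb _
  have hmain := eq_zero_of_harmonic hm (K := 2 * K)
    (h := residualMean m (fun z => movingAverage ε (residualMean m f) (-z))
      - movingAverage ε (residualMean m f)) (fun x => by
      have := abs_sub (residualMean m (fun z => movingAverage ε (residualMean m f) (-z)) x)
        (movingAverage ε (residualMean m f) x)
      have h1 := abs_residualMean_le (m := m) hAb' x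
      have h2 := hAb x
      simp only [Pi.sub_apply]
      linarith) (fun s hs => by
      simp only [Pi.sub_apply]
      rw [residualMean_of_neg hm hr _ hs]; simp) (fun s hs => by
      simp only [Pi.sub_apply]
      rw [integral_sub, ← residualMean_harmonic hm hr hA' hAb' hs,
        ← movingAverage_harmonic hε hG hGb (fun s hs => residualMean_harmonic hm hr hf hb hs) hs]
      · exact integrable_of_bdd ((measurable_residualMean (m := m) hA').comp (by fun_prop))
          fun x => abs_residualMean_le hAb' _
      · exact integrable_of_bdd (hA.comp (by fun_prop)) fun x => hAb _) s
  simp only [Pi.sub_apply] at hmain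
  linarith

/-- The limit of the moving averages, in terms of the equilibrium law. -/
lemma tendsto_movingAverage_residualMean (hm : IsRenewalLaw m rate) (hr : 0 < rate) {ε : ℝ}
    (hε : 0 < ε) {f : ℝ → ℝ} {K : ℝ} (hf : Measurable f) (hb : ∀ x, |f x| ≤ K) :
    Tendsto (movingAverage ε (residualMean m f)) atTop
      (𝓝 ((∫ u, (∫ s in (0 - u)..0, movingAverage ε (residualMean m f) s) ∂m) / ∫ x, x ∂m)) :=
  tendsto_movingAverage_harmonic hm.integrable hm.noAtoms (by rw [hm.mean]; positivity)
    (measurable_residualMean hf) (abs_residualMean_le hb)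
    (fun _ hs => residualMean_harmonic hm hr hf hb hs) hε

/-- The indicator of `(-∞, x]`. -/
def leIndicator (x : ℝ) : ℝ → ℝ := Set.indicator (Set.Iic x) fun _ => 1

lemma measurable_leIndicator (x : ℝ) : Measurable (leIndicator x) :=
  measurable_const.indicator measurableSet_Iic

lemma abs_leIndicator_le (x z : ℝ) : |leIndicator x z| ≤ 1 := by
  unfold leIndicator Set.indicator; split_ifs <;> simp

/-- Short moving averages of the residual mean reproduce a left-continuous test function. -/
lemma tendsto_movingAverage_leIndicator (hm : IsRenewalLaw m rate) (hr : 0 < rate) (x : ℝ) {z : ℝ}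
    (hz : 0 < z) :
    Tendsto (fun n : ℕ => movingAverage (1 / ((n : ℝ) + 1)) (residualMean m (leIndicator x)) (-z))
      atTop (𝓝 (leIndicator x z)) := by
  obtain ⟨η, hη, hcon⟩ : ∃ η : ℝ, 0 < η ∧ ∀ r, 0 ≤ r → r ≤ η →
      residualMean m (leIndicator x) (-z + r) = leIndicator x z := by
    by_cases h : z ≤ x
    · refine ⟨z / 2, by positivity, fun r h0 hr' => ?_⟩
      rw [residualMean_of_neg hm hr _ (by linarith)]
      have h1 : -(-z + r) ≤ x := by linarith
      simp only [leIndicator, Set.indicator, Set.mem_Iic, h, h1]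
    · refine ⟨min (z / 2) ((z - x) / 2), lt_min (by positivity) (by linarith), fun r h0 hr' => ?_⟩
      have h1 := hr'.trans (min_le_left _ _)
      have h2 := hr'.trans (min_le_right _ _)
      rw [residualMean_of_neg hm hr _ (by linarith)]
      have h3 : ¬ -(-z + r) ≤ x := by linarith
      simp only [leIndicator, Set.indicator, Set.mem_Iic, h, h3]
  refine tendsto_const_nhds.congr' ?_
  filter_upwards [(tendsto_one_div_add_atTop_nhds_zero_nat (𝕜 := ℝ)).eventually (ge_mem_nhds hη)]
    with n hn
  have hε : (0 : ℝ) < 1 / ((n : ℝ) + 1) := by positivity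
  unfold movingAverage
  rw [intervalIntegral.integral_congr (g := fun _ => leIndicator x z)]
  · simp only [intervalIntegral.integral_const, sub_zero, smul_eq_mul]
    field_simp
  · intro r hr'
    rw [Set.uIcc_of_le hε.le] at hr'
    exact hcon r hr'.1 (hr'.2.trans hn)

/-- The limits of the window averages of the indicator of `(-∞, x]`, as the window shrinks, are the
values of the distribution function of the equilibrium law. -/
lemma tendsto_window_leIndicator (hm : IsRenewalLaw m rate) (hr : 0 < rate) (x : ℝ) :
    Tendsto (fun n : ℕ => (∫ u, (∫ s in (0 - u)..0,
        movingAverage (1 / ((n : ℝ) + 1)) (residualMean m (leIndicator x)) s) ∂m) / ∫ x, x ∂m)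
      atTop (𝓝 ((equilibriumLaw m rate).real (Set.Iic x))) := by
  set A : ℕ → ℝ → ℝ := fun n =>
    movingAverage (1 / ((n : ℝ) + 1)) (residualMean m (leIndicator x)) with hA
  have hpos : ∀ n : ℕ, (0 : ℝ) < 1 / ((n : ℝ) + 1) := fun n => by positivity
  have hAm : ∀ n, Measurable (A n) := fun n =>
    measurable_movingAverage (hpos n) (measurable_residualMean (measurable_leIndicator x))
  have hAb : ∀ n s, |A n s| ≤ 1 := fun n =>
    abs_movingAverage_le (hpos n) (abs_residualMean_le (abs_leIndicator_le x))
  have hinner : ∀ u, 0 < u → Tendsto (fun n => ∫ s in (0 - u)..0, A n s) atTop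
      (𝓝 (volume (Set.Ico 0 u ∩ Set.Iic x)).toReal) := by
    intro u hu
    have h1 : (volume (Set.Ico 0 u ∩ Set.Iic x)).toReal = ∫ s in (0 - u)..0, leIndicator x (-s) := by
      rw [intervalIntegral.integral_comp_neg]
      simp only [neg_zero, zero_sub, neg_neg]
      rw [intervalIntegral.integral_of_le hu.le, integral_Ioc_eq_integral_Ioo,
        ← integral_Ico_eq_integral_Ioo, leIndicator, integral_indicator measurableSet_Iic,
        Measure.restrict_restrict measurableSet_Iic]
      simp [Measure.real, Set.inter_comm]
    rw [h1]
    refine intervalIntegral.tendsto_integral_filter_of_dominated_convergence (fun _ => 1)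
      (Eventually.of_forall fun n => (hAm n).aestronglyMeasurable)
      (Eventually.of_forall fun n => Eventually.of_forall fun s _ => hAb n s) (by simp) ?_
    have h0 : ∀ᵐ s : ℝ ∂volume, s ≠ 0 := by
      rw [ae_iff]; simp
    filter_upwards [h0] with s hs0 hs
    rw [Set.uIoc_of_le (by linarith)] at hs
    have := tendsto_movingAverage_leIndicator hm hr x (z := -s)
      (by rcases lt_or_eq_of_le hs.2 with h | h; linarith; exact absurd h hs0)
    rwa [neg_neg] at this
  have h2 : Tendsto (fun n => ∫ u, (∫ s in (0 - u)..0, A n s) ∂m) atTop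
      (𝓝 (∫ u, (volume (Set.Ico 0 u ∩ Set.Iic x)).toReal ∂m)) := by
    refine tendsto_integral_of_dominated_convergence (fun u => |u|)
      (fun n => (measurable_intervalIntegral_sub (hAm n) (hAb n) 0).aestronglyMeasurable)
      hm.integrable.abs (fun n => Eventually.of_forall fun u => ?_) ?_
    · have := abs_intervalIntegral_le_of_bdd (hAb n) (0 - u) 0
      simpa using this
    · filter_upwards [hm.ae_pos] with u hu using hinner u hu
  have h3 : (equilibriumLaw m rate).real (Set.Iic x)
      = (∫ u, (volume (Set.Ico 0 u ∩ Set.Iic x)).toReal ∂m) / ∫ x, x ∂m := by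
    have hms : Measurable fun u : ℝ => volume (Set.Ico 0 u ∩ Set.Iic x) := by
      have h4 : MeasurableSet {p : ℝ × ℝ | (0 ≤ p.2 ∧ p.2 < p.1) ∧ p.2 ≤ x} :=
        ((measurableSet_le measurable_const measurable_snd).inter
          (measurableSet_lt measurable_snd measurable_fst)).inter
          (measurableSet_le measurable_snd measurable_const)
      exact measurable_measure_prodMk_left h4
    rw [Measure.real, equilibriumLaw_apply measurableSet_Iic, ENNReal.toReal_mul,
      ENNReal.toReal_ofReal hr.le, hm.mean, integral_toReal hms.aemeasurable]
    · field_simp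
    · refine Eventually.of_forall fun u => ?_
      exact (measure_mono Set.inter_subset_left).trans_lt (by simp)
  rw [h3]
  exact h2.div_const _

/-- The law of independent renewal clocks with non-atomic interval laws has only one invariant
distribution, the product of the equilibrium laws. -/
theorem eq_pi_equilibriumLaw_of_invariant {ι : Type*} [Fintype ι] {m : ι → Measure ℝ}
    [∀ i, IsProbabilityMeasure (m i)] {rate : ι → ℝ} (hm : ∀ i, IsRenewalLaw (m i) (rate i))
    (hr : ∀ i, 0 < rate i) {α : Measure (ι → ℝ)} [IsProbabilityMeasure α]
    (hpos : ∀ᵐ a ∂α, ∀ i, 0 < a i)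
    (hinv : ∀ t : ℝ, 0 ≤ t → (α.prod (Measure.pi fun i => seqLaw (m i))).map
      (fun p i => residual (epoch (p.1 i) (p.2 i)) t) = α) :
    α = Measure.pi fun i => equilibriumLaw (m i) (rate i) := by
  have := fun i => isProbabilityMeasure_equilibriumLaw (hm i) (hr i)
  set A : ℕ → ι → ℝ → ℝ → ℝ := fun n i x =>
    movingAverage (1 / ((n : ℝ) + 1)) (residualMean (m i) (leIndicator x)) with hA
  have hεpos : ∀ n : ℕ, (0 : ℝ) < 1 / ((n : ℝ) + 1) := fun n => by positivity
  have hAm : ∀ n i x, Measurable (A n i x) := fun n i x =>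
    measurable_movingAverage (hεpos n) (measurable_residualMean (measurable_leIndicator x))
  have hAb : ∀ n i x s, |A n i x s| ≤ 1 := fun n i x =>
    abs_movingAverage_le (hεpos n) (abs_residualMean_le (abs_leIndicator_le x))
  have hprodb : ∀ (g : ι → ℝ), (∀ i, |g i| ≤ 1) → |∏ i, g i| ≤ 1 := fun g hg => by
    rw [Finset.abs_prod]
    exact Finset.prod_le_one (fun i _ => abs_nonneg _) fun i _ => hg i
  -- invariance, for products of moving averages
  have hshift : ∀ (n : ℕ) (x : ι → ℝ) (t : ℝ), 0 ≤ t →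
      ∫ a, ∏ i, A n i (x i) (-a i) ∂α = ∫ a, ∏ i, A n i (x i) (t - a i) ∂α := by
    intro n x t ht
    have hFm : Measurable fun a : ι → ℝ => ∏ i, A n i (x i) (-a i) :=
      Finset.measurable_prod _ fun i _ => (hAm n i (x i)).comp (by fun_prop)
    have hresm : Measurable fun (p : (ι → ℝ) × (ι → ℕ → ℝ)) i =>
        residual (epoch (p.1 i) (p.2 i)) t :=
      measurable_pi_lambda _ fun i => measurable_residual_epoch (by fun_prop) (by fun_prop)
        measurable_const
    conv_lhs => rw [← hinv t ht]
    rw [integral_map hresm.aemeasurable hFm.aestronglyMeasurable,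
      integral_prod _ (by
        refine integrable_of_bdd (K := 1) ?_ fun p => hprodb _ fun i => hAb _ _ _ _
        exact hFm.comp hresm)]
    congr 1
    ext a
    rw [integral_fintype_prod_eq_prod (μ := fun i => seqLaw (m i))
      (f := fun i (u : ℕ → ℝ) => A n i (x i) (-residual (epoch (a i) u) t))]
    refine Finset.prod_congr rfl fun i _ => ?_
    have h1 := residualMean_movingAverage (hm i) (hr i) (hεpos n) (measurable_leIndicator (x i))
      (abs_leIndicator_le (x i)) (t - a i)
    rw [residualMean] at h1
    rw [hA]
    simp only
    rw [← h1]
    congr 1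
    ext u
    rw [residual_epoch]
  set M : ℕ → ι → ℝ → ℝ := fun n i x => (∫ u, (∫ s in (0 - u)..0, A n i x s) ∂(m i)) / ∫ x, x ∂(m i)
    with hM
  -- for a fixed window, let the time tend to infinity in the invariance identity
  have hlim1 : ∀ (n : ℕ) (x : ι → ℝ), ∫ a, ∏ i, A n i (x i) (-a i) ∂α = ∏ i, M n i (x i) := by
    intro n x
    have h1 : Tendsto (fun t : ℝ => ∫ a, ∏ i, A n i (x i) (t - a i) ∂α) atTop
        (𝓝 (∫ _, ∏ i, M n i (x i) ∂α)) := by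
      refine tendsto_integral_filter_of_dominated_convergence (fun _ => 1)
        (Eventually.of_forall fun t => ?_)
        (Eventually.of_forall fun t => Eventually.of_forall fun a =>
          hprodb _ fun i => hAb n i (x i) _) (integrable_const _)
        (Eventually.of_forall fun a => ?_)
      · exact (Finset.measurable_prod _ fun i _ =>
          (hAm n i (x i)).comp (by fun_prop)).aestronglyMeasurable
      · refine tendsto_finsetProd _ fun i _ => ?_
        exact (tendsto_movingAverage_residualMean (hm i) (hr i) (hεpos n)
          (measurable_leIndicator (x i)) (abs_leIndicator_le (x i))).comp
          (tendsto_atTop_add_const_right _ (-a i) tendsto_id)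
    rw [integral_const, probReal_univ, one_smul] at h1
    refine tendsto_nhds_unique (tendsto_const_nhds.congr' ?_) h1
    filter_upwards [eventually_ge_atTop 0] with t ht using hshift n x t ht
  -- then let the window shrink
  have hbox : ∀ x : ι → ℝ, α.real (Set.univ.pi fun i => Set.Iic (x i))
      = ∏ i, (equilibriumLaw (m i) (rate i)).real (Set.Iic (x i)) := by
    intro x
    have h1 : Tendsto (fun n => ∏ i, M n i (x i)) atTop
        (𝓝 (∏ i, (equilibriumLaw (m i) (rate i)).real (Set.Iic (x i)))) :=
      tendsto_finsetProd _ fun i _ => tendsto_window_leIndicator (hm i) (hr i) (x i)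
    have h2 : Tendsto (fun n => ∫ a, ∏ i, A n i (x i) (-a i) ∂α) atTop
        (𝓝 (∫ a, ∏ i, leIndicator (x i) (a i) ∂α)) := by
      refine tendsto_integral_of_dominated_convergence (fun _ => 1) (fun n => ?_)
        (integrable_const _) (fun n => Eventually.of_forall fun a =>
          hprodb _ fun i => hAb n i (x i) _) ?_
      · exact (Finset.measurable_prod _ fun i _ =>
          (hAm n i (x i)).comp (by fun_prop)).aestronglyMeasurable
      · filter_upwards [hpos] with a ha
        exact tendsto_finsetProd _ fun i _ =>
          tendsto_movingAverage_leIndicator (hm i) (hr i) (x i) (ha i)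
    simp_rw [hlim1] at h2
    rw [← tendsto_nhds_unique h2 h1]
    have h3 : (fun a : ι → ℝ => ∏ i, leIndicator (x i) (a i))
        = Set.indicator (Set.univ.pi fun i => Set.Iic (x i)) fun _ => 1 := by
      ext a
      by_cases h : a ∈ Set.univ.pi fun i => Set.Iic (x i)
      · rw [Set.indicator_of_mem h]
        refine Finset.prod_eq_one fun i _ => ?_
        exact Set.indicator_of_mem (h i trivial) _
      · rw [Set.indicator_of_notMem h]
        simp only [Set.mem_pi, Set.mem_univ, true_implies, not_forall] at h
        obtain ⟨i, hi⟩ := h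
        exact Finset.prod_eq_zero (Finset.mem_univ i) (Set.indicator_of_notMem hi _)
    rw [h3, integral_indicator_const _ (MeasurableSet.univ_pi fun i => measurableSet_Iic)]
    simp
  symm
  refine Measure.pi_eq_generateFrom (C := fun _ => Set.range Set.Iic)
    (fun i => by rw [← borel_eq_generateFrom_Iic]; exact BorelSpace.measurable_eq.symm)
    (fun i => isPiSystem_Iic)
    (fun i => ⟨fun n : ℕ => Set.Iic (n : ℝ), fun n => ⟨_, rfl⟩, fun n => measure_lt_top _ _, ?_⟩) ?_
  · refine Set.eq_univ_of_forall fun y => ?_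
    obtain ⟨n, hn⟩ := exists_nat_ge y
    exact Set.mem_iUnion.2 ⟨n, hn⟩
  · intro s hs
    choose x hx using hs
    have h1 := hbox x
    have h2 : (fun i => Set.Iic (x i)) = s := funext hx
    rw [h2] at h1
    simp only [congrFun h2] at h1
    rw [← ENNReal.ofReal_toReal (measure_ne_top α _)]
    have h3 : (α (Set.univ.pi s)).toReal = _ := h1
    rw [h3, ENNReal.ofReal_prod_of_nonneg (fun i _ => measureReal_nonneg)]
    refine Finset.prod_congr rfl fun i _ => ?_
    rw [Measure.real, ENNReal.ofReal_toReal (measure_ne_top _ _)]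

end ClockUniqueness

/-! ### Regeneration of marked renewal clocks -/

section Regeneration

open AutonomousNetwork

/-- A map that is composed of countably many measure-preserving pieces preserves measures. -/
lemma measurePreserving_of_pieces {Ω Ω' : Type*} [MeasurableSpace Ω] [MeasurableSpace Ω']
    {μ : Measure Ω} {ν : Measure Ω'} {T : Ω → Ω'} (hT : Measurable T) {A : ℕ → Set Ω}
    {B : ℕ → Set Ω'} (hAm : ∀ n, MeasurableSet (A n)) (hBm : ∀ n, MeasurableSet (B n))
    (hAd : Pairwise (Function.onFun Disjoint A)) (hBd : Pairwise (Function.onFun Disjoint B))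
    {S : ℕ → Ω → Ω'} (hS : ∀ n, MeasurePreserving (S n) μ ν)
    (hAB : ∀ n, S n ⁻¹' B n =ᵐ[μ] A n) (hTS : ∀ n, ∀ ω ∈ A n, T ω = S n ω) :
    MeasurePreserving T (μ.restrict (⋃ n, A n)) (ν.restrict (⋃ n, B n)) := by
  refine ⟨hT, ?_⟩
  rw [Measure.restrict_iUnion hAd hAm, Measure.restrict_iUnion hBd hBm,
    Measure.map_sum hT.aemeasurable]
  congr 1
  ext1 n
  rw [← ((hS n).restrict_preimage (hBm n)).map_eq, Measure.restrict_congr_set (hAB n)]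
  refine Measure.map_congr ?_
  filter_upwards [ae_restrict_mem (hAm n)] with ω hω using hTS n ω hω

lemma measurePreserving_prodProdProdComm {α β γ δ : Type*} [MeasurableSpace α] [MeasurableSpace β]
    [MeasurableSpace γ] [MeasurableSpace δ] (a : Measure α) (b : Measure β) (c : Measure γ)
    (e : Measure δ) [SFinite a] [SFinite b] [SFinite c] [SFinite e] :
    MeasurePreserving (fun p : (α × β) × (γ × δ) => ((p.1.1, p.2.1), (p.1.2, p.2.2)))
      ((a.prod b).prod (c.prod e)) ((a.prod c).prod (b.prod e)) := by
  have h1 := measurePreserving_prodAssoc a b (c.prod e)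
  have h2 : MeasurePreserving _ (b.prod (c.prod e)) ((b.prod c).prod e) :=
    (measurePreserving_prodAssoc b c e).symm
  have h3 : MeasurePreserving _ ((b.prod c).prod e) ((c.prod b).prod e) :=
    Measure.measurePreserving_swap.prod (MeasurePreserving.id e)
  have h4 := measurePreserving_prodAssoc c b e
  have h5 : MeasurePreserving _ (a.prod (c.prod (b.prod e))) ((a.prod c).prod (b.prod e)) :=
    (measurePreserving_prodAssoc a c (b.prod e)).symm
  exact h5.comp (((MeasurePreserving.id a).prod (h4.comp (h3.comp h2))).comp h1)

/-- Intervals and marks of one clock. -/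
abbrev ClockPath (M : Type*) : Type _ := (ℕ → ℝ) × (ℕ → M)

variable {M : Type*} [MeasurableSpace M]

/-- I.i.d. intervals with law `m` and, independently of them, i.i.d. marks with law `q`. -/
abbrev clockLaw (m : Measure ℝ) (q : Measure M) : Measure (ClockPath M) :=
  (seqLaw m).prod (seqLaw q)

/-- The clock with first epoch `a` that follows `p.1` up to time `t` and is driven by `p.2` after
that. -/
def spliceClock (a t : ℝ) (p : ClockPath M × ClockPath M) : ClockPath M :=
  (spliceAt (countUpTo (epoch a p.1.1) t) (p.1.1, p.2.1),
    spliceAt (countUpTo (epoch a p.1.1) t) (p.1.2, p.2.2))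

lemma measurable_spliceClock {Ω : Type*} [MeasurableSpace Ω] {a : Ω → ℝ} (t : ℝ)
    {p : Ω → ClockPath M × ClockPath M} (ha : Measurable a) (hp : Measurable p) :
    Measurable fun ω => spliceClock (a ω) t (p ω) := by
  have h : Measurable fun x : (ClockPath M × ClockPath M) × ℕ =>
      ((spliceAt x.2 (x.1.1.1, x.1.2.1), spliceAt x.2 (x.1.1.2, x.1.2.2)) : ClockPath M) :=
    measurable_from_prod_countable_left fun n =>
      ((measurable_spliceAt n).comp (by fun_prop)).prodMk
        ((measurable_spliceAt n).comp (by fun_prop))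
  exact h.comp (hp.prodMk (measurable_countUpTo_epoch ha
    (measurable_fst.comp (measurable_fst.comp hp)) measurable_const))

variable {m : Measure ℝ} [IsProbabilityMeasure m] {q : Measure M} [IsProbabilityMeasure q]
  {rate : ℝ}

omit [IsProbabilityMeasure q] in
lemma IsRenewalLaw.ae_goodIntervals_clockLaw (hm : IsRenewalLaw m rate) (hr : 0 < rate) :
    ∀ᵐ w ∂(clockLaw m q), GoodIntervals w.1 :=
  Measure.quasiMeasurePreserving_fst.ae (hm.ae_goodIntervals hr)

/-- Regeneration: driving a clock by independent intervals and marks after a fixed time does not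
change its law. -/
lemma measurePreserving_spliceClock (hm : IsRenewalLaw m rate) (hr : 0 < rate) (a t : ℝ) :
    MeasurePreserving (spliceClock (M := M) a t) ((clockLaw m q).prod (clockLaw m q))
      (clockLaw m q) := by
  have hS : ∀ n : ℕ, MeasurePreserving (fun p : ClockPath M × ClockPath M =>
      ((spliceAt n (p.1.1, p.2.1), spliceAt n (p.1.2, p.2.2)) : ClockPath M))
      ((clockLaw m q).prod (clockLaw m q)) (clockLaw m q) := fun n =>
    ((measurePreserving_spliceAt m n).prod (measurePreserving_spliceAt q n)).comp
      (measurePreserving_prodProdProdComm (seqLaw m) (seqLaw q) (seqLaw m) (seqLaw q))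
  have hN : Measurable fun w : ClockPath M => countUpTo (epoch a w.1) t :=
    measurable_countUpTo_epoch measurable_const measurable_fst measurable_const
  have h := measurePreserving_of_pieces (μ := (clockLaw m q).prod (clockLaw m q))
    (ν := clockLaw m q) (measurable_spliceClock t (measurable_const (a := a)) measurable_id)
    (A := fun n => {p | countUpTo (epoch a p.1.1) t = n})
    (B := fun n => {w | countUpTo (epoch a w.1) t = n})
    (fun n => (hN.comp measurable_fst) (measurableSet_singleton n))
    (fun n => hN (measurableSet_singleton n))
    (fun i j hij => Set.disjoint_left.2 fun p hi hj => hij (Eq.trans (Eq.symm hi) hj))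
    (fun i j hij => Set.disjoint_left.2 fun p hi hj => hij (Eq.trans (Eq.symm hi) hj))
    hS (fun n => ?_) (fun n p hp => by
      have : countUpTo (epoch a p.1.1) t = n := hp
      simp only [spliceClock, id, this])
  · have e1 : (⋃ n, {p : ClockPath M × ClockPath M | countUpTo (epoch a p.1.1) t = n})
        = Set.univ := Set.eq_univ_of_forall fun p => Set.mem_iUnion.2 ⟨_, rfl⟩
    have e2 : (⋃ n, {w : ClockPath M | countUpTo (epoch a w.1) t = n})
        = Set.univ := Set.eq_univ_of_forall fun p => Set.mem_iUnion.2 ⟨_, rfl⟩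
    rw [e1, e2, Measure.restrict_univ, Measure.restrict_univ] at h
    exact h
  · have g := hm.ae_goodIntervals_clockLaw (q := q) hr
    filter_upwards [Measure.quasiMeasurePreserving_fst.ae g,
      Measure.quasiMeasurePreserving_snd.ae g] with p hp1 hp2
    refine eq_iff_iff.2 ?_
    change countUpTo (epoch a (spliceAt n (p.1.1, p.2.1))) t = n ↔ countUpTo (epoch a p.1.1) t = n
    have hg1 := hp1.goodEpochs a
    have hg2 := (goodIntervals_spliceAt hp1 hp2 n).goodEpochs a
    constructor
    · intro h
      refine hg1.countUpTo_eq (fun k hk => ?_) ?_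
      · rw [← epoch_spliceAt_of_le a p.1.1 p.2.1 hk.le]
        rwa [← h, hg2.lt_countUpTo_iff] at hk
      · have := hg2.lt_epoch_countUpTo t
        rwa [h, epoch_spliceAt_of_le _ _ _ le_rfl] at this
    · intro h
      refine hg2.countUpTo_eq (fun k hk => ?_) ?_
      · rw [epoch_spliceAt_of_le _ _ _ hk.le]
        rwa [← h, hg1.lt_countUpTo_iff] at hk
      · have := hg1.lt_epoch_countUpTo t
        rwa [h, ← epoch_spliceAt_of_le _ _ p.2.1 le_rfl] at this

/-- Joint regeneration of independent clocks, all at the same time. -/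
lemma measurePreserving_spliceClock_pi {κ : Type*} [Fintype κ] {m : κ → Measure ℝ}
    [∀ k, IsProbabilityMeasure (m k)] {q : κ → Measure M} [∀ k, IsProbabilityMeasure (q k)]
    {rate : κ → ℝ} (hm : ∀ k, IsRenewalLaw (m k) (rate k)) (hr : ∀ k, 0 < rate k)
    (a : κ → ℝ) (t : ℝ) :
    MeasurePreserving (fun (p : (κ → ClockPath M) × (κ → ClockPath M)) k =>
        spliceClock (a k) t (p.1 k, p.2 k))
      ((Measure.pi fun k => clockLaw (m k) (q k)).prod (Measure.pi fun k => clockLaw (m k) (q k)))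
      (Measure.pi fun k => clockLaw (m k) (q k)) :=
  (measurePreserving_pi _ _ fun k => measurePreserving_spliceClock (hm k) (hr k) (a k) t).comp
    (measurePreserving_arrowProdEquivProdArrow _ _ κ (fun k => clockLaw (m k) (q k))
      (fun k => clockLaw (m k) (q k))).symm

end Regeneration

/-! ### Time reversal of a stationary marked renewal clock -/

section Reversal

open AutonomousNetwork

variable {M : Type*}

/-- A stationary clock seen at time `0`: the first epoch after `0`, the length of the interval that
covers `0`, and the later intervals and marks. -/
abbrev StatClock (M : Type*) : Type _ := (ℝ × ℝ) × ClockPath M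

/-- The sequence of intervals that starts with the one covering `0`. -/
def consInterval (v : ℝ) (u : ℕ → ℝ) : ℕ → ℝ := fun k => if k = 0 then v else u (k - 1)

@[simp] lemma consInterval_zero (v : ℝ) (u : ℕ → ℝ) : consInterval v u 0 = v := rfl

@[simp] lemma consInterval_succ (v : ℝ) (u : ℕ → ℝ) (k : ℕ) :
    consInterval v u (k + 1) = u k := by simp [consInterval]

lemma epoch_consInterval (x v : ℝ) (u : ℕ → ℝ) (k : ℕ) :
    epoch (x - v) (consInterval v u) (k + 1) = epoch x u k := by
  induction k with
  | zero => simp [epoch_succ]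
  | succ k ih => rw [epoch_succ, ih, epoch_succ, consInterval_succ]

/-- The involution of the indices that reverses `0, …, n - 1` and fixes the others. -/
def flipBelow (n k : ℕ) : ℕ := if k < n then n - 1 - k else k

lemma flipBelow_injective (n : ℕ) : Function.Injective (flipBelow n) := by
  intro i j h
  unfold flipBelow at h
  split_ifs at h <;> omega

/-- Reversal about `L` of a stationary clock with `n` epochs up to time `L`: the intervals
`0, …, n` and the marks of the `n` epochs are read backwards. -/
def reversePiece (L : ℝ) (n : ℕ) (ξ : StatClock M) : StatClock M :=
  let v := consInterval ξ.1.2 ξ.2.1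
  ((L - epoch (ξ.1.1 - ξ.1.2) v n, v (flipBelow (n + 1) 0)),
    (fun k => v (flipBelow (n + 1) (k + 1)), fun k => ξ.2.2 (flipBelow n k)))

/-- The points of the window: `0` lies in the interval that ends at the first epoch. -/
def InWindow (ξ : StatClock M) : Prop := 0 ≤ ξ.1.1 ∧ ξ.1.1 < ξ.1.2

/-- Reversal of time about `L`. -/
def reverseClock (L : ℝ) (ξ : StatClock M) : StatClock M :=
  reversePiece L (countUpTo (epoch ξ.1.1 ξ.2.1) L) ξ

lemma consInterval_reversePiece (L : ℝ) (n : ℕ) (ξ : StatClock M) (k : ℕ) :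
    consInterval (reversePiece L n ξ).1.2 (reversePiece L n ξ).2.1 k
      = consInterval ξ.1.2 ξ.2.1 (flipBelow (n + 1) k) := by
  cases k with
  | zero => rfl
  | succ k => simp [reversePiece]

/-- The epochs of the reversed clock, including the last one before time `0`. -/
lemma epoch_reversePiece (L : ℝ) (n : ℕ) (ξ : StatClock M) {k : ℕ} (hk : k ≤ n + 1) :
    epoch ((reversePiece L n ξ).1.1 - (reversePiece L n ξ).1.2)
        (consInterval (reversePiece L n ξ).1.2 (reversePiece L n ξ).2.1) k
      = L - epoch (ξ.1.1 - ξ.1.2) (consInterval ξ.1.2 ξ.2.1) (n + 1 - k) := by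
  induction k with
  | zero =>
    rw [epoch_zero, Nat.sub_zero, epoch_succ]
    simp [reversePiece, flipBelow]
    ring
  | succ k ih =>
    rw [epoch_succ, ih (by omega), consInterval_reversePiece]
    have e : n + 1 - k = (n + 1 - (k + 1)) + 1 := by omega
    have e2 : flipBelow (n + 1) k = n + 1 - (k + 1) := by
      unfold flipBelow; rw [if_pos (by omega)]; omega
    rw [e, epoch_succ, e2]
    ring

/-- A stationary clock has `n` epochs up to time `L`. -/
def HasEpochs (L : ℝ) (n : ℕ) (ξ : StatClock M) : Prop :=
  InWindow ξ ∧ epoch (ξ.1.1 - ξ.1.2) (consInterval ξ.1.2 ξ.2.1) n ≤ L ∧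
    L < epoch (ξ.1.1 - ξ.1.2) (consInterval ξ.1.2 ξ.2.1) (n + 1)

lemma hasEpochs_reversePiece (L : ℝ) (n : ℕ) (ξ : StatClock M) :
    HasEpochs L n (reversePiece L n ξ) ↔ HasEpochs L n ξ := by
  have h0 := epoch_reversePiece L n ξ (Nat.zero_le _)
  have h1 := epoch_reversePiece L n ξ (k := 1) (by omega)
  rw [epoch_zero, Nat.sub_zero] at h0
  rw [epoch_succ, epoch_zero, Nat.add_sub_cancel] at h1
  unfold HasEpochs InWindow
  rw [epoch_reversePiece L n ξ (Nat.le_succ n), epoch_reversePiece L n ξ le_rfl]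
  rw [Nat.sub_self, epoch_zero, show n + 1 - n = 0 + 1 by omega, epoch_succ, epoch_zero]
  simp only [consInterval_zero, sub_add_cancel] at h1 ⊢
  constructor
  · rintro ⟨⟨ha, hb⟩, hc, hd⟩
    refine ⟨⟨?_, ?_⟩, ?_, ?_⟩ <;> linarith
  · rintro ⟨⟨ha, hb⟩, hc, hd⟩
    refine ⟨⟨?_, ?_⟩, ?_, ?_⟩ <;> linarith

lemma hasEpochs_iff {L : ℝ} (hL : 0 ≤ L) {n : ℕ} {ξ : StatClock M} (hξ : GoodIntervals ξ.2.1) :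
    HasEpochs L n ξ ↔ InWindow ξ ∧ countUpTo (epoch ξ.1.1 ξ.2.1) L = n := by
  have hg := hξ.goodEpochs ξ.1.1
  refine and_congr_right fun hw => ?_
  rw [epoch_consInterval]
  constructor
  · rintro ⟨h1, h2⟩
    refine hg.countUpTo_eq (fun k hk => ?_) h2
    obtain ⟨j, rfl⟩ : ∃ j, n = j + 1 := ⟨n - 1, by omega⟩
    rw [epoch_consInterval] at h1
    exact (hg.strictMono.monotone (by omega : k ≤ j)).trans h1
  · rintro rfl
    refine ⟨?_, hg.lt_epoch_countUpTo L⟩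
    rcases Nat.eq_zero_or_eq_succ_pred (countUpTo (epoch ξ.1.1 ξ.2.1) L) with h | h
    · rw [h, epoch_zero]; linarith [hw.2]
    · rw [h, Nat.succ_eq_add_one, epoch_consInterval, ← hg.lt_countUpTo_iff]
      omega

/-- The stationary clocks without exceptional behaviour: `0` lies in the interval that covers it, and
the later intervals are good. -/
structure GoodClock (ξ : StatClock M) : Prop where
  window : InWindow ξ
  intervals : GoodIntervals ξ.2.1

/-- The epochs of the reversed clock up to time `L` are the reflected ones, in reverse order. -/
lemma epoch_reverseClock {L : ℝ} {ξ : StatClock M}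
    {k : ℕ} (hk : k < countUpTo (epoch ξ.1.1 ξ.2.1) L) :
    epoch (reverseClock L ξ).1.1 (reverseClock L ξ).2.1 k
      = L - epoch ξ.1.1 ξ.2.1 (countUpTo (epoch ξ.1.1 ξ.2.1) L - 1 - k) := by
  rw [← epoch_consInterval _ (reverseClock L ξ).1.2, reverseClock,
    epoch_reversePiece L _ ξ (by omega)]
  have e : countUpTo (epoch ξ.1.1 ξ.2.1) L + 1 - (k + 1)
      = (countUpTo (epoch ξ.1.1 ξ.2.1) L - 1 - k) + 1 := by omega
  rw [e, epoch_consInterval]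

lemma epoch_reverseClock_countUpTo {L : ℝ} {ξ : StatClock M} :
    epoch (reverseClock L ξ).1.1 (reverseClock L ξ).2.1 (countUpTo (epoch ξ.1.1 ξ.2.1) L)
      = L + (ξ.1.2 - ξ.1.1) := by
  rw [← epoch_consInterval _ (reverseClock L ξ).1.2, reverseClock,
    epoch_reversePiece L _ ξ le_rfl, Nat.sub_self, epoch_zero]
  ring

lemma goodIntervals_reverseClock {L : ℝ} {ξ : StatClock M} (hξ : GoodClock ξ) :
    GoodIntervals (reverseClock L ξ).2.1 := by
  set n := countUpTo (epoch ξ.1.1 ξ.2.1) L with hn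
  have hv : GoodIntervals (consInterval ξ.1.2 ξ.2.1) := by
    refine ⟨fun k => ?_, ?_⟩
    · cases k with
      | zero => exact hξ.window.1.trans_lt hξ.window.2
      | succ k => rw [consInterval_succ]; exact hξ.intervals.pos k
    · rw [← tendsto_add_atTop_iff_nat 1]
      have h := (hξ.intervals.goodEpochs ξ.1.2).tendsto
      refine h.congr fun k => ?_
      have := epoch_consInterval ξ.1.2 ξ.1.2 ξ.2.1 k
      rw [sub_self] at this
      rw [← this, epoch, zero_add]
  refine ⟨fun k => hv.pos _, ?_⟩
  have htail : ∀ k, (reverseClock L ξ).2.1 (n + k) = ξ.2.1 (n + k) := by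
    intro k
    have : flipBelow (n + 1) (n + k + 1) = n + k + 1 := by
      unfold flipBelow; rw [if_neg (by omega)]
    change consInterval ξ.1.2 ξ.2.1 (flipBelow (n + 1) (n + k + 1)) = _
    rw [this, consInterval_succ]
  rw [← tendsto_add_atTop_iff_nat n]
  have h1 : ∀ k, ∑ j ∈ Finset.range (k + n), (reverseClock L ξ).2.1 j
      = (∑ j ∈ Finset.range (k + n), ξ.2.1 j) + (∑ j ∈ Finset.range n, (reverseClock L ξ).2.1 j
        - ∑ j ∈ Finset.range n, ξ.2.1 j) := by
    intro k
    rw [add_comm k n, Finset.sum_range_add, Finset.sum_range_add]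
    simp_rw [htail]
    ring
  simp_rw [h1]
  exact tendsto_atTop_add_const_right _ _
    ((tendsto_add_atTop_iff_nat n).2 hξ.intervals.tendsto)

lemma countUpTo_reverseClock {L : ℝ} {ξ : StatClock M} (hξ : GoodClock ξ) :
    countUpTo (epoch (reverseClock L ξ).1.1 (reverseClock L ξ).2.1) L
      = countUpTo (epoch ξ.1.1 ξ.2.1) L := by
  have hg := (goodIntervals_reverseClock (L := L) hξ).goodEpochs (reverseClock L ξ).1.1
  refine hg.countUpTo_eq (fun k hk => ?_) ?_
  · rw [epoch_reverseClock hk]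
    have := (hξ.intervals.goodEpochs ξ.1.1).strictMono.monotone
      (Nat.zero_le (countUpTo (epoch ξ.1.1 ξ.2.1) L - 1 - k))
    rw [epoch_zero] at this
    linarith [hξ.window.1]
  · rw [epoch_reverseClock_countUpTo]
    linarith [hξ.window.2]

/-- The residual time at `L` of the reversed clock is the age at `0` of the clock. -/
lemma residual_reverseClock {L : ℝ} {ξ : StatClock M} (hξ : GoodClock ξ) :
    residual (epoch (reverseClock L ξ).1.1 (reverseClock L ξ).2.1) L = ξ.1.2 - ξ.1.1 := by
  rw [AutonomousNetwork.residual, countUpTo_reverseClock hξ, epoch_reverseClock_countUpTo]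
  ring

/-- Marked counts of the reversed clock. -/
lemma ncard_reverseClock {L s : ℝ} (hsL : s ≤ L) {ξ : StatClock M}
    (hξ : GoodClock ξ) (Q : M → Prop) :
    {k | epoch (reverseClock L ξ).1.1 (reverseClock L ξ).2.1 k ≤ s
        ∧ Q ((reverseClock L ξ).2.2 k)}.ncard
      = {k | (L - s ≤ epoch ξ.1.1 ξ.2.1 k ∧ epoch ξ.1.1 ξ.2.1 k ≤ L) ∧ Q (ξ.2.2 k)}.ncard := by
  set n := countUpTo (epoch ξ.1.1 ξ.2.1) L with hn
  have hg := hξ.intervals.goodEpochs ξ.1.1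
  have hg' := (goodIntervals_reverseClock (L := L) hξ).goodEpochs (reverseClock L ξ).1.1
  have hlt : ∀ k, epoch (reverseClock L ξ).1.1 (reverseClock L ξ).2.1 k ≤ s → k < n := by
    intro k hk
    rw [hn, ← countUpTo_reverseClock hξ, hg'.lt_countUpTo_iff]
    exact hk.trans hsL
  have hmark : ∀ k < n, (reverseClock L ξ).2.2 k = ξ.2.2 (n - 1 - k) := by
    intro k hk
    change ξ.2.2 (flipBelow n k) = _
    rw [flipBelow, if_pos hk]
  refine Set.ncard_congr (fun k _ => n - 1 - k) ?_ ?_ ?_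
  · rintro k ⟨h1, h2⟩
    have hk := hlt k h1
    rw [epoch_reverseClock hk] at h1
    rw [hmark k hk] at h2
    refine ⟨⟨by linarith, ?_⟩, h2⟩
    rw [← hg.lt_countUpTo_iff]
    omega
  · intro i j hi hj hij
    have h1 := hlt i hi.1
    have h2 := hlt j hj.1
    omega
  · rintro l ⟨⟨h1, h2⟩, h3⟩
    rw [← hg.lt_countUpTo_iff, ← hn] at h2
    have hk : n - 1 - l < n := by omega
    have e : n - 1 - (n - 1 - l) = l := by omega
    refine ⟨n - 1 - l, ⟨?_, ?_⟩, e⟩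
    · rw [epoch_reverseClock hk, ← hn, e]; linarith
    · rw [hmark _ hk, e]; exact h3

variable [MeasurableSpace M]

/-- The law of a stationary clock seen at time `0`. The first epoch `x` and the covering interval `v`
have joint law `rate • (dx ⊗ m(dv))` on the window `0 ≤ x < v`, that is, the covering interval is
size-biased and `0` is uniformly placed in it; the later intervals and the marks are independent
of these. -/
def statClockLaw (m : Measure ℝ) (rate : ℝ) (q : Measure M) : Measure (StatClock M) :=
  (ENNReal.ofReal rate • (volume.prod m).restrict {p | 0 ≤ p.1 ∧ p.1 < p.2}).prod (clockLaw m q)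

variable {m : Measure ℝ} [IsProbabilityMeasure m] {q : Measure M} [IsProbabilityMeasure q]
  {rate : ℝ}

lemma isProbabilityMeasure_statClockLaw (hm : IsRenewalLaw m rate) (hr : 0 < rate) :
    IsProbabilityMeasure (statClockLaw m rate q) := by
  have h := isProbabilityMeasure_equilibriumLaw hm hr
  have : IsProbabilityMeasure
      (ENNReal.ofReal rate • (volume.prod m).restrict {p : ℝ × ℝ | 0 ≤ p.1 ∧ p.1 < p.2}) := by
    constructor
    have h1 := h.measure_univ
    rwa [equilibriumLaw, Measure.map_apply measurable_fst MeasurableSet.univ,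
      Set.preimage_univ] at h1
  unfold statClockLaw
  infer_instance

/-- The first epoch, the later intervals and the marks of a stationary clock. -/
lemma measurePreserving_forget_statClock (m : Measure ℝ) [IsProbabilityMeasure m] (q : Measure M)
    [IsProbabilityMeasure q] (rate : ℝ) :
    MeasurePreserving (fun ξ : StatClock M => (ξ.1.1, ξ.2)) (statClockLaw m rate q)
      ((equilibriumLaw m rate).prod (clockLaw m q)) :=
  MeasurePreserving.prod (μa := ENNReal.ofReal rate • (volume.prod m).restrict
    {p : ℝ × ℝ | 0 ≤ p.1 ∧ p.1 < p.2}) ⟨measurable_fst, rfl⟩ (MeasurePreserving.id _)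

omit [IsProbabilityMeasure q] in
lemma statClockLaw_ae_good (hm : IsRenewalLaw m rate) (hr : 0 < rate) :
    ∀ᵐ ξ ∂(statClockLaw m rate q), GoodClock ξ := by
  have h1 : ∀ᵐ p ∂(ENNReal.ofReal rate •
      (volume.prod m).restrict {p : ℝ × ℝ | 0 ≤ p.1 ∧ p.1 < p.2}), 0 ≤ p.1 ∧ p.1 < p.2 :=
    Measure.ae_smul_measure (ae_restrict_mem measurableSet_window) _
  filter_upwards [Measure.quasiMeasurePreserving_fst.ae h1,
    Measure.quasiMeasurePreserving_snd.ae (hm.ae_goodIntervals_clockLaw (q := q) hr)] with ξ h2 h3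
  exact ⟨h2, h3⟩

lemma measurable_consInterval :
    Measurable fun p : ℝ × (ℕ → ℝ) => consInterval p.1 p.2 := by
  refine measurable_pi_lambda _ fun k => ?_
  cases k with
  | zero => simpa using measurable_fst
  | succ k => simp only [consInterval_succ]; fun_prop

lemma measurePreserving_consInterval (m : Measure ℝ) [IsProbabilityMeasure m] :
    MeasurePreserving (fun p : ℝ × (ℕ → ℝ) => consInterval p.1 p.2) (m.prod (seqLaw m))
      (seqLaw m) := by
  have h1 : MeasurePreserving (Prod.map (fun u : ℕ → ℝ => u 0) id)
      ((seqLaw m).prod (seqLaw m)) (m.prod (seqLaw m)) :=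
    (measurePreserving_eval_seqLaw m 0).prod (MeasurePreserving.id _)
  have h2 : (fun p : ℝ × (ℕ → ℝ) => consInterval p.1 p.2) ∘ Prod.map (fun u : ℕ → ℝ => u 0) id
      = spliceAt 1 := by
    ext p k
    cases k with
    | zero => simp [spliceAt]
    | succ k => simp [spliceAt]
  have h3 := MeasurePreserving.map_of_comp (h2 ▸ measurePreserving_spliceAt m 1)
    measurable_consInterval h1.measurable
  rwa [h1.map_eq] at h3

lemma measurePreserving_splitInterval (m : Measure ℝ) [IsProbabilityMeasure m] :
    MeasurePreserving (fun v : ℕ → ℝ => (v 0, fun k => v (k + 1))) (seqLaw m)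
      (m.prod (seqLaw m)) := by
  have hm : Measurable fun v : ℕ → ℝ => (v 0, fun k => v (k + 1)) := by fun_prop
  refine ⟨hm, ?_⟩
  conv_lhs => rw [← (measurePreserving_consInterval m).map_eq]
  rw [Measure.map_map hm measurable_consInterval]
  have hid : (fun v : ℕ → ℝ => (v 0, fun k => v (k + 1))) ∘
      (fun p : ℝ × (ℕ → ℝ) => consInterval p.1 p.2) = id := by
    ext p : 1
    simp
  rw [hid, Measure.map_id]

/-- The reversal of the pieces preserves the measure before it is restricted to the window: for
given intervals it is a reflection of the first epoch. -/
lemma measurePreserving_reversePiece (m : Measure ℝ) [IsProbabilityMeasure m] (q : Measure M)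
    [IsProbabilityMeasure q] (L : ℝ) (n : ℕ) :
    MeasurePreserving (reversePiece (M := M) L n) ((volume.prod m).prod (clockLaw m q))
      ((volume.prod m).prod (clockLaw m q)) := by
  have a1 := measurePreserving_prodAssoc (volume : Measure ℝ) m (clockLaw m q)
  have a2 : MeasurePreserving _ (m.prod (clockLaw m q)) ((m.prod (seqLaw m)).prod (seqLaw q)) :=
    (measurePreserving_prodAssoc m (seqLaw m) (seqLaw q)).symm
  have a3 : MeasurePreserving _ ((m.prod (seqLaw m)).prod (seqLaw q)) (clockLaw m q) :=
    (measurePreserving_consInterval m).prod (MeasurePreserving.id (seqLaw q))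
  have b1 : MeasurePreserving _ ((volume : Measure ℝ).prod (m.prod (clockLaw m q)))
      ((volume.prod m).prod (clockLaw m q)) :=
    (measurePreserving_prodAssoc (volume : Measure ℝ) m (clockLaw m q)).symm
  have b2 := measurePreserving_prodAssoc m (seqLaw m) (seqLaw q)
  have b3 : MeasurePreserving _ (clockLaw m q) ((m.prod (seqLaw m)).prod (seqLaw q)) :=
    (measurePreserving_splitInterval m).prod (MeasurePreserving.id (seqLaw q))
  have hΦ := (Measure.measurePreserving_swap (μ := (volume : Measure ℝ)) (ν := clockLaw m q)).comp
    (((MeasurePreserving.id (volume : Measure ℝ)).prod (a3.comp a2)).comp a1)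
  have hΨ := (b1.comp ((MeasurePreserving.id (volume : Measure ℝ)).prod (b2.comp b3))).comp
    (Measure.measurePreserving_swap (μ := clockLaw m q) (ν := (volume : Measure ℝ)))
  have hbase : MeasurePreserving (fun w : ClockPath M =>
      ((fun k => w.1 (flipBelow (n + 1) k), fun k => w.2 (flipBelow n k)) : ClockPath M))
      (clockLaw m q) (clockLaw m q) :=
    (measurePreserving_reindex_seqLaw m (flipBelow_injective (n + 1))).prod
      (measurePreserving_reindex_seqLaw q (flipBelow_injective n))
  -- Among the intervals with the covering one put in front, reversal permutes the first `n + 1`,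
  -- permutes the first `n` marks and reflects the first epoch, given the intervals.
  have hT : MeasurePreserving (fun p : ClockPath M × ℝ =>
      (((fun k => p.1.1 (flipBelow (n + 1) k), fun k => p.1.2 (flipBelow n k)) : ClockPath M),
        L - epoch (p.2 - p.1.1 0) p.1.1 n))
      ((clockLaw m q).prod volume) ((clockLaw m q).prod volume) := by
    refine hbase.skew_product (g := fun w x => L - epoch (x - w.1 0) w.1 n) ?_ ?_
    · exact measurable_const.sub (measurable_epoch (by fun_prop) (by fun_prop) n)
    · refine Eventually.of_forall fun w => ?_
      have : (fun x : ℝ => L - epoch (x - w.1 0) w.1 n)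
          = fun x => (L + w.1 0 - ∑ k ∈ Finset.range n, w.1 k) - x := by
        ext x; simp only [epoch]; ring
      rw [this]
      exact (Measure.measurePreserving_sub_left volume _).map_eq
  convert hΨ.comp (hT.comp hΦ) using 1
  rfl

lemma measurable_reversePiece (L : ℝ) (n : ℕ) : Measurable (reversePiece (M := M) L n) := by
  have hv : Measurable fun ξ : StatClock M => consInterval ξ.1.2 ξ.2.1 :=
    measurable_consInterval.comp (by fun_prop : Measurable fun ξ : StatClock M => (ξ.1.2, ξ.2.1))
  have hvk : ∀ k, Measurable fun ξ : StatClock M => consInterval ξ.1.2 ξ.2.1 k := fun k =>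
    (measurable_pi_apply k).comp hv
  exact ((measurable_const.sub (measurable_epoch (by fun_prop) hv n)).prodMk (hvk _)).prodMk
    ((measurable_pi_lambda _ fun k => hvk _).prodMk (by fun_prop))

lemma measurable_reverseClock (L : ℝ) : Measurable (reverseClock (M := M) L) := by
  have h : Measurable fun x : StatClock M × ℕ => reversePiece L x.2 x.1 :=
    measurable_from_prod_countable_left fun n => measurable_reversePiece L n
  exact h.comp (measurable_id.prodMk (measurable_countUpTo_epoch (by fun_prop) (by fun_prop)
    measurable_const))

/-- A stationary clock is reversible. -/
theorem measurePreserving_reverseClock (hm : IsRenewalLaw m rate) (hr : 0 < rate) {L : ℝ}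
    (hL : 0 ≤ L) :
    MeasurePreserving (reverseClock (M := M) L) (statClockLaw m rate q)
      (statClockLaw m rate q) := by
  set μ₀ : Measure (StatClock M) := (volume.prod m).prod (clockLaw m q) with hμ
  have hgood : ∀ᵐ ξ ∂μ₀, GoodIntervals ξ.2.1 :=
    Measure.quasiMeasurePreserving_snd.ae (hm.ae_goodIntervals_clockLaw (q := q) hr)
  have hW : MeasurableSet {ξ : StatClock M | InWindow ξ} := measurable_fst measurableSet_window
  have hN : Measurable fun ξ : StatClock M => countUpTo (epoch ξ.1.1 ξ.2.1) L :=
    measurable_countUpTo_epoch (by fun_prop) (by fun_prop) measurable_const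
  set A : ℕ → Set (StatClock M) := fun n =>
    {ξ | InWindow ξ} ∩ {ξ | countUpTo (epoch ξ.1.1 ξ.2.1) L = n} with hA
  have hAm : ∀ n, MeasurableSet (A n) := fun n => hW.inter (hN (measurableSet_singleton n))
  have hAd : Pairwise (Function.onFun Disjoint A) := fun i j hij =>
    Set.disjoint_left.2 fun p hi hj => hij (Eq.trans (Eq.symm hi.2) hj.2)
  have hS := fun n => measurePreserving_reversePiece (M := M) m q L n
  have h := measurePreserving_of_pieces (μ := μ₀) (ν := μ₀) (measurable_reverseClock L) hAm hAm
    hAd hAd hS (fun n => ?_) (fun n ξ hξ => by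
      have : countUpTo (epoch ξ.1.1 ξ.2.1) L = n := hξ.2
      rw [reverseClock, this])
  · have hU : (⋃ n, A n) = {p : ℝ × ℝ | 0 ≤ p.1 ∧ p.1 < p.2} ×ˢ Set.univ := by
      ext ξ
      simp [hA, InWindow]
    rw [hU, hμ, ← Measure.prod_restrict, Measure.restrict_univ] at h
    unfold statClockLaw
    rw [Measure.prod_smul_left]
    exact h.smul_measure _
  · filter_upwards [hgood, (hS n).quasiMeasurePreserving.ae hgood] with ξ h1 h2
    refine eq_iff_iff.2 ?_
    exact (hasEpochs_iff hL h2).symm.trans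
      ((hasEpochs_reversePiece L n ξ).trans (hasEpochs_iff hL h1))

end Reversal

/-! ### Law of large numbers for marked renewal clocks -/

section LongRun

open AutonomousNetwork

lemma GoodEpochs.tendsto_countUpTo {e : ℕ → ℝ} (he : GoodEpochs e) :
    Tendsto (countUpTo e) atTop atTop := by
  refine tendsto_atTop.2 fun n => ?_
  filter_upwards [eventually_ge_atTop (e n)] with t ht
  exact (he.lt_countUpTo_iff.2 ht).le

lemma GoodEpochs.countUpTo_mono {e : ℕ → ℝ} (he : GoodEpochs e) : Monotone (countUpTo e) :=
  fun _ t hst => Set.ncard_le_ncard (fun _ hn => le_trans (b := _) hn hst) (he.finite t)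

/-- The asymptotic rate of a renewal process. -/
lemma tendsto_countUpTo_div {u : ℕ → ℝ} (hu : GoodIntervals u) (a : ℝ) {rate : ℝ} (hr : 0 < rate)
    (hlim : Tendsto (fun n : ℕ => (∑ k ∈ Finset.range n, u k) / n) atTop (𝓝 (1 / rate))) :
    Tendsto (fun t : ℝ => (countUpTo (epoch a u) t : ℝ) / t) atTop (𝓝 rate) := by
  have hg := hu.goodEpochs a
  have h1 : Tendsto (fun n : ℕ => epoch a u n / n) atTop (𝓝 (1 / rate)) := by
    have := (tendsto_const_div_atTop_nhds_zero_nat a).add hlim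
    rw [zero_add] at this
    refine this.congr fun n => ?_
    rw [epoch, add_div]
  have h2 : Tendsto (fun n : ℕ => epoch a u (n - 1) / n) atTop (𝓝 (1 / rate)) := by
    rw [← tendsto_add_atTop_iff_nat 1]
    have h3 := h1.mul (tendsto_natCast_div_add_atTop (1 : ℝ))
    rw [mul_one] at h3
    refine h3.congr' ?_
    filter_upwards [eventually_gt_atTop 0] with n hn
    rw [Nat.add_sub_cancel]
    push_cast
    field_simp
  have hN := hg.tendsto_countUpTo
  have h4 : Tendsto (fun t : ℝ => t / (countUpTo (epoch a u) t : ℝ)) atTop (𝓝 (1 / rate)) := by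
    refine tendsto_of_tendsto_of_tendsto_of_le_of_le' (h2.comp hN) (h1.comp hN) ?_ ?_
    · filter_upwards [hN.eventually_gt_atTop 0] with t ht
      simp only [Function.comp_apply]
      gcongr
      rw [← hg.lt_countUpTo_iff]
      omega
    · filter_upwards with t
      simp only [Function.comp_apply]
      gcongr
      exact (hg.lt_epoch_countUpTo t).le
  have h5 := h4.inv₀ (by positivity)
  simpa using h5

lemma ncard_mark_eq {M : Type*} [DecidableEq M] {u : ℕ → ℝ} (hu : GoodIntervals u) (a : ℝ)
    (r : ℕ → M) (j : M) (t : ℝ) :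
    ({n | epoch a u n ≤ t ∧ r n = j}.ncard : ℝ)
      = ∑ k ∈ Finset.range (countUpTo (epoch a u) t), (if r k = j then (1 : ℝ) else 0) := by
  have : {n | epoch a u n ≤ t ∧ r n = j}
      = (((Finset.range (countUpTo (epoch a u) t)).filter (r · = j) : Finset ℕ) : Set ℕ) := by
    ext n
    simp [(hu.goodEpochs a).lt_countUpTo_iff]
  rw [this, Set.ncard_coe_finset, Finset.sum_boole]

/-- The asymptotic rate of the marked epochs of a renewal process. -/
lemma tendsto_ncard_mark_div {M : Type*} [DecidableEq M] {u : ℕ → ℝ} (hu : GoodIntervals u) (a : ℝ)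
    {rate : ℝ} (hr : 0 < rate)
    (hlim : Tendsto (fun n : ℕ => (∑ k ∈ Finset.range n, u k) / n) atTop (𝓝 (1 / rate)))
    {r : ℕ → M} {j : M} {p : ℝ}
    (hmark : Tendsto (fun n : ℕ => (∑ k ∈ Finset.range n, if r k = j then (1 : ℝ) else 0) / n)
      atTop (𝓝 p)) :
    Tendsto (fun t : ℝ => ({n | epoch a u n ≤ t ∧ r n = j}.ncard : ℝ) / t) atTop
      (𝓝 (p * rate)) := by
  have hN := (hu.goodEpochs a).tendsto_countUpTo
  refine ((hmark.comp hN).mul (tendsto_countUpTo_div hu a hr hlim)).congr' ?_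
  filter_upwards [hN.eventually_gt_atTop 0] with t ht
  simp only [Function.comp_apply]
  rw [ncard_mark_eq hu]
  have : (countUpTo (epoch a u) t : ℝ) ≠ 0 := by positivity
  field_simp

end LongRun

/-! ### One reflected queue -/

section Queue

open AutonomousNetwork

/-- The input counts `I` of a queue and the epochs `e` of its server: the input does not jump at
an epoch of the server. -/
structure QueueInput (I : ℝ → ℕ) (e : ℕ → ℝ) : Prop where
  mono : Monotone I
  epochs : GoodEpochs e
  pos : 0 < e 0
  no_common : ∀ n, ∀ᶠ s in 𝓝[<] (e n), I s = I (e n)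

/-- Input minus number of activity completions. -/
def netInput (I : ℝ → ℕ) (e : ℕ → ℝ) (t : ℝ) : ℤ := (I t : ℤ) - countUpTo e t

/-- The number of wasted completions of a queue with initial length `y₀` and net input `X`, given by
the reflection formula: the least nondecreasing correction that keeps `y₀ + X` nonnegative. -/
def wasted (y₀ : ℤ) (X : ℝ → ℤ) (t : ℝ) : ℤ :=
  max 0 (sSup ((fun s => -X s - y₀) '' Set.Icc 0 t))

/-- The length of the queue with initial length `y₀` and net input `X`. -/
def queueLength (y₀ : ℤ) (X : ℝ → ℤ) (t : ℝ) : ℤ := y₀ + X t + wasted y₀ X t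

variable {X : ℝ → ℤ} {y₀ : ℤ} {t : ℝ}

lemma wasted_le_iff (hX : BddBelow (X '' Set.Icc 0 t)) (ht : 0 ≤ t) {c : ℤ} :
    wasted y₀ X t ≤ c ↔ 0 ≤ c ∧ ∀ s ∈ Set.Icc 0 t, -X s - y₀ ≤ c := by
  have hne : ((fun s => -X s - y₀) '' Set.Icc 0 t).Nonempty := ⟨_, 0, ⟨le_rfl, ht⟩, rfl⟩
  have hb : BddAbove ((fun s => -X s - y₀) '' Set.Icc 0 t) := by
    obtain ⟨b, hb⟩ := hX
    refine ⟨-b - y₀, ?_⟩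
    rintro _ ⟨s, hs, rfl⟩
    have := hb ⟨s, hs, rfl⟩
    simp only
    omega
  rw [wasted, max_le_iff, csSup_le_iff hb hne, Set.forall_mem_image]

lemma wasted_nonneg : 0 ≤ wasted y₀ X t := le_max_left _ _

lemma queueLength_le_iff (hX : BddBelow (X '' Set.Icc 0 t)) (ht : 0 ≤ t) {c : ℤ} :
    queueLength y₀ X t ≤ c ↔ y₀ + X t ≤ c ∧ ∀ s ∈ Set.Icc 0 t, X t - X s ≤ c := by
  have h := wasted_le_iff (y₀ := y₀) hX ht (c := c - y₀ - X t)
  unfold queueLength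
  rw [show y₀ + X t + wasted y₀ X t ≤ c ↔ wasted y₀ X t ≤ c - y₀ - X t by omega, h]
  refine and_congr (by omega) (forall₂_congr fun s _ => by omega)

lemma queueLength_congr {X' : ℝ → ℤ} (h : ∀ s ∈ Set.Icc 0 t, X s = X' s) (ht : 0 ≤ t) :
    queueLength y₀ X t = queueLength y₀ X' t := by
  unfold queueLength wasted
  rw [h t ⟨ht, le_rfl⟩, Set.image_congr fun s hs => by rw [h s hs]]

/-- The queue restarted at time `t`. -/
lemma queueLength_add {X' : ℝ → ℤ} {s : ℝ} (hX : BddBelow (X '' Set.Icc 0 (t + s)))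
    (ht : 0 ≤ t) (hs : 0 ≤ s) (hX' : ∀ r ∈ Set.Icc 0 s, X (t + r) = X t + X' r) :
    queueLength y₀ X (t + s) = queueLength (queueLength y₀ X t) X' s := by
  have hXt : BddBelow (X '' Set.Icc 0 t) :=
    hX.mono (Set.image_mono (Set.Icc_subset_Icc_right (by linarith)))
  have hXs : BddBelow (X' '' Set.Icc 0 s) := by
    obtain ⟨b, hb⟩ := hX
    refine ⟨b - X t, ?_⟩
    rintro _ ⟨r, hr, rfl⟩
    have h1 := hb ⟨t + r, ⟨by linarith [hr.1], by linarith [hr.2]⟩, rfl⟩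
    rw [hX' r hr] at h1
    omega
  refine eq_of_forall_ge_iff fun c => ?_
  rw [queueLength_le_iff hX (by linarith), queueLength_le_iff hXs hs]
  have h1 := queueLength_le_iff (y₀ := y₀) hXt ht (c := c - X' s)
  rw [show queueLength y₀ X t + X' s ≤ c ↔ queueLength y₀ X t ≤ c - X' s by omega, h1]
  have hs' := hX' s ⟨hs, le_rfl⟩
  constructor
  · rintro ⟨h2, h3⟩
    refine ⟨⟨by omega, fun v hv => ?_⟩, fun r hr => ?_⟩
    · have := h3 v ⟨hv.1, by linarith [hv.2]⟩
      omega
    · have := h3 (t + r) ⟨by linarith [hr.1], by linarith [hr.2]⟩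
      rw [hX' r hr] at this
      omega
  · rintro ⟨⟨h2, h3⟩, h4⟩
    refine ⟨by omega, fun v hv => ?_⟩
    by_cases hvt : v ≤ t
    · have := h3 v ⟨hv.1, hvt⟩
      omega
    · have h5 : v - t ∈ Set.Icc 0 s := ⟨by linarith, by linarith [hv.2]⟩
      have h6 := h4 _ h5
      have h7 := hX' _ h5
      rw [add_sub_cancel] at h7
      omega

/-- Once the net input has fallen to `-y₀`, the initial queue length is forgotten. -/
lemma queueLength_eq_zero_start (hX : BddBelow (X '' Set.Icc 0 t)) {s : ℝ} (hs : s ∈ Set.Icc 0 t)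
    (hXs : X s ≤ -y₀) (hy : 0 ≤ y₀) :
    queueLength y₀ X t = queueLength 0 X t := by
  have ht : 0 ≤ t := hs.1.trans hs.2
  refine eq_of_forall_ge_iff fun c => ?_
  rw [queueLength_le_iff hX ht, queueLength_le_iff hX ht]
  constructor
  · rintro ⟨h1, h2⟩
    exact ⟨by omega, h2⟩
  · rintro ⟨h1, h2⟩
    have := h2 s hs
    exact ⟨by omega, h2⟩

variable {I : ℝ → ℕ} {e : ℕ → ℝ}

lemma QueueInput.bddBelow (h : QueueInput I e) (t : ℝ) :
    BddBelow (netInput I e '' Set.Icc 0 t) := by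
  refine ⟨-(countUpTo e t : ℤ), ?_⟩
  rintro _ ⟨s, hs, rfl⟩
  have := h.epochs.countUpTo_mono hs.2
  simp only [netInput]
  omega

lemma QueueInput.epoch_pos (h : QueueInput I e) (n : ℕ) : 0 < e n :=
  h.pos.trans_le (h.epochs.strictMono.monotone (Nat.zero_le n))

/-- The completions of the server up to time `t` that find the queue empty. -/
def emptyCompletions (e : ℕ → ℝ) (y : ℝ → ℕ) (t : ℝ) : Set ℕ :=
  {n | e n ≤ t ∧ ¬ ∀ᶠ s in 𝓝[<] (e n), 0 < y s}

/-- The completions that find the queue empty are counted by `wasted`, for any candidate path that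
is compatible with this count. -/
lemma QueueInput.ncard_emptyCompletions (h : QueueInput I e) {y₀ : ℕ} {y : ℝ → ℕ}
    (hy : ∀ s, 0 ≤ s → ((emptyCompletions e y s).ncard : ℤ) = wasted y₀ (netInput I e) s →
      (y s : ℤ) = queueLength y₀ (netInput I e) s) {t : ℝ} (ht : 0 ≤ t) :
    ((emptyCompletions e y t).ncard : ℤ) = wasted y₀ (netInput I e) t := by
  have hb := h.bddBelow
  obtain ⟨n, hn⟩ : ∃ n, countUpTo e t = n := ⟨_, rfl⟩
  induction n generalizing t with
  | zero =>
    have h1 : emptyCompletions e y t = ∅ := by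
      ext k
      simp only [emptyCompletions, Set.mem_ofPred_eq, Set.mem_empty_iff_false, iff_false]
      rintro ⟨h1, _⟩
      rw [← h.epochs.lt_countUpTo_iff, hn] at h1
      omega
    rw [h1, Set.ncard_empty, Nat.cast_zero]
    refine le_antisymm wasted_nonneg ((wasted_le_iff (hb t) ht).2 ⟨le_rfl, fun s hs => ?_⟩)
    have := h.epochs.countUpTo_mono hs.2
    simp only [netInput]
    omega
  | succ n ih =>
    have hτt : e n ≤ t := by rw [← h.epochs.lt_countUpTo_iff, hn]; omega
    have hlt : ∀ s, s < e n → countUpTo e s ≤ n := fun s hs => by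
      by_contra hc
      have := h.epochs.lt_countUpTo_iff.1 (not_le.1 hc)
      linarith
    -- The induction is on the number of completions up to `t`; the last of them, `e n`, increases
    -- `wasted` exactly if it brings `y₀ + X` to a new negative minimum, that is, if the queue is
    -- empty just before it.
    -- a left neighbourhood of the last completion without any other event
    obtain ⟨s₀, hs0, hs0τ, hI, hD⟩ : ∃ s₀, 0 ≤ s₀ ∧ s₀ < e n ∧
        (∀ s, s₀ ≤ s → s < e n → I s = I (e n)) ∧
        (∀ s, s₀ ≤ s → s < e n → countUpTo e s = n) := by
      obtain ⟨a, ha, ha2⟩ := (mem_nhdsLT_iff_exists_Ico_subset).1 (h.no_common n)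
      have hprev : ∃ b, b < e n ∧ 0 ≤ b ∧ ∀ s, b ≤ s → n ≤ countUpTo e s := by
        cases n with
        | zero => exact ⟨0, h.pos, le_rfl, fun s _ => Nat.zero_le _⟩
        | succ k => exact ⟨e k, h.epochs.strictMono (Nat.lt_succ_self k), (h.epoch_pos k).le,
            fun s hs => h.epochs.lt_countUpTo_iff.2 hs⟩
      obtain ⟨b, hb1, hb0, hb2⟩ := hprev
      refine ⟨max a b, hb0.trans (le_max_right _ _), max_lt ha hb1, fun s hs hsτ => ?_,
        fun s hs hsτ => ?_⟩
      · exact ha2 ⟨(le_max_left _ _).trans hs, hsτ⟩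
      · exact le_antisymm (hlt s hsτ) (hb2 s ((le_max_right _ _).trans hs))
    have hDτ : countUpTo e (e n) = n + 1 := by
      refine le_antisymm ?_ (h.epochs.lt_countUpTo_iff.2 le_rfl)
      rw [← hn]; exact h.epochs.countUpTo_mono hτt
    have hτ0 := h.epoch_pos n
    have hX0 : ∀ s, s₀ ≤ s → s < e n → netInput I e s = netInput I e s₀ := fun s h1 h2 => by
      simp only [netInput]
      rw [hI s h1 h2, hI s₀ le_rfl hs0τ, hD s h1 h2, hD s₀ le_rfl hs0τ]
    have hXτ : netInput I e (e n) = netInput I e s₀ - 1 := by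
      simp only [netInput]
      rw [hI s₀ le_rfl hs0τ, hD s₀ le_rfl hs0τ, hDτ]
      push_cast; ring
    have hw0 : ∀ s, s₀ ≤ s → s < e n →
        wasted y₀ (netInput I e) s = wasted y₀ (netInput I e) s₀ := fun s h1 h2 => by
      refine eq_of_forall_ge_iff fun c => ?_
      rw [wasted_le_iff (hb s) (hs0.trans h1), wasted_le_iff (hb s₀) hs0]
      refine and_congr_right fun _ => ⟨fun h3 r hr => h3 r ⟨hr.1, hr.2.trans h1⟩, fun h3 r hr => ?_⟩
      by_cases hrs : r ≤ s₀
      · exact h3 r ⟨hr.1, hrs⟩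
      · rw [hX0 r (not_le.1 hrs).le (hr.2.trans_lt h2)]
        exact h3 s₀ ⟨hs0, le_rfl⟩
    have hys : ∀ s, s₀ ≤ s → s < e n →
        (y s : ℤ) = y₀ + netInput I e s₀ + wasted y₀ (netInput I e) s₀ := fun s h1 h2 => by
      rw [hy s (hs0.trans h1) (ih (hs0.trans h1) (hD s h1 h2)), queueLength, hX0 s h1 h2,
        hw0 s h1 h2]
    have hev : (∀ᶠ s in 𝓝[<] (e n), 0 < y s) ↔ 0 < y s₀ := by
      have hmem : Set.Ico s₀ (e n) ∈ 𝓝[<] (e n) := Ico_mem_nhdsLT hs0τ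
      constructor
      · intro h1
        obtain ⟨s, hs1, hs2⟩ := (h1.and hmem).exists
        have e1 := hys s hs2.1 hs2.2
        have e2 := hys s₀ le_rfl hs0τ
        omega
      · intro h1
        filter_upwards [hmem] with s hs
        have e1 := hys s hs.1 hs.2
        have e2 := hys s₀ le_rfl hs0τ
        omega
    have hwt : wasted y₀ (netInput I e) t
        = max (wasted y₀ (netInput I e) s₀) (-netInput I e (e n) - y₀) := by
      refine eq_of_forall_ge_iff fun c => ?_
      rw [max_le_iff, wasted_le_iff (hb t) ht, wasted_le_iff (hb s₀) hs0]
      constructor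
      · rintro ⟨h1, h2⟩
        exact ⟨⟨h1, fun r hr => h2 r ⟨hr.1, hr.2.trans (hs0τ.le.trans hτt)⟩⟩,
          h2 _ ⟨hτ0.le, hτt⟩⟩
      · rintro ⟨⟨h1, h2⟩, h3⟩
        refine ⟨h1, fun r hr => ?_⟩
        by_cases hr1 : r ≤ s₀
        · exact h2 r ⟨hr.1, hr1⟩
        by_cases hr2 : r < e n
        · rw [hX0 r (not_le.1 hr1).le hr2]
          exact h2 s₀ ⟨hs0, le_rfl⟩
        · have e1 := h.mono (not_lt.1 hr2)
          have e2 := h.epochs.countUpTo_mono hr.2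
          rw [hn] at e2
          simp only [netInput] at h3 ⊢
          rw [hDτ] at h3
          push_cast at h3
          omega
    have hy0 := hys s₀ le_rfl hs0τ
    have hih := ih hs0 (hD s₀ le_rfl hs0τ)
    have hset : emptyCompletions e y t
        = emptyCompletions e y s₀ ∪ {k | k = n ∧ ¬ 0 < y s₀} := by
      ext k
      simp only [emptyCompletions, Set.mem_union, Set.mem_ofPred_eq]
      constructor
      · rintro ⟨h1, h2⟩
        rw [← h.epochs.lt_countUpTo_iff, hn] at h1
        rcases Nat.lt_succ_iff_lt_or_eq.1 h1 with h3 | rfl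
        · left
          refine ⟨?_, h2⟩
          rw [← h.epochs.lt_countUpTo_iff, hD s₀ le_rfl hs0τ]
          exact h3
        · right
          exact ⟨rfl, fun h3 => h2 (hev.2 h3)⟩
      · rintro (⟨h1, h2⟩ | ⟨rfl, h2⟩)
        · exact ⟨h1.trans (hs0τ.le.trans hτt), h2⟩
        · exact ⟨hτt, fun h3 => h2 (hev.1 h3)⟩
    have hfin : (emptyCompletions e y s₀).Finite :=
      (h.epochs.finite s₀).subset fun k hk => hk.1
    have hdisj : Disjoint (emptyCompletions e y s₀) {k | k = n ∧ ¬ 0 < y s₀} := by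
      rw [Set.disjoint_left]
      rintro k ⟨h1, _⟩ ⟨rfl, _⟩
      linarith
    have hfin2 : {k | k = n ∧ ¬ 0 < y s₀}.Finite := (Set.finite_singleton n).subset fun k hk => hk.1
    rw [hset, Set.ncard_union_eq hdisj hfin hfin2, hwt, hXτ]
    push_cast
    rw [hih]
    by_cases h0 : 0 < y s₀
    · have : {k | k = n ∧ ¬ 0 < y s₀} = ∅ := by ext k; simp [h0]
      rw [this, Set.ncard_empty]
      push_cast
      omega
    · have : {k | k = n ∧ ¬ 0 < y s₀} = {n} := by ext k; simp [h0]
      rw [this, Set.ncard_singleton]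
      push_cast
      omega

/-- A path solves the queueing equation if and only if it is given by `queueLength`. -/
theorem QueueInput.solution_iff (h : QueueInput I e) {y₀ : ℕ} {y : ℝ → ℕ} :
    (∀ t, 0 ≤ t → y t + {n | e n ≤ t ∧ ∀ᶠ s in 𝓝[<] (e n), 0 < y s}.ncard = y₀ + I t) ↔
      ∀ t, 0 ≤ t → (y t : ℤ) = queueLength y₀ (netInput I e) t := by
  have hsplit : ∀ t, {n | e n ≤ t ∧ ∀ᶠ s in 𝓝[<] (e n), 0 < y s}.ncard
      + (emptyCompletions e y t).ncard = countUpTo e t := by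
    intro t
    have hf := h.epochs.finite t
    rw [← Set.ncard_union_eq _ (hf.subset fun k hk => hk.1) (hf.subset fun k hk => hk.1)]
    · congr 1
      ext k
      simp only [emptyCompletions, Set.mem_union, Set.mem_ofPred_eq]
      tauto
    · rw [Set.disjoint_left]
      exact fun k hk1 hk2 => hk2.2 hk1.2
  constructor
  · intro hsol t ht
    have key : ∀ s, 0 ≤ s → (y s : ℤ) = y₀ + netInput I e s + (emptyCompletions e y s).ncard := by
      intro s hs
      have h1 := hsol s hs
      have h2 := hsplit s
      simp only [netInput]
      omega
    have h1 := h.ncard_emptyCompletions (y₀ := y₀) (y := y) (fun s hs hw => by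
      rw [key s hs, hw, queueLength]) ht
    rw [key t ht, h1, queueLength]
  · intro hq t ht
    have h1 := h.ncard_emptyCompletions (y₀ := y₀) (y := y) (fun s hs _ => hq s hs) ht
    have h2 := hsplit t
    have h3 := hq t ht
    rw [queueLength, ← h1] at h3
    simp only [netInput] at h3
    omega

end Queue

/-! ### Paths of the network -/

section LocalCounts

lemma GoodEpochs.eventually_lt_iff {e : ℕ → ℝ} (he : GoodEpochs e) (r : ℝ) :
    ∀ᶠ s in 𝓝 r, ∀ n, (e n < r → e n < s) ∧ (r < e n → s < e n) := by
  obtain ⟨N, hN⟩ := he.exists_lt r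
  have h1 : ∀ᶠ s in 𝓝 r, ∀ n ∈ Set.Iic N, (e n < r → e n < s) ∧ (r < e n → s < e n) := by
    refine (Set.finite_Iic N).eventually_all.2 fun n _ => ?_
    rcases lt_trichotomy (e n) r with h | h | h
    · filter_upwards [lt_mem_nhds h] with s hs using ⟨fun _ => hs, fun h' => absurd h' h.not_gt⟩
    · exact Eventually.of_forall fun s => ⟨fun h' => absurd h' h.not_lt, fun h' => absurd h' h.not_gt⟩
    · filter_upwards [gt_mem_nhds h] with s hs using ⟨fun h' => absurd h' h.not_gt, fun _ => hs⟩
  filter_upwards [h1] with s hs n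
  by_cases hn : n ≤ N
  · exact hs n hn
  · have h2 := he.strictMono.monotone (not_le.1 hn).le
    exact ⟨fun h3 => by linarith, fun _ => ((hs N Set.self_mem_Iic).2 hN).trans_le h2⟩

end LocalCounts

namespace AutonomousNetwork

variable {d : ℕ} {net : AutonomousNetwork d}

/-- All clocks of the network: those of the external arrivals and those of the servers. -/
abbrev Clock (net : AutonomousNetwork d) : Type := net.Src ⊕ Fin d

/-- Intervals and marks of all clocks; the marks of the external arrivals carry no information. -/
abbrev Paths (net : AutonomousNetwork d) : Type := net.Clock → ClockPath (Fin (d + 1))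

/-- Number of the epochs of the clock `k` that lie in `S` and whose mark satisfies `p`. -/
def cnt (a : net.Clock → ℝ) (v : net.Paths) (S : Set ℝ) (k : net.Clock) (p : Fin (d + 1) → Prop) :
    ℤ :=
  ({n | epoch (a k) (v k).1 n ∈ S ∧ p ((v k).2 n)}.ncard : ℤ)

/-- Arrivals minus activity completions at station `i`, for given counts of marked epochs. -/
def netOf (c : net.Clock → (Fin (d + 1) → Prop) → ℤ) (i : Fin d) : ℤ :=
  (if h : 0 < net.lam i then c (Sum.inl ⟨i, h⟩) (fun _ => True) else 0)
    + ∑ j ∈ Finset.univ.erase i, c (Sum.inr j) (fun x => x = i.succ)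
    - c (Sum.inr i) (fun _ => True)

/-- The net input of station `i` up to time `t`. -/
def netPath (a : net.Clock → ℝ) (v : net.Paths) (i : Fin d) (t : ℝ) : ℤ :=
  netOf (cnt a v (Set.Iic t)) i

lemma netOf_sub (c c' : net.Clock → (Fin (d + 1) → Prop) → ℤ) (i : Fin d) :
    netOf (fun k p => c k p - c' k p) i = netOf c i - netOf c' i := by
  unfold netOf
  rw [Finset.sum_sub_distrib]
  split_ifs <;> ring

lemma netOf_add (c c' : net.Clock → (Fin (d + 1) → Prop) → ℤ) (i : Fin d) :
    netOf (fun k p => c k p + c' k p) i = netOf c i + netOf c' i := by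
  unfold netOf
  rw [Finset.sum_add_distrib]
  split_ifs <;> ring

/-- All clocks have positive intervals with infinite sum. -/
def GoodPaths (v : net.Paths) : Prop := ∀ k, GoodIntervals (v k).1

lemma GoodPaths.epochs {v : net.Paths} (hv : GoodPaths v) (a : net.Clock → ℝ) (k : net.Clock) :
    GoodEpochs (epoch (a k) (v k).1) := (hv k).goodEpochs _

variable {a : net.Clock → ℝ} {v : net.Paths}

lemma cnt_congr {S T : Set ℝ} (h : ∀ k n, epoch (a k) (v k).1 n ∈ S ↔ epoch (a k) (v k).1 n ∈ T) :
    cnt a v S = cnt a v T := by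
  ext k p
  unfold cnt
  simp_rw [h k]

lemma cnt_add (hv : GoodPaths v) {S T U : Set ℝ} (hST : Disjoint S T) (hU : S ∪ T = U)
    (hb : BddAbove U) (k : net.Clock) (p : Fin (d + 1) → Prop) :
    cnt a v S k p + cnt a v T k p = cnt a v U k p := by
  obtain ⟨b, hb⟩ := hb
  have hfin := (hv.epochs a k).finite b
  have h1 : Disjoint {n | epoch (a k) (v k).1 n ∈ S ∧ p ((v k).2 n)}
      {n | epoch (a k) (v k).1 n ∈ T ∧ p ((v k).2 n)} := by
    rw [Set.disjoint_left]
    exact fun n h1 h2 => Set.disjoint_left.1 hST h1.1 h2.1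
  have h2 : {n | epoch (a k) (v k).1 n ∈ S ∧ p ((v k).2 n)}.Finite :=
    hfin.subset fun n hn => hb (hU ▸ Or.inl hn.1)
  have h3 : {n | epoch (a k) (v k).1 n ∈ T ∧ p ((v k).2 n)}.Finite :=
    hfin.subset fun n hn => hb (hU ▸ Or.inr hn.1)
  unfold cnt
  rw [← Nat.cast_add, ← Set.ncard_union_eq h1 h2 h3]
  congr 2
  ext n
  simp only [Set.mem_union, Set.mem_ofPred_eq, ← hU]
  tauto

lemma netOf_cnt_Icc (hv : GoodPaths v) {r L : ℝ} (hr : r ≤ L) (i : Fin d) :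
    netOf (cnt a v (Set.Icc r L)) i = netPath a v i L - netOf (cnt a v (Set.Iio r)) i := by
  rw [netPath, ← netOf_sub]
  congr 1
  ext k p
  have := cnt_add (a := a) hv (S := Set.Iio r) (T := Set.Icc r L) (U := Set.Iic L)
    (Set.disjoint_left.2 fun x h1 h2 => absurd h1 (not_lt.2 h2.1))
    (by ext x; simp only [Set.mem_union, Set.mem_Iio, Set.mem_Icc, Set.mem_Iic]
        constructor
        · rintro (h | h)
          · exact h.le.trans hr
          · exact h.2
        · intro h
          by_cases h' : x < r
          · exact Or.inl h'
          · exact Or.inr ⟨not_lt.1 h', h⟩) bddAbove_Iic k p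
  omega

/-- Near `r`, the epochs other than `r` stay on their side. -/
lemma GoodPaths.eventually_lt_iff (hv : GoodPaths v) (a : net.Clock → ℝ) (r : ℝ) :
    ∀ᶠ s in 𝓝 r, ∀ k n, (epoch (a k) (v k).1 n < r → epoch (a k) (v k).1 n < s) ∧
      (r < epoch (a k) (v k).1 n → s < epoch (a k) (v k).1 n) :=
  eventually_all.2 fun k => (hv.epochs a k).eventually_lt_iff r

/-- The net input is right-continuous. -/
lemma GoodPaths.netPath_right (hv : GoodPaths v) (a : net.Clock → ℝ) (i : Fin d) (r : ℝ) :
    ∀ᶠ s in 𝓝[>] r, netPath a v i s = netPath a v i r := by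
  filter_upwards [nhdsWithin_le_nhds (hv.eventually_lt_iff a r), self_mem_nhdsWithin] with s hs hsr
  unfold netPath
  rw [cnt_congr fun k n => ?_]
  simp only [Set.mem_Iic]
  have hsr' : r < s := hsr
  constructor
  · intro h
    by_contra h'
    have := (hs k n).2 (not_le.1 h')
    linarith
  · intro h; linarith

lemma GoodPaths.netPath_right' (hv : GoodPaths v) (a : net.Clock → ℝ) (i : Fin d) (r : ℝ) :
    ∀ᶠ s in 𝓝[>] r, netOf (cnt a v (Set.Iio s)) i = netPath a v i r := by
  filter_upwards [nhdsWithin_le_nhds (hv.eventually_lt_iff a r), self_mem_nhdsWithin] with s hs hsr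
  unfold netPath
  rw [cnt_congr fun k n => ?_]
  simp only [Set.mem_Iic, Set.mem_Iio]
  have hsr' : r < s := hsr
  constructor
  · intro h
    by_contra h'
    have := (hs k n).2 (not_le.1 h')
    linarith
  · intro h; linarith

lemma GoodPaths.netPath_left (hv : GoodPaths v) (a : net.Clock → ℝ) (i : Fin d) (r : ℝ) :
    ∀ᶠ s in 𝓝[<] r, netPath a v i s = netOf (cnt a v (Set.Iio r)) i := by
  filter_upwards [nhdsWithin_le_nhds (hv.eventually_lt_iff a r), self_mem_nhdsWithin] with s hs hsr
  unfold netPath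
  rw [cnt_congr fun k n => ?_]
  simp only [Set.mem_Iic, Set.mem_Iio]
  have hsr' : s < r := hsr
  constructor
  · intro h; linarith
  · intro h; exact ((hs k n).1 h).le

/-- No clock has an epoch at `t`. -/
def NoEpochAt (a : net.Clock → ℝ) (v : net.Paths) (t : ℝ) : Prop :=
  ∀ k n, epoch (a k) (v k).1 n ≠ t

lemma NoEpochAt.netOf_Iio {t : ℝ} (h : NoEpochAt a v t) (i : Fin d) :
    netOf (cnt a v (Set.Iio t)) i = netPath a v i t := by
  unfold netPath
  rw [cnt_congr fun k n => ?_]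
  simp only [Set.mem_Iic, Set.mem_Iio]
  exact ⟨le_of_lt, fun h' => lt_of_le_of_ne h' (h k n)⟩

/-- Arrivals at station `i`. -/
def inCount (a : net.Clock → ℝ) (v : net.Paths) (i : Fin d) (t : ℝ) : ℕ :=
  (if h : 0 < net.lam i then
      countUpTo (epoch (a (Sum.inl ⟨i, h⟩)) (v (Sum.inl ⟨i, h⟩)).1) t else 0)
    + ∑ j ∈ Finset.univ.erase i,
      {n | epoch (a (Sum.inr j)) (v (Sum.inr j)).1 n ≤ t ∧ (v (Sum.inr j)).2 n = i.succ}.ncard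

lemma netPath_eq_netInput (i : Fin d) (t : ℝ) :
    netPath a v i t = netInput (inCount a v i) (epoch (a (Sum.inr i)) (v (Sum.inr i)).1) t := by
  unfold netPath netInput inCount netOf cnt
  simp only [countUpTo_eq_ncard, Set.mem_Iic]
  push_cast
  split_ifs <;> simp

lemma GoodPaths.bddBelow_netPath (hv : GoodPaths v) (a : net.Clock → ℝ) (i : Fin d) (t : ℝ) :
    BddBelow (netPath a v i '' Set.Icc 0 t) := by
  refine ⟨-(countUpTo (epoch (a (Sum.inr i)) (v (Sum.inr i)).1) t : ℤ), ?_⟩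
  rintro _ ⟨s, hs, rfl⟩
  have := (hv.epochs a (Sum.inr i)).countUpTo_mono hs.2
  rw [netPath_eq_netInput, netInput]
  omega

/-- Positive first epochs, and no two clocks with a common epoch. -/
structure GoodConfig (a : net.Clock → ℝ) (v : net.Paths) : Prop where
  pos : ∀ k, 0 < a k
  paths : GoodPaths v
  no_common : ∀ k l, k ≠ l → ∀ n m, epoch (a k) (v k).1 n ≠ epoch (a l) (v l).1 m

lemma GoodConfig.queueInput (h : GoodConfig a v) (i : Fin d) :
    QueueInput (inCount a v i) (epoch (a (Sum.inr i)) (v (Sum.inr i)).1) where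
  mono s t hst := by
    unfold inCount
    refine add_le_add ?_ (Finset.sum_le_sum fun j _ => ?_)
    · split_ifs
      · exact (h.paths.epochs a _).countUpTo_mono hst
      · exact le_rfl
    · exact Set.ncard_le_ncard (fun n hn => ⟨hn.1.trans hst, hn.2⟩)
        (((h.paths.epochs a _).finite t).subset fun n hn => hn.1)
  epochs := h.paths.epochs a _
  pos := by rw [epoch_zero]; exact h.pos _
  no_common n := by
    set r := epoch (a (Sum.inr i)) (v (Sum.inr i)).1 n with hr
    filter_upwards [nhdsWithin_le_nhds (h.paths.eventually_lt_iff a r)] with s hs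
    have key : ∀ k, k ≠ Sum.inr i → ∀ m, epoch (a k) (v k).1 m ≤ s ↔ epoch (a k) (v k).1 m ≤ r := by
      intro k hk m
      rcases lt_or_gt_of_ne (h.no_common k _ hk m n) with h1 | h1
      · exact ⟨fun _ => h1.le, fun _ => ((hs k m).1 h1).le⟩
      · exact ⟨fun h2 => absurd h2 (not_le.2 ((hs k m).2 h1)), fun h2 => absurd h2 (not_le.2 h1)⟩
    unfold inCount countUpTo
    congr 1
    · split_ifs
      · simp_rw [key _ (Sum.inl_ne_inr)]
      · rfl
    · refine Finset.sum_congr rfl fun j hj => ?_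
      have hj' : (Sum.inr j : net.Clock) ≠ Sum.inr i := fun h' =>
        (Finset.ne_of_mem_erase hj) (Sum.inr_injective h')
      simp_rw [key _ hj']

/-! ### States and their evolution -/

/-- The remaining times of a state, on all clocks. -/
def clocks (z : net.QState) : net.Clock → ℝ := Sum.elim z.2.1 z.2.2

/-- The state with given queue lengths and remaining times. -/
def mkState (y : Fin d → ℕ) (a : net.Clock → ℝ) : net.QState :=
  (y, fun e => a (Sum.inl e), fun i => a (Sum.inr i))

@[simp] lemma clocks_mkState (y : Fin d → ℕ) (a : net.Clock → ℝ) : clocks (mkState y a) = a := by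
  ext (e | i) <;> rfl

/-- The supremum that defines the queue length, over countably many times. -/
def queueLengthRat (y₀ : ℤ) (X : ℝ → ℤ) (t : ℝ) : ℤ :=
  max (y₀ + X t) (max 0 (⨆ q : ℚ, if 0 ≤ (q : ℝ) ∧ (q : ℝ) ≤ t then X t - X q else 0))

lemma queueLengthRat_eq {y₀ : ℤ} {X : ℝ → ℤ} {t : ℝ} (ht : 0 ≤ t)
    (hX : BddBelow (X '' Set.Icc 0 t)) (hr : ∀ s, ∀ᶠ r in 𝓝[>] s, X r = X s) :
    queueLengthRat y₀ X t = queueLength y₀ X t := by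
  refine eq_of_forall_ge_iff fun c => ?_
  have hb : BddAbove (Set.range fun q : ℚ => if 0 ≤ (q : ℝ) ∧ (q : ℝ) ≤ t then X t - X q else 0) := by
    obtain ⟨b, hb⟩ := hX
    refine ⟨max 0 (X t - b), ?_⟩
    rintro _ ⟨q, rfl⟩
    simp only
    split_ifs with h
    · have := hb ⟨q, ⟨h.1, h.2⟩, rfl⟩
      exact le_max_of_le_right (by omega)
    · exact le_max_left _ _
  rw [queueLength_le_iff hX ht, queueLengthRat, max_le_iff, max_le_iff, ciSup_le_iff hb]
  refine and_congr_right fun _ => ⟨?_, ?_⟩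
  · rintro ⟨h1, h2⟩ s hs
    rcases hs.2.eq_or_lt with rfl | hst
    · simpa using h1
    · have hev : ∀ᶠ r in 𝓝[>] s, X r = X s ∧ r < t :=
        (hr s).and (nhdsWithin_le_nhds (gt_mem_nhds hst))
      obtain ⟨u, hu, hsub⟩ := (mem_nhdsGT_iff_exists_Ioo_subset).1 hev
      obtain ⟨q, hq1, hq2⟩ := exists_rat_btwn (show s < u from hu)
      have h3 := hsub ⟨hq1, hq2⟩
      have h4 := h2 q
      rw [if_pos ⟨hs.1.trans hq1.le, h3.2.le⟩, h3.1] at h4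
      exact h4
  · intro h
    refine ⟨by simpa using h t ⟨ht, le_rfl⟩, fun q => ?_⟩
    split_ifs with hq
    · exact h q hq
    · simpa using h t ⟨ht, le_rfl⟩

/-- The queue lengths at time `t`, from the state with queue lengths `y` and remaining times `a`. -/
def queuesAt (t : ℝ) (y : Fin d → ℕ) (a : net.Clock → ℝ) (v : net.Paths) (i : Fin d) : ℤ :=
  queueLengthRat (y i) (netPath a v i) t

lemma queuesAt_eq (hv : GoodPaths v) {t : ℝ} (ht : 0 ≤ t) (y : Fin d → ℕ) (i : Fin d) :
    queuesAt t y a v i = queueLength (y i) (netPath a v i) t :=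
  queueLengthRat_eq ht (hv.bddBelow_netPath a i t) (hv.netPath_right a i)

lemma queuesAt_nonneg {t : ℝ} (y : Fin d → ℕ) (a : net.Clock → ℝ) (v : net.Paths) (i : Fin d) :
    0 ≤ queuesAt t y a v i := le_max_of_le_right (le_max_left _ _)

/-- The residual times at time `t`. -/
def residualsAt (t : ℝ) (a : net.Clock → ℝ) (v : net.Paths) (k : net.Clock) : ℝ :=
  residual (epoch (a k) (v k).1) t

/-- The state at time `t`. -/
def evolve (t : ℝ) (z : net.QState) (v : net.Paths) : net.QState :=
  mkState (fun i => (queuesAt t z.1 (clocks z) v i).toNat) (residualsAt t (clocks z) v)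

/-- The network driven by `v'` after time `t`. -/
def splicePaths (t : ℝ) (a : net.Clock → ℝ) (p : net.Paths × net.Paths) : net.Paths :=
  fun k => spliceClock (a k) t (p.1 k, p.2 k)

lemma goodPaths_splicePaths {t : ℝ} {v' : net.Paths} (hv : GoodPaths v) (hv' : GoodPaths v') :
    GoodPaths (splicePaths t a (v, v')) := fun k => goodIntervals_spliceAt (hv k) (hv' k) _

lemma netPath_splicePaths_add {t s : ℝ} {v' : net.Paths} (hv : GoodPaths v) (hv' : GoodPaths v')
    (hs : 0 ≤ s) (i : Fin d) :
    netPath a (splicePaths t a (v, v')) i (t + s)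
      = netPath a v i t + netPath (residualsAt t a v) v' i s := by
  unfold netPath
  rw [← netOf_add]
  congr 1
  ext k p
  have hg := hv.epochs a k
  have h := ncard_spliceAt (a := a k) (t := t) (hv k) (hv' k)
    (n := countUpTo (epoch (a k) (v k).1) t)
    (fun j hj => hg.lt_countUpTo_iff.1 hj) hs p (v k).2 (v' k).2
  simp_rw [hg.lt_countUpTo_iff] at h
  unfold cnt
  exact_mod_cast h

lemma netPath_splicePaths_of_le {t s : ℝ} {v' : net.Paths} (hv : GoodPaths v) (hv' : GoodPaths v')
    (hs : s ≤ t) (i : Fin d) :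
    netPath a (splicePaths t a (v, v')) i s = netPath a v i s := by
  unfold netPath
  congr 1
  ext k p
  unfold cnt
  have hg := hv.epochs a k
  have hg' := (goodPaths_splicePaths (t := t) (a := a) hv hv').epochs a k
  set n := countUpTo (epoch (a k) (v k).1) t with hn
  congr 2
  ext j
  simp only [Set.mem_ofPred_eq, Set.mem_Iic]
  have hlt := hg.lt_epoch_countUpTo t
  by_cases hj : j < n
  · have e1 : epoch (a k) (splicePaths t a (v, v') k).1 j = epoch (a k) (v k).1 j :=
      epoch_spliceAt_of_le _ _ _ hj.le
    have e2 : (splicePaths t a (v, v') k).2 j = (v k).2 j := spliceAt_of_lt hj _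
    rw [e1, e2]
  · have h1 := hg.strictMono.monotone (not_lt.1 hj)
    have h2 := hg'.strictMono.monotone (not_lt.1 hj)
    have e1 : epoch (a k) (splicePaths t a (v, v') k).1 n = epoch (a k) (v k).1 n :=
      epoch_spliceAt_of_le _ _ _ le_rfl
    rw [e1] at h2
    rw [← hn] at hlt
    constructor
    · rintro ⟨h3, _⟩; linarith
    · rintro ⟨h3, _⟩; linarith

/-- Markov property, path by path: the state at time `t + s` is obtained from the state at time `t`
and the intervals and marks that are used after time `t`. -/
lemma queuesAt_splicePaths {t s : ℝ} {v' : net.Paths} (hv : GoodPaths v) (hv' : GoodPaths v')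
    (ht : 0 ≤ t) (hs : 0 ≤ s) (z : net.QState) :
    queuesAt (t + s) z.1 (clocks z) (splicePaths t (clocks z) (v, v'))
      = queuesAt s (evolve t z v).1 (clocks (evolve t z v)) v' := by
  have hsp := goodPaths_splicePaths (t := t) (a := clocks z) hv hv'
  ext i
  rw [queuesAt_eq hsp (by linarith), queuesAt_eq hv' hs, evolve, clocks_mkState,
    queueLength_add (X' := netPath (residualsAt t (clocks z) v) v' i)
      (hsp.bddBelow_netPath _ i _) ht hs]
  · congr 1
    rw [queueLength_congr (fun r hr => netPath_splicePaths_of_le hv hv' hr.2 i) ht,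
      ← queuesAt_eq hv ht]
    exact (Int.toNat_of_nonneg (queuesAt_nonneg _ _ _ _)).symm
  · intro r hr
    rw [netPath_splicePaths_add hv hv' hr.1, netPath_splicePaths_of_le hv hv' le_rfl]

lemma evolve_splicePaths {t s : ℝ} {v' : net.Paths} (hv : GoodPaths v) (hv' : GoodPaths v')
    (ht : 0 ≤ t) (hs : 0 ≤ s) (z : net.QState) :
    evolve (t + s) z (splicePaths t (clocks z) (v, v')) = evolve s (evolve t z v) v' := by
  rw [evolve, queuesAt_splicePaths hv hv' ht hs]
  conv_rhs => rw [evolve]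
  congr 1
  ext k
  have hg := hv.epochs (clocks z) k
  rw [evolve, clocks_mkState]
  exact residual_spliceAt (hv k) (hv' k) (fun j hj => hg.lt_countUpTo_iff.1 hj) hs

end AutonomousNetwork

/-! ### Laws of the clocks -/

section Assembling

/-- Independent families indexed by two types, the second one with an additional independent
family, form one independent family over the disjoint union of the two types. -/
lemma measurePreserving_assemble {ι κ α β : Type*} [Fintype ι] [Fintype κ] [MeasurableSpace α]
    [MeasurableSpace β] {p : ι ⊕ κ → Measure α} {q : κ → Measure β} {b : β}
    [∀ k, IsProbabilityMeasure (p k)] [∀ j, IsProbabilityMeasure (q j)] :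
    MeasurePreserving (fun (w : (ι → α) × (κ → α) × (κ → β)) (k : ι ⊕ κ) =>
        Sum.elim (fun i => (w.1 i, b)) (fun j => (w.2.1 j, w.2.2 j)) k)
      ((Measure.pi fun i => p (Sum.inl i)).prod
        ((Measure.pi fun j => p (Sum.inr j)).prod (Measure.pi q)))
      (Measure.pi fun k => (p k).prod (Sum.elim (fun _ => Measure.dirac b) q k)) := by
  have hq : ∀ k : ι ⊕ κ, IsProbabilityMeasure
      ((Sum.elim (fun _ => Measure.dirac b) q : ι ⊕ κ → Measure β) k) := by
    rintro (i | j)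
    · exact Measure.dirac.isProbabilityMeasure
    · simp only [Sum.elim_inr]; infer_instance
  have h1 : MeasurePreserving (fun (w : ι → α) i => (w i, b)) (Measure.pi fun i => p (Sum.inl i))
      (Measure.pi fun i => (p (Sum.inl i)).prod (Measure.dirac b)) :=
    measurePreserving_pi _ _ fun i => ⟨by fun_prop, (Measure.prod_dirac b).symm⟩
  have h2 := (measurePreserving_arrowProdEquivProdArrow α β κ (fun j => p (Sum.inr j)) q).symm
  have h3 := measurePreserving_sumPiEquivProdPi_symm (X := fun _ : ι ⊕ κ => α × β)
    (fun k => (p k).prod ((Sum.elim (fun _ => Measure.dirac b) q : ι ⊕ κ → Measure β) k))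
  have h4 := h3.comp (h1.prod h2)
  convert h4 using 1
  ext w k : 2
  rcases k with i | j <;> rfl

end Assembling

namespace AutonomousNetwork

variable {d : ℕ} (net : AutonomousNetwork d)

/-- The laws of the intervals of the clocks. -/
def intervalLaw : net.Clock → Measure ℝ :=
  Sum.elim (fun e => (net.arrLaw e : Measure ℝ)) fun i => (net.actLaw i : Measure ℝ)

/-- The rates of the clocks. -/
def clockRate : net.Clock → ℝ := Sum.elim (fun e => net.lam e) net.mu

/-- The laws of the marks of the clocks. -/
def markLaw : net.Clock → Measure (Fin (d + 1)) :=
  Sum.elim (fun _ => Measure.dirac 0) fun i => (net.route i).toMeasure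

instance (k : net.Clock) : IsProbabilityMeasure (net.intervalLaw k) := by
  rcases k with e | i <;> simp only [intervalLaw, Sum.elim_inl, Sum.elim_inr] <;> infer_instance

instance (k : net.Clock) : IsProbabilityMeasure (net.markLaw k) := by
  rcases k with e | i <;> simp only [markLaw, Sum.elim_inl, Sum.elim_inr] <;> infer_instance

/-- The law of the intervals and marks of all clocks. -/
def pathLaw : Measure net.Paths := Measure.pi fun k => clockLaw (net.intervalLaw k) (net.markLaw k)

/-- The law of the first epochs of stationary clocks. -/
def equilibriumClocks : Measure (net.Clock → ℝ) :=
  Measure.pi fun k => equilibriumLaw (net.intervalLaw k) (net.clockRate k)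

instance : IsProbabilityMeasure net.pathLaw := by unfold pathLaw; infer_instance

variable {net}

lemma Assumptions.isRenewalLaw (h : net.Assumptions) (k : net.Clock) :
    IsRenewalLaw (net.intervalLaw k) (net.clockRate k) := by
  rcases k with e | i
  · exact h.arr_law e
  · exact h.act_law i

lemma Assumptions.clockRate_pos (h : net.Assumptions) (k : net.Clock) : 0 < net.clockRate k := by
  rcases k with e | i
  · exact e.2
  · exact h.mu_pos i

lemma Assumptions.isProbabilityMeasure_equilibriumLaw (h : net.Assumptions) (k : net.Clock) :
    IsProbabilityMeasure (equilibriumLaw (net.intervalLaw k) (net.clockRate k)) :=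
  _root_.isProbabilityMeasure_equilibriumLaw (h.isRenewalLaw k) (h.clockRate_pos k)

lemma Assumptions.isProbabilityMeasure_equilibriumClocks (h : net.Assumptions) :
    IsProbabilityMeasure net.equilibriumClocks := by
  have := h.isProbabilityMeasure_equilibriumLaw
  unfold equilibriumClocks
  infer_instance

/-- The intervals and marks of all clocks. -/
def toPaths (w : net.Drive) : net.Paths := fun k =>
  Sum.elim (fun e => (w.1 e, fun _ => 0)) (fun i => (w.2.1 i, w.2.2 i)) k

lemma clockLaw_eq (k : net.Clock) : clockLaw (net.intervalLaw k) (net.markLaw k)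
    = (seqLaw (net.intervalLaw k)).prod ((Sum.elim (fun _ => Measure.dirac fun _ => 0)
      fun i => seqLaw (net.route i).toMeasure : net.Clock → Measure (ℕ → Fin (d + 1))) k) := by
  rcases k with e | i
  · simp only [markLaw, Sum.elim_inl]
    rw [clockLaw, seqLaw, seqLaw, Measure.infinitePi_dirac (fun _ : ℕ => (0 : Fin (d + 1)))]
  · rfl

lemma measurePreserving_toPaths :
    MeasurePreserving (toPaths (net := net)) net.driveLaw net.pathLaw := by
  have h := measurePreserving_assemble (p := fun k => seqLaw (net.intervalLaw k))
    (q := fun i => seqLaw (net.route i).toMeasure) (b := fun _ => (0 : Fin (d + 1)))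
  unfold pathLaw
  simp_rw [clockLaw_eq]
  exact h

lemma extCount_add_routeCount (z : net.QState) (w : net.Drive) (i : Fin d) (t : ℝ) :
    net.extCount z w i t + ∑ j ∈ Finset.univ.erase i, net.routeCount z w j i t
      = inCount (clocks z) (toPaths w) i t := rfl

/-- The queueing equation determines the queue lengths. -/
lemma isSolution_iff {z : net.QState} {w : net.Drive} (h : GoodConfig (clocks z) (toPaths w))
    {y : ℝ → Fin d → ℕ} : net.IsSolution z w y ↔
      ∀ t, 0 ≤ t → ∀ i, (y t i : ℤ) = queuesAt t z.1 (clocks z) (toPaths w) i := by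
  have key := fun i => (h.queueInput i).solution_iff (y₀ := z.1 i) (y := fun t => y t i)
  have e : ∀ i, netInput (inCount (clocks z) (toPaths w) i)
      (epoch (clocks z (Sum.inr i)) (toPaths w (Sum.inr i)).1) = netPath (clocks z) (toPaths w) i :=
    fun i => funext fun t => (netPath_eq_netInput i t).symm
  constructor
  · intro hs t ht i
    rw [queuesAt_eq h.paths ht, ← e]
    refine (key i).1 (fun t ht => ?_) t ht
    have := hs t ht i
    rw [add_assoc, extCount_add_routeCount] at this
    exact this
  · intro hq t ht i
    rw [add_assoc, extCount_add_routeCount]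
    refine (key i).2 (fun t ht => ?_) t ht
    rw [e, ← queuesAt_eq h.paths ht]
    exact hq t ht i

lemma stateAt_eq_evolve {Y : net.QState × net.Drive → ℝ → Fin d → ℕ} {t : ℝ} (ht : 0 ≤ t)
    {p : net.QState × net.Drive} (h : GoodConfig (clocks p.1) (toPaths p.2))
    (hs : net.IsSolution p.1 p.2 (Y p)) : net.stateAt Y t p = evolve t p.1 (toPaths p.2) := by
  have h1 := (isSolution_iff h).1 hs t ht
  have : Y p t = fun i => (queuesAt t p.1.1 (clocks p.1) (toPaths p.2) i).toNat := by
    ext i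
    rw [← h1 i, Int.toNat_natCast]
  unfold stateAt evolve mkState
  rw [this]
  rfl

/-! ### Almost sure properties of the clocks -/

section AlmostSure

lemma ae_pathLaw {k : net.Clock} {p : ClockPath (Fin (d + 1)) → Prop}
    (hp : ∀ᵐ w ∂(clockLaw (net.intervalLaw k) (net.markLaw k)), p w) :
    ∀ᵐ v ∂net.pathLaw, p (v k) :=
  (measurePreserving_eval (fun k => clockLaw (net.intervalLaw k) (net.markLaw k))
    k).quasiMeasurePreserving.ae hp

lemma measurable_clockEpoch {X : Type*} [MeasurableSpace X] {a : X → net.Clock → ℝ}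
    {v : X → net.Paths} (ha : Measurable a) (hv : Measurable v) (k : net.Clock) (n : ℕ) :
    Measurable fun x => epoch (a x k) (v x k).1 n :=
  measurable_epoch (by fun_prop) (by fun_prop) n

variable (h : net.Assumptions)
include h

lemma Assumptions.ae_goodPaths : ∀ᵐ v ∂net.pathLaw, GoodPaths v := by
  refine ae_all_iff.2 fun k => ?_
  exact ae_pathLaw
    ((h.isRenewalLaw k).ae_goodIntervals_clockLaw (h.clockRate_pos k))

lemma Assumptions.ae_pos : ∀ᵐ a ∂net.equilibriumClocks, ∀ k, 0 < a k := by
  have := h.isProbabilityMeasure_equilibriumLaw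
  refine ae_all_iff.2 fun k => ?_
  exact (measurePreserving_eval _ k).quasiMeasurePreserving.ae equilibriumLaw_ae_pos

lemma Assumptions.ae_noEpochAt (v : net.Paths) (t : ℝ) :
    ∀ᵐ a ∂net.equilibriumClocks, NoEpochAt a v t := by
  have := h.isProbabilityMeasure_equilibriumLaw
  refine ae_all_iff.2 fun k => ae_all_iff.2 fun n => ?_
  have h1 : ∀ᵐ x ∂(equilibriumLaw (net.intervalLaw k) (net.clockRate k)),
      x ≠ t - ∑ j ∈ Finset.range n, (v k).1 j := by
    rw [ae_iff]; simp
  filter_upwards [(measurePreserving_eval _ k).quasiMeasurePreserving.ae h1] with a ha hc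
  exact ha (by simp only [Function.eval, ← hc, epoch]; ring)

lemma Assumptions.ae_no_common (v : net.Paths) :
    ∀ᵐ a ∂net.equilibriumClocks, ∀ k l, k ≠ l → ∀ n m,
      epoch (a k) (v k).1 n ≠ epoch (a l) (v l).1 m := by
  have := h.isProbabilityMeasure_equilibriumLaw
  simp only [ae_all_iff]
  intro k l hkl n m
  have hi := (iIndepFun_pi (μ := fun k => equilibriumLaw (net.intervalLaw k) (net.clockRate k))
    (X := fun _ => id) fun _ => aemeasurable_id).indepFun hkl
  simp only [id] at hi
  rw [indepFun_iff_map_prod_eq_prod_map_map ((measurable_pi_apply k).aemeasurable)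
    ((measurable_pi_apply l).aemeasurable)] at hi
  set c := ∑ j ∈ Finset.range m, (v l).1 j - ∑ j ∈ Finset.range n, (v k).1 j with hc
  have h1 : ∀ᵐ p ∂((equilibriumLaw (net.intervalLaw k) (net.clockRate k)).prod
      (equilibriumLaw (net.intervalLaw l) (net.clockRate l))), p.1 ≠ p.2 + c := by
    have hms : MeasurableSet {p : ℝ × ℝ | p.1 ≠ p.2 + c} :=
      (measurableSet_eq_fun (by fun_prop) (by fun_prop)).compl
    rw [Measure.ae_prod_iff_ae_ae hms]
    refine Eventually.of_forall fun x => ?_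
    rw [ae_iff]
    have : {y : ℝ | ¬ x ≠ y + c} = {x - c} := by
      ext y
      simp only [ne_eq, not_not, Set.mem_ofPred_eq, Set.mem_singleton_iff]
      constructor <;> intro h <;> linarith
    rw [this, measure_singleton]
  have h2 : ∀ᵐ a ∂net.equilibriumClocks, a k ≠ a l + c := by
    have e1 : net.equilibriumClocks.map (fun a => (a k, a l))
        = (equilibriumLaw (net.intervalLaw k) (net.clockRate k)).prod
      (equilibriumLaw (net.intervalLaw l) (net.clockRate l)) := by
      refine hi.trans ?_
      congr 1
      · exact (measurePreserving_eval _ k).map_eq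
      · exact (measurePreserving_eval _ l).map_eq
    rw [← e1] at h1
    exact ae_of_ae_map (f := fun a : net.Clock → ℝ => (a k, a l)) (by fun_prop) h1
  filter_upwards [h2] with a ha hcon
  exact ha (by simp only [epoch] at hcon; rw [hc]; linarith)

lemma Assumptions.ae_goodConfig :
    ∀ᵐ p ∂(net.equilibriumClocks.prod net.pathLaw), GoodConfig p.1 p.2 := by
  have := h.isProbabilityMeasure_equilibriumClocks
  have hm : MeasurableSet {p : (net.Clock → ℝ) × net.Paths | ∀ k l, k ≠ l → ∀ n m,
      epoch (p.1 k) (p.2 k).1 n ≠ epoch (p.1 l) (p.2 l).1 m} := by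
    have he := fun k n => measurable_clockEpoch (measurable_fst (α := net.Clock → ℝ)
      (β := net.Paths)) measurable_snd k n
    simp only [Set.ofPred_forall]
    refine MeasurableSet.iInter fun k => MeasurableSet.iInter fun l => MeasurableSet.iInter fun _ =>
      MeasurableSet.iInter fun n => MeasurableSet.iInter fun m => ?_
    exact (measurableSet_eq_fun (he k n) (he l m)).compl
  have h3 : ∀ᵐ p ∂(net.equilibriumClocks.prod net.pathLaw), ∀ k l, k ≠ l → ∀ n m,
      epoch (p.1 k) (p.2 k).1 n ≠ epoch (p.1 l) (p.2 l).1 m := by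
    rw [Measure.ae_prod_iff_ae_ae hm, Measure.ae_ae_comm hm]
    exact Eventually.of_forall fun v => h.ae_no_common v
  filter_upwards [Measure.quasiMeasurePreserving_fst.ae h.ae_pos,
    Measure.quasiMeasurePreserving_snd.ae h.ae_goodPaths, h3] with p h4 h5 h6
  exact ⟨h4, h5, h6⟩

lemma Assumptions.ae_noEpochAt_prod (t : ℝ) :
    ∀ᵐ p ∂(net.equilibriumClocks.prod net.pathLaw), NoEpochAt p.1 p.2 t := by
  have := h.isProbabilityMeasure_equilibriumClocks
  have hm : MeasurableSet {p : (net.Clock → ℝ) × net.Paths | NoEpochAt p.1 p.2 t} := by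
    have he := fun k n => measurable_clockEpoch (measurable_fst (α := net.Clock → ℝ)
      (β := net.Paths)) measurable_snd k n
    simp only [NoEpochAt, Set.ofPred_forall]
    refine MeasurableSet.iInter fun k => MeasurableSet.iInter fun n => ?_
    exact (measurableSet_eq_fun (he k n) measurable_const).compl
  rw [Measure.ae_prod_iff_ae_ae hm, Measure.ae_ae_comm hm]
  exact Eventually.of_forall fun v => h.ae_noEpochAt v t

/-- Stability: almost surely the net input of each station has a negative drift. -/
lemma Assumptions.ae_tendsto_netPath :
    ∀ᵐ v ∂net.pathLaw, ∀ (a : net.Clock → ℝ) i, Tendsto (netPath a v i) atTop atBot := by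
  have hlim : ∀ᵐ v ∂net.pathLaw, ∀ k, Tendsto (fun n : ℕ =>
      (∑ j ∈ Finset.range n, (v k).1 j) / (n : ℝ)) atTop (𝓝 (1 / net.clockRate k)) := by
    refine ae_all_iff.2 fun k => ?_
    have h1 := seqLaw_strongLaw (net.intervalLaw k) measurable_id (h.isRenewalLaw k).integrable
    simp only [id, (h.isRenewalLaw k).mean] at h1
    exact ae_pathLaw (Measure.quasiMeasurePreserving_fst.ae h1)
  have hmark : ∀ᵐ v ∂net.pathLaw, ∀ (j : Fin d) (x : Fin (d + 1)), Tendsto (fun n : ℕ =>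
      (∑ m ∈ Finset.range n, if (v (Sum.inr j)).2 m = x then (1 : ℝ) else 0) / n) atTop
        (𝓝 (net.route j x).toReal) := by
    refine ae_all_iff.2 fun j => ae_all_iff.2 fun x => ?_
    have h1 := seqLaw_strongLaw (net.route j).toMeasure
      (f := fun y => if y = x then (1 : ℝ) else 0) (measurable_of_countable _)
      (Integrable.of_finite)
    have e : ∫ y, (if y = x then (1 : ℝ) else 0) ∂(net.route j).toMeasure
        = (net.route j x).toReal := by
      rw [integral_fintype Integrable.of_finite, Finset.sum_eq_single x]
      · simp [Measure.real]
      · intro b _ hb; simp [hb]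
      · simp
    rw [e] at h1
    exact ae_pathLaw (k := Sum.inr j) (Measure.quasiMeasurePreserving_snd.ae h1)
  filter_upwards [hlim, hmark, h.ae_goodPaths] with v h1 h2 hv a i
  have hin : Tendsto (fun t : ℝ => ((if h : 0 < net.lam i then
      cnt a v (Set.Iic t) (Sum.inl ⟨i, h⟩) (fun _ => True) else 0 : ℤ) : ℝ) / t) atTop
      (𝓝 (net.lam i)) := by
    split_ifs with hi
    · have := tendsto_countUpTo_div (hv (Sum.inl ⟨i, hi⟩)) (a (Sum.inl ⟨i, hi⟩))
        (h.clockRate_pos _) (h1 (Sum.inl ⟨i, hi⟩))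
      refine this.congr fun t => ?_
      rw [countUpTo_eq_ncard]
      rfl
    · have : net.lam i = 0 := le_antisymm (not_lt.1 hi) (h.lam_nonneg i)
      rw [this]
      simp
  have hout : Tendsto (fun t : ℝ => (cnt a v (Set.Iic t) (Sum.inr i) (fun _ => True) : ℝ) / t)
      atTop (𝓝 (net.mu i)) := by
    have := tendsto_countUpTo_div (hv (Sum.inr i)) (a (Sum.inr i))
      (h.clockRate_pos _) (h1 (Sum.inr i))
    refine this.congr fun t => ?_
    rw [countUpTo_eq_ncard]
    rfl
  have hroute : ∀ j : Fin d, Tendsto (fun t : ℝ =>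
      (cnt a v (Set.Iic t) (Sum.inr j) (fun x => x = i.succ) : ℝ) / t) atTop
        (𝓝 ((net.route j i.succ).toReal * net.mu j)) := fun j =>
    tendsto_ncard_mark_div (hv (Sum.inr j)) (a (Sum.inr j)) (h.clockRate_pos _)
      (h1 (Sum.inr j)) (h2 j i.succ)
  have hall := (hin.add (tendsto_finsetSum (Finset.univ.erase i) fun j _ => hroute j)).sub hout
  -- the stability condition: the routing to `i` from `i` itself has probability zero
  have hneg : net.lam i + ∑ j ∈ Finset.univ.erase i, (net.route j i.succ).toReal * net.mu j
      - net.mu i < 0 := by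
    have h3 := h.stable i
    rw [← Finset.sum_erase_add _ _ (Finset.mem_univ i), h.no_self_route] at h3
    simp only [ENNReal.toReal_zero, zero_mul, add_zero] at h3
    linarith
  have h4 := hall.neg_mul_atTop hneg tendsto_id
  rw [← tendsto_intCast_atBot_iff (R := ℝ)]
  refine h4.congr' ?_
  filter_upwards [eventually_gt_atTop 0] with t ht
  simp only [netPath, netOf, id]
  push_cast
  rw [← Finset.sum_div, ← add_div, ← sub_div, div_mul_cancel₀ _ ht.ne']

end AlmostSure

end AutonomousNetwork

/-! ### Measurability of the evolution -/

section Measurability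

/-- Random elements that eventually agree have asymptotically equal laws. -/
lemma tendsto_measureReal_map_sub {Ω E : Type*} [MeasurableSpace Ω] [MeasurableSpace E]
    {μ : Measure Ω} [IsProbabilityMeasure μ] {f g : ℕ → Ω → E} (hf : ∀ n, Measurable (f n))
    (hg : ∀ n, Measurable (g n)) (h : ∀ᵐ ω ∂μ, ∀ᶠ n in atTop, f n ω = g n ω) {C : Set E}
    (hC : MeasurableSet C) :
    Tendsto (fun n => (μ.map (f n)).real C - (μ.map (g n)).real C) atTop (𝓝 0) := by
  have e : ∀ n, (μ.map (f n)).real C - (μ.map (g n)).real C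
      = ∫ ω, ((f n ⁻¹' C).indicator 1 ω - (g n ⁻¹' C).indicator 1 ω : ℝ) ∂μ := by
    intro n
    rw [integral_sub, integral_indicator_one (hf n hC), integral_indicator_one (hg n hC),
      map_measureReal_apply (hf n) hC, map_measureReal_apply (hg n) hC]
    · exact (integrable_const (1 : ℝ)).indicator (hf n hC)
    · exact (integrable_const (1 : ℝ)).indicator (hg n hC)
  simp_rw [e]
  rw [← integral_zero Ω ℝ (μ := μ)]
  refine tendsto_integral_of_dominated_convergence (fun _ => 2) (fun n => ?_)
    (integrable_const _) (fun n => ?_) ?_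
  · exact ((measurable_one.indicator (hf n hC)).sub
      (measurable_one.indicator (hg n hC))).aestronglyMeasurable
  · refine Eventually.of_forall fun ω => ?_
    simp only [Set.indicator, Pi.one_apply]
    split_ifs <;> norm_num
  · filter_upwards [h] with ω hω
    refine tendsto_const_nhds.congr' ?_
    filter_upwards [hω] with n hn
    by_cases hm : g n ω ∈ C <;> simp [Set.indicator, hn, hm]

end Measurability

namespace AutonomousNetwork

variable {d : ℕ} {net : AutonomousNetwork d}

section Measurability

variable {Ω : Type*} [MeasurableSpace Ω] {a : Ω → net.Clock → ℝ} {v : Ω → net.Paths}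

lemma measurable_cnt (ha : Measurable a) (hv : Measurable v) {S : Set ℝ} (hS : MeasurableSet S)
    (k : net.Clock) (p : Fin (d + 1) → Prop) : Measurable fun x => cnt (a x) (v x) S k p := by
  have h : Measurable fun x => {n | epoch (a x k) (v x k).1 n ∈ S ∧ p ((v x k).2 n)}.ncard := by
    refine measurable_ncard_setOf fun n => MeasurableSet.inter ?_ ?_
    · exact measurable_clockEpoch ha hv k n hS
    · have : Measurable fun x => (v x k).2 n := by fun_prop
      exact this (MeasurableSet.of_discrete (s := {y | p y}))
  exact (measurable_of_countable (fun n : ℕ => (n : ℤ))).comp h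

lemma measurable_netPath (ha : Measurable a) (hv : Measurable v) (i : Fin d) (t : ℝ) :
    Measurable fun x => netPath (a x) (v x) i t := by
  have h := fun k p => measurable_cnt ha hv (measurableSet_Iic (a := t)) k p
  unfold netPath netOf
  refine Measurable.sub (Measurable.add ?_ (Finset.measurable_sum _ fun j _ => h _ _)) (h _ _)
  split_ifs with hi
  · exact h _ _
  · exact measurable_const

lemma measurable_queuesAt {y : Ω → Fin d → ℕ} (hy : Measurable y) (ha : Measurable a)
    (hv : Measurable v) (t : ℝ) : Measurable fun x => queuesAt t (y x) (a x) (v x) := by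
  refine measurable_pi_lambda _ fun i => ?_
  have h := fun t => measurable_netPath ha hv i t
  have h2 : Measurable fun x => ((y x i : ℕ) : ℤ) :=
    (measurable_of_countable (fun n : ℕ => (n : ℤ))).comp ((measurable_pi_apply i).comp hy)
  unfold queuesAt queueLengthRat
  refine (h2.add (h t)).max (measurable_const.max (Measurable.iSup fun q => ?_))
  split_ifs
  · exact (h t).sub (h q)
  · exact measurable_const

lemma measurable_residualsAt (ha : Measurable a) (hv : Measurable v) (t : ℝ) :
    Measurable fun x => residualsAt t (a x) (v x) :=
  measurable_pi_lambda _ fun k => measurable_residual_epoch (by fun_prop) (by fun_prop)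
    measurable_const

lemma measurable_mkState : Measurable fun p : (Fin d → ℕ) × (net.Clock → ℝ) => mkState p.1 p.2 := by
  unfold mkState; fun_prop

lemma measurable_clocks : Measurable (clocks (net := net)) := by
  refine measurable_pi_lambda _ fun k => ?_
  rcases k with e | i <;> simp only [clocks, Sum.elim_inl, Sum.elim_inr] <;> fun_prop

lemma measurable_toNat_comp {q : Ω → Fin d → ℤ} (hq : Measurable q) :
    Measurable fun x i => (q x i).toNat :=
  measurable_pi_lambda _ fun i =>
    (measurable_of_countable Int.toNat).comp ((measurable_pi_apply i).comp hq)

lemma measurable_evolve {z : Ω → net.QState} (hz : Measurable z) (hv : Measurable v) (t : ℝ) :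
    Measurable fun x => evolve t (z x) (v x) :=
  measurable_mkState.comp ((measurable_toNat_comp (measurable_queuesAt (by fun_prop)
    (measurable_clocks.comp hz) hv t)).prodMk (measurable_residualsAt
      (measurable_clocks.comp hz) hv t))

lemma measurable_splicePaths {v' : Ω → net.Paths} (ha : Measurable a) (hv : Measurable v)
    (hv' : Measurable v') (t : ℝ) : Measurable fun x => splicePaths t (a x) (v x, v' x) :=
  measurable_pi_lambda _ fun k => measurable_spliceClock t (by fun_prop) (by fun_prop)

end Measurability

/-! ### The reversed queue -/

/-- The reversed queue with net input `X` at time `-c`, as a supremum over countably many times. -/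
def reversedRat (X : ℝ → ℤ) (c : ℝ) : ℤ :=
  -X c + ⨆ q : ℚ, if c ≤ (q : ℝ) then X q else X c

lemma bddAbove_image_Ici {X : ℝ → ℤ} {c : ℝ} (hlim : Tendsto X atTop atBot)
    (hb : ∀ t, BddAbove (X '' Set.Icc 0 t)) (hc : 0 ≤ c) : BddAbove (X '' Set.Ici c) := by
  obtain ⟨L, hL⟩ := eventually_atTop.1 (hlim.eventually_le_atBot 0)
  obtain ⟨b, hb⟩ := hb L
  refine ⟨max b 0, ?_⟩
  rintro _ ⟨s, hs, rfl⟩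
  rcases le_total s L with h | h
  · exact le_max_of_le_left (hb ⟨s, ⟨hc.trans hs, h⟩, rfl⟩)
  · exact le_max_of_le_right (hL s h)

lemma reversedRat_le_iff {X : ℝ → ℤ} {c : ℝ} (hb : BddAbove (X '' Set.Ici c))
    (hr : ∀ s, ∀ᶠ r in 𝓝[>] s, X r = X s) {K : ℤ} :
    reversedRat X c ≤ K ↔ ∀ s, c ≤ s → X s - X c ≤ K := by
  have hb' : BddAbove (Set.range fun q : ℚ => if c ≤ (q : ℝ) then X q else X c) := by
    obtain ⟨b, hb⟩ := hb
    refine ⟨b, ?_⟩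
    rintro _ ⟨q, rfl⟩
    simp only
    split_ifs with h
    · exact hb ⟨q, h, rfl⟩
    · exact hb ⟨c, Set.self_mem_Ici, rfl⟩
  have e : reversedRat X c ≤ K ↔ (⨆ q : ℚ, if c ≤ (q : ℝ) then X q else X c) ≤ K + X c := by
    unfold reversedRat; constructor <;> intro h <;> omega
  rw [e, ciSup_le_iff hb']
  constructor
  · intro h s hs
    obtain ⟨u, hu, hsub⟩ := (mem_nhdsGT_iff_exists_Ioo_subset).1 (hr s)
    obtain ⟨q, hq1, hq2⟩ := exists_rat_btwn (show s < u from hu)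
    have h3 : X q = X s := hsub ⟨hq1, hq2⟩
    have h4 := h q
    rw [if_pos (hs.trans hq1.le), h3] at h4
    omega
  · intro h q
    split_ifs with hq
    · have := h q hq; omega
    · have := h c le_rfl; omega

lemma reversedRat_eq {X : ℝ → ℤ} {c : ℝ} (hb : BddAbove (X '' Set.Ici c))
    (hr : ∀ s, ∀ᶠ r in 𝓝[>] s, X r = X s) :
    reversedRat X c = -X c + sSup (X '' Set.Ici c) := by
  refine eq_of_forall_ge_iff fun K => ?_
  rw [reversedRat_le_iff hb hr]
  have e : -X c + sSup (X '' Set.Ici c) ≤ K ↔ sSup (X '' Set.Ici c) ≤ K + X c := by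
    constructor <;> intro h <;> omega
  rw [e, csSup_le_iff hb ⟨_, c, Set.self_mem_Ici, rfl⟩]
  constructor
  · rintro h _ ⟨s, hs, rfl⟩
    have := h s hs
    omega
  · intro h s hs
    have := h _ ⟨s, hs, rfl⟩
    omega

/-- The reversed queue lengths at time `-c`. -/
def reversedQueues (a : net.Clock → ℝ) (v : net.Paths) (c : ℝ) (i : Fin d) : ℤ :=
  reversedRat (netPath a v i) c

lemma measurable_reversedQueues {Ω : Type*} [MeasurableSpace Ω] {a : Ω → net.Clock → ℝ}
    {v : Ω → net.Paths} (ha : Measurable a) (hv : Measurable v) (c : ℝ) :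
    Measurable fun x => reversedQueues (a x) (v x) c := by
  refine measurable_pi_lambda _ fun i => ?_
  have h := fun t => measurable_netPath ha hv i t
  unfold reversedQueues reversedRat
  refine (h c).neg.add (Measurable.iSup fun q => ?_)
  split_ifs
  · exact h q
  · exact h c

lemma GoodConfig.bddAbove_netPath {a : net.Clock → ℝ} {v : net.Paths} (h : GoodConfig a v)
    (i : Fin d) (t : ℝ) : BddAbove (netPath a v i '' Set.Icc 0 t) := by
  refine ⟨inCount a v i t, ?_⟩
  rintro _ ⟨s, hs, rfl⟩
  have := (h.queueInput i).mono hs.2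
  rw [netPath_eq_netInput, netInput]
  omega

/-! ### Stationary clocks of the network and their reversal -/

/-- Stationary clocks, with the intervals that cover time `0`. -/
abbrev StatClocks (net : AutonomousNetwork d) : Type := net.Clock → StatClock (Fin (d + 1))

/-- The first epochs after time `0`. -/
def StatClocks.first (ξ : net.StatClocks) : net.Clock → ℝ := fun k => (ξ k).1.1

/-- The ages at time `0`: the times since the last epochs. -/
def StatClocks.age (ξ : net.StatClocks) : net.Clock → ℝ := fun k => (ξ k).1.2 - (ξ k).1.1

/-- The intervals and marks after the first epochs. -/
def StatClocks.paths (ξ : net.StatClocks) : net.Paths := fun k => (ξ k).2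

/-- Reversal of all clocks about `L`. -/
def StatClocks.reverse (L : ℝ) (ξ : net.StatClocks) : net.StatClocks := fun k => reverseClock L (ξ k)

open StatClocks

variable (net) in
/-- The law of the stationary clocks. -/
def statLaw : Measure net.StatClocks :=
  Measure.pi fun k => statClockLaw (net.intervalLaw k) (net.clockRate k) (net.markLaw k)

/-- Counts of the reversed clocks. -/
lemma cnt_reverse {ξ : net.StatClocks} (hξ : ∀ k, GoodClock (ξ k)) {L s : ℝ} (hs : s ≤ L) :
    cnt (first (reverse L ξ)) (paths (reverse L ξ)) (Set.Iic s)
      = cnt (first ξ) (paths ξ) (Set.Icc (L - s) L) := by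
  ext k p
  exact congrArg (Nat.cast : ℕ → ℤ) (ncard_reverseClock hs (hξ k) p)

lemma netPath_reverse {ξ : net.StatClocks} (hξ : ∀ k, GoodClock (ξ k)) {L s : ℝ} (hs : s ≤ L)
    (h0 : 0 ≤ s) (i : Fin d) :
    netPath (first (reverse L ξ)) (paths (reverse L ξ)) i s
      = netPath (first ξ) (paths ξ) i L - netOf (cnt (first ξ) (paths ξ) (Set.Iio (L - s))) i := by
  rw [netPath, cnt_reverse hξ hs,
    netOf_cnt_Icc (show GoodPaths (paths ξ) from fun k => (hξ k).intervals) (by linarith)]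

lemma goodPaths_reverse {ξ : net.StatClocks} (hξ : ∀ k, GoodClock (ξ k)) (L : ℝ) :
    GoodPaths (paths (reverse L ξ)) := fun k => goodIntervals_reverseClock (hξ k)

/-- Started empty and driven by the reversed clocks, the queue is at time `L - c` the largest
increment of the net input over the intervals `[c, s]` with `s ≤ L`. -/
lemma queuesAt_reverse_le_iff {ξ : net.StatClocks} (hξ : ∀ k, GoodClock (ξ k)) {L c : ℝ}
    (hc : 0 ≤ c) (hcL : c ≤ L) (hne : NoEpochAt (first ξ) (paths ξ) c) (i : Fin d) {K : ℤ} :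
    queuesAt (L - c) (fun _ => 0) (first (reverse L ξ)) (paths (reverse L ξ)) i ≤ K ↔
      ∀ s, c ≤ s → s ≤ L →
        netPath (first ξ) (paths ξ) i s - netPath (first ξ) (paths ξ) i c ≤ K := by
  have hg : GoodPaths (paths ξ) := fun k => (hξ k).intervals
  have hr := goodPaths_reverse hξ L
  rw [queuesAt_eq hr (by linarith),
    queueLength_le_iff (hr.bddBelow_netPath _ i _) (by linarith)]
  set X := netPath (first ξ) (paths ξ) i with hX
  set Xm : ℝ → ℤ := fun r => netOf (cnt (first ξ) (paths ξ) (Set.Iio r)) i with hXm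
  have e : ∀ s, 0 ≤ s → s ≤ L →
      netPath (first (reverse L ξ)) (paths (reverse L ξ)) i s = X L - Xm (L - s) :=
    fun s h0 hs => netPath_reverse hξ hs h0 i
  have ec : Xm c = X c := hne.netOf_Iio i
  rw [e (L - c) (by linarith) (by linarith), sub_sub_cancel, ec]
  constructor
  · rintro ⟨h1, h2⟩ s hcs hsL
    rcases hsL.eq_or_lt with rfl | hsL
    · simpa using h1
    · have hev : ∀ᶠ r in 𝓝[>] s, Xm r = X s ∧ r < L ∧ s < r :=
        (hg.netPath_right' (first ξ) i s).and
          ((eventually_nhdsWithin_of_eventually_nhds (eventually_lt_nhds hsL)).and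
            self_mem_nhdsWithin)
      obtain ⟨r, hr1, hr2, hr3⟩ := hev.exists
      have h3 := h2 (L - r) ⟨by linarith, by linarith⟩
      rw [e (L - r) (by linarith) (by linarith), sub_sub_cancel, hr1] at h3
      omega
  · intro h
    refine ⟨by simpa using h L hcL le_rfl, ?_⟩
    rintro s ⟨hs0, hs1⟩
    rw [e s hs0 (by linarith)]
    have h4 : Xm (L - s) - X c ≤ K := by
      rcases (show c ≤ L - s by linarith).eq_or_lt with h5 | h5
      · rw [← h5, ec]; simpa using h c le_rfl hcL
      · have hev : ∀ᶠ r in 𝓝[<] (L - s), X r = Xm (L - s) ∧ c < r ∧ r < L - s :=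
          (hg.netPath_left (first ξ) i (L - s)).and
            ((eventually_nhdsWithin_of_eventually_nhds (eventually_gt_nhds h5)).and
              self_mem_nhdsWithin)
        obtain ⟨r, hr1, hr2, hr3⟩ := hev.exists
        have h6 := h r hr2.le (by linarith)
        omega
    omega

/-- The properties of stationary clocks that hold almost surely and on which the reversal of the
queue relies. -/
structure Typical (ξ : net.StatClocks) : Prop where
  clock : ∀ k, GoodClock (ξ k)
  config : GoodConfig (first ξ) (paths ξ)
  drift : ∀ i, Tendsto (netPath (first ξ) (paths ξ) i) atTop atBot

/-- Over long horizons the reversed queue started empty is the stationary reversed queue. -/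
lemma Typical.eventually_queuesAt {ξ : net.StatClocks} (hξ : Typical ξ) {c : ℝ}
    (hc : 0 ≤ c) (hne : NoEpochAt (first ξ) (paths ξ) c) :
    ∀ᶠ L in atTop,
      queuesAt (L - c) (fun _ => 0) (first (reverse L ξ)) (paths (reverse L ξ))
        = reversedQueues (first ξ) (paths ξ) c := by
  have h1 : ∀ᶠ s in atTop, ∀ i,
      netPath (first ξ) (paths ξ) i s ≤ netPath (first ξ) (paths ξ) i c :=
    eventually_all.2 fun i => (hξ.drift i).eventually_le_atBot _
  obtain ⟨L₀, hL₀⟩ := eventually_atTop.1 h1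
  filter_upwards [eventually_ge_atTop L₀, eventually_ge_atTop c] with L hL hcL
  ext i
  refine eq_of_forall_ge_iff fun K => ?_
  rw [queuesAt_reverse_le_iff hξ.clock hc hcL hne, reversedQueues, reversedRat_le_iff
    (bddAbove_image_Ici (hξ.drift i) (hξ.config.bddAbove_netPath i) hc)
    (hξ.config.paths.netPath_right _ i)]
  refine ⟨fun h s hs => ?_, fun h s hs _ => h s hs⟩
  rcases le_total s L with h2 | h2
  · exact h s hs h2
  · have h3 := h c le_rfl hcL
    have h4 := hL₀ s (hL.trans h2) i
    omega

lemma residualsAt_reverse {ξ : net.StatClocks} (hξ : ∀ k, GoodClock (ξ k)) (L : ℝ) :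
    residualsAt L (first (reverse L ξ)) (paths (reverse L ξ)) = age ξ := by
  ext k
  exact residual_reverseClock (hξ k)

lemma measurable_first : Measurable (first (net := net)) := by unfold first; fun_prop

lemma measurable_paths : Measurable (StatClocks.paths (net := net)) := by
  unfold StatClocks.paths; fun_prop

lemma measurable_age : Measurable (age (net := net)) := by unfold age; fun_prop

section Laws

variable (h : net.Assumptions)
include h

lemma Assumptions.isProbabilityMeasure_statClockLaw (k : net.Clock) : IsProbabilityMeasure
    (statClockLaw (net.intervalLaw k) (net.clockRate k) (net.markLaw k)) :=
  _root_.isProbabilityMeasure_statClockLaw (h.isRenewalLaw k) (h.clockRate_pos k)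

lemma Assumptions.isProbabilityMeasure_statLaw : IsProbabilityMeasure net.statLaw := by
  have := h.isProbabilityMeasure_statClockLaw
  unfold statLaw; infer_instance

lemma Assumptions.measurePreserving_forget :
    MeasurePreserving (fun ξ : net.StatClocks => (first ξ, paths ξ)) net.statLaw
      (net.equilibriumClocks.prod net.pathLaw) := by
  have := h.isProbabilityMeasure_statClockLaw
  have := h.isProbabilityMeasure_equilibriumLaw
  exact (measurePreserving_arrowProdEquivProdArrow ℝ (ClockPath (Fin (d + 1))) net.Clock
    (fun k => equilibriumLaw (net.intervalLaw k) (net.clockRate k))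
    (fun k => clockLaw (net.intervalLaw k) (net.markLaw k))).comp
    (measurePreserving_pi _ _ fun k => measurePreserving_forget_statClock (net.intervalLaw k)
      (net.markLaw k) (net.clockRate k))

lemma Assumptions.measurePreserving_reverse {L : ℝ} (hL : 0 ≤ L) :
    MeasurePreserving (reverse (net := net) L) net.statLaw net.statLaw := by
  have := h.isProbabilityMeasure_statClockLaw
  exact measurePreserving_pi _ _ fun k =>
    measurePreserving_reverseClock (h.isRenewalLaw k) (h.clockRate_pos k) hL

lemma Assumptions.ae_goodClock : ∀ᵐ ξ ∂net.statLaw, ∀ k, GoodClock (ξ k) := by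
  have := h.isProbabilityMeasure_statClockLaw
  refine ae_all_iff.2 fun k => ?_
  exact (measurePreserving_eval (fun k => statClockLaw (net.intervalLaw k) (net.clockRate k)
    (net.markLaw k)) k).quasiMeasurePreserving.ae
      (statClockLaw_ae_good (h.isRenewalLaw k) (h.clockRate_pos k))

lemma Assumptions.ae_typical : ∀ᵐ ξ ∂net.statLaw, Typical ξ := by
  have hq := h.measurePreserving_forget.quasiMeasurePreserving
  have := h.isProbabilityMeasure_equilibriumClocks
  filter_upwards [h.ae_goodClock, hq.ae h.ae_goodConfig,
    hq.ae (Measure.quasiMeasurePreserving_snd.ae h.ae_tendsto_netPath)] with ξ h1 h2 h3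
  exact ⟨h1, h2, fun i => h3 _ i⟩

lemma Assumptions.ae_noEpochAt_stat (t : ℝ) :
    ∀ᵐ ξ ∂net.statLaw, NoEpochAt (first ξ) (paths ξ) t :=
  h.measurePreserving_forget.quasiMeasurePreserving.ae (h.ae_noEpochAt_prod t)

/-- The ages of stationary clocks are distributed like the times to the next epochs. -/
lemma Assumptions.map_age : net.statLaw.map age = net.equilibriumClocks := by
  have := h.isProbabilityMeasure_equilibriumClocks
  have h1 : MeasurePreserving (fun ξ : net.StatClocks => first (reverse 0 ξ)) net.statLaw
      net.equilibriumClocks :=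
    (measurePreserving_fst.comp h.measurePreserving_forget).comp
      (h.measurePreserving_reverse le_rfl)
  rw [← h1.map_eq]
  refine Measure.map_congr ?_
  filter_upwards [h.ae_goodClock, (h.measurePreserving_reverse le_rfl).quasiMeasurePreserving.ae
    h.ae_typical] with ξ h2 h3
  rw [← residualsAt_reverse h2 0]
  ext k
  have h4 : countUpTo (epoch (first (reverse 0 ξ) k) (paths (reverse 0 ξ) k).1) 0 = 0 :=
    (h3.config.paths.epochs _ k).countUpTo_eq (fun j hj => absurd hj (Nat.not_lt_zero j))
      (by rw [epoch_zero]; exact h3.config.pos k)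
  rw [residualsAt, AutonomousNetwork.residual, h4, epoch_zero, sub_zero]

end Laws

end AutonomousNetwork

/-! ### The Markov property and convergence to equilibrium -/

section Coupling

/-- Two laws agree if they are linked by two asymptotic couplings. -/
lemma eq_of_eventually_eq {Ω₁ Ω₂ E : Type*} [MeasurableSpace Ω₁] [MeasurableSpace Ω₂]
    [MeasurableSpace E] {μ₁ : Measure Ω₁} {μ₂ : Measure Ω₂} [IsProbabilityMeasure μ₁]
    [IsProbabilityMeasure μ₂] {ρ₁ ρ₂ : Measure E} {f₁ g₁ : ℕ → Ω₁ → E} {f₂ g₂ : ℕ → Ω₂ → E}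
    (hf₁ : ∀ n, Measurable (f₁ n)) (hg₁ : ∀ n, Measurable (g₁ n))
    (hf₂ : ∀ n, Measurable (f₂ n)) (hg₂ : ∀ n, Measurable (g₂ n))
    (h₁ : ∀ᵐ ω ∂μ₁, ∀ᶠ n in atTop, f₁ n ω = g₁ n ω)
    (h₂ : ∀ᵐ ω ∂μ₂, ∀ᶠ n in atTop, f₂ n ω = g₂ n ω)
    (hρ₁ : ∀ n, μ₁.map (f₁ n) = ρ₁) (hlink : ∀ n, μ₁.map (g₁ n) = μ₂.map (f₂ n))
    (hρ₂ : ∀ n, μ₂.map (g₂ n) = ρ₂) : ρ₁ = ρ₂ := by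
  have : IsProbabilityMeasure ρ₁ := hρ₁ 0 ▸ Measure.isProbabilityMeasure_map (hf₁ 0).aemeasurable
  have : IsProbabilityMeasure ρ₂ := hρ₂ 0 ▸ Measure.isProbabilityMeasure_map (hg₂ 0).aemeasurable
  ext C hC
  have h3 := (tendsto_measureReal_map_sub hf₁ hg₁ h₁ hC).add
    (tendsto_measureReal_map_sub hf₂ hg₂ h₂ hC)
  simp only [hρ₁, hlink, hρ₂, sub_add_sub_cancel, add_zero, tendsto_const_nhds_iff] at h3
  rw [← ENNReal.toReal_eq_toReal_iff' (measure_ne_top _ _) (measure_ne_top _ _)]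
  exact sub_eq_zero.1 h3

end Coupling

namespace AutonomousNetwork

variable {d : ℕ} {net : AutonomousNetwork d}

open StatClocks

variable (net) in
/-- The law of the state at time `t` from an initial state with law `π`. -/
def evolveLaw (π : Measure net.QState) (t : ℝ) : Measure net.QState :=
  (π.prod net.pathLaw).map fun p => evolve t p.1 p.2

lemma measurable_evolve_prod (t : ℝ) :
    Measurable fun p : net.QState × net.Paths => evolve t p.1 p.2 :=
  measurable_evolve measurable_fst measurable_snd t

instance (π : Measure net.QState) [IsProbabilityMeasure π] (t : ℝ) :
    IsProbabilityMeasure (net.evolveLaw π t) :=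
  Measure.isProbabilityMeasure_map (measurable_evolve_prod t).aemeasurable

section Markov

variable (h : net.Assumptions)
include h

lemma Assumptions.measurePreserving_splicePaths (t : ℝ) (a : net.Clock → ℝ) :
    MeasurePreserving (splicePaths t a) (net.pathLaw.prod net.pathLaw) net.pathLaw :=
  measurePreserving_spliceClock_pi (q := net.markLaw) h.isRenewalLaw h.clockRate_pos a t

lemma Assumptions.measurePreserving_splice (π : Measure net.QState) [IsProbabilityMeasure π]
    (t : ℝ) :
    MeasurePreserving (fun q : (net.QState × net.Paths) × net.Paths =>
        (q.1.1, splicePaths t (clocks q.1.1) (q.1.2, q.2)))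
      ((π.prod net.pathLaw).prod net.pathLaw) (π.prod net.pathLaw) := by
  have hg : Measurable (Function.uncurry fun (z : net.QState) (p : net.Paths × net.Paths) =>
      splicePaths t (clocks z) p) :=
    measurable_splicePaths (measurable_clocks.comp measurable_fst)
      (measurable_fst.comp measurable_snd) (measurable_snd.comp measurable_snd) t
  have h1 := MeasurePreserving.skew_product (MeasurePreserving.id π) hg
    (Eventually.of_forall fun z => (h.measurePreserving_splicePaths t (clocks z)).map_eq)
  exact h1.comp (measurePreserving_prodAssoc _ _ _)

/-- The Markov property: `Φ` depends on the evolution as `Ψ` does on the evolution after time `t`. -/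
lemma Assumptions.map_markov (π : Measure net.QState) [IsProbabilityMeasure π] {t : ℝ}
    {E : Type*} [MeasurableSpace E] {Φ Ψ : net.QState × net.Paths → E} (hΦ : Measurable Φ)
    (hΨ : Measurable Ψ)
    (hΦΨ : ∀ z v v', GoodPaths v → GoodPaths v' →
      Φ (z, splicePaths t (clocks z) (v, v')) = Ψ (evolve t z v, v')) :
    (π.prod net.pathLaw).map Φ = ((net.evolveLaw π t).prod net.pathLaw).map Ψ := by
  have h1 := h.measurePreserving_splice π t
  have h2 : MeasurePreserving (fun q : (net.QState × net.Paths) × net.Paths =>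
      (evolve t q.1.1 q.1.2, q.2)) ((π.prod net.pathLaw).prod net.pathLaw)
      ((net.evolveLaw π t).prod net.pathLaw) :=
    MeasurePreserving.prod ⟨measurable_evolve_prod t, rfl⟩ (MeasurePreserving.id net.pathLaw)
  rw [← h1.map_eq, ← h2.map_eq, Measure.map_map hΦ h1.measurable, Measure.map_map hΨ h2.measurable]
  refine Measure.map_congr ?_
  filter_upwards [Measure.quasiMeasurePreserving_fst.ae
    (Measure.quasiMeasurePreserving_snd.ae h.ae_goodPaths),
    Measure.quasiMeasurePreserving_snd.ae h.ae_goodPaths] with q h3 h4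
  exact hΦΨ q.1.1 q.1.2 q.2 h3 h4

lemma Assumptions.evolveLaw_add (π : Measure net.QState) [IsProbabilityMeasure π] {t s : ℝ}
    (ht : 0 ≤ t) (hs : 0 ≤ s) :
    net.evolveLaw π (t + s) = net.evolveLaw (net.evolveLaw π t) s :=
  h.map_markov π (measurable_evolve_prod _) (measurable_evolve_prod _)
    fun z _ _ hv hv' => evolve_splicePaths hv hv' ht hs z

end Markov

/-- The empty network with given remaining times. -/
def emptyState (a : net.Clock → ℝ) : net.QState := mkState (fun _ => 0) a

lemma measurable_emptyState : Measurable (emptyState (net := net)) :=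
  measurable_mkState.comp (measurable_const.prodMk measurable_id)

variable (net) in
/-- The law of the empty network with stationary clocks. -/
def emptyLaw : Measure net.QState := net.equilibriumClocks.map emptyState

/-- Initial state and paths of the empty network that is driven by the reversed clocks. -/
def reversedStart (L : ℝ) (ξ : net.StatClocks) : net.QState × net.Paths :=
  (emptyState (first (reverse L ξ)), paths (reverse L ξ))

/-- The state at time `L` of the empty network that is driven by the reversed clocks. -/
def reversedState (L : ℝ) (ξ : net.StatClocks) : net.QState :=
  evolve L (reversedStart L ξ).1 (reversedStart L ξ).2

/-- The limit of `reversedState`. -/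
def limitState (ξ : net.StatClocks) : net.QState :=
  mkState (fun i => (reversedQueues (first ξ) (paths ξ) 0 i).toNat) (age ξ)

variable (net) in
/-- The stationary distribution of the network. -/
def equilibriumState : Measure net.QState := net.statLaw.map limitState

lemma measurable_limitState : Measurable (limitState (net := net)) :=
  measurable_mkState.comp ((measurable_toNat_comp (measurable_reversedQueues measurable_first
    measurable_paths 0)).prodMk measurable_age)

lemma GoodConfig.noEpochAt_zero {a : net.Clock → ℝ} {v : net.Paths} (hc : GoodConfig a v) :
    NoEpochAt a v 0 := fun k n => by
  have := (hc.paths.epochs a k).strictMono.monotone (Nat.zero_le n)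
  rw [epoch_zero] at this
  exact ((hc.pos k).trans_le this).ne'

lemma Typical.eventually_reversedState {ξ : net.StatClocks} (hξ : Typical ξ) :
    ∀ᶠ L in atTop, reversedState L ξ = limitState ξ := by
  filter_upwards [hξ.eventually_queuesAt le_rfl hξ.config.noEpochAt_zero] with L hL
  rw [sub_zero] at hL
  unfold reversedState reversedStart evolve limitState emptyState
  rw [clocks_mkState, ← hL, ← residualsAt_reverse hξ.clock L]
  rfl

section Convergence

variable (h : net.Assumptions)
include h

lemma Assumptions.isProbabilityMeasure_emptyLaw : IsProbabilityMeasure net.emptyLaw := by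
  have := h.isProbabilityMeasure_equilibriumClocks
  exact Measure.isProbabilityMeasure_map measurable_emptyState.aemeasurable

lemma Assumptions.isProbabilityMeasure_equilibriumState :
    IsProbabilityMeasure net.equilibriumState := by
  have := h.isProbabilityMeasure_statLaw
  exact Measure.isProbabilityMeasure_map measurable_limitState.aemeasurable

lemma Assumptions.measurePreserving_reversedStart {L : ℝ} (hL : 0 ≤ L) :
    MeasurePreserving (reversedStart (net := net) L) net.statLaw
      (net.emptyLaw.prod net.pathLaw) := by
  have := h.isProbabilityMeasure_equilibriumClocks
  have := h.isProbabilityMeasure_emptyLaw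
  have h1 : MeasurePreserving (Prod.map (emptyState (net := net)) (id : net.Paths → net.Paths))
      (net.equilibriumClocks.prod net.pathLaw) (net.emptyLaw.prod net.pathLaw) :=
    MeasurePreserving.prod ⟨measurable_emptyState, rfl⟩ (MeasurePreserving.id net.pathLaw)
  exact (h1.comp h.measurePreserving_forget).comp (h.measurePreserving_reverse hL)

lemma Assumptions.measurePreserving_reversedState {L : ℝ} (hL : 0 ≤ L) :
    MeasurePreserving (reversedState (net := net) L) net.statLaw
      (net.evolveLaw net.emptyLaw L) :=
  MeasurePreserving.comp (μb := net.emptyLaw.prod net.pathLaw)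
    ⟨measurable_evolve_prod L, rfl⟩ (h.measurePreserving_reversedStart hL)

lemma Assumptions.map_clocks_equilibriumState :
    net.equilibriumState.map clocks = net.equilibriumClocks := by
  rw [equilibriumState, Measure.map_map measurable_clocks measurable_limitState, ← h.map_age]
  exact congrArg net.statLaw.map (funext fun ξ => clocks_mkState _ _)

/-- The limit of the reversed states is invariant. -/
lemma Assumptions.evolveLaw_equilibriumState {t : ℝ} (ht : 0 ≤ t) :
    net.evolveLaw net.equilibriumState t = net.equilibriumState := by
  have := h.isProbabilityMeasure_statLaw
  have := h.isProbabilityMeasure_emptyLaw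
  have := h.isProbabilityMeasure_equilibriumState
  have hmR := fun (n : ℕ) => (h.measurePreserving_reversedState (Nat.cast_nonneg n)).measurable
  have hmp : ∀ {Z : net.StatClocks → net.QState} {ρ : Measure net.QState}
      [IsProbabilityMeasure ρ], MeasurePreserving Z net.statLaw ρ →
      (net.statLaw.prod net.pathLaw).map (fun p => evolve t (Z p.1) p.2) = net.evolveLaw ρ t := by
    intro Z ρ _ hZ
    have h1 := hZ.prod (MeasurePreserving.id net.pathLaw)
    rw [evolveLaw, ← h1.map_eq, Measure.map_map (measurable_evolve_prod t) h1.measurable]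
    rfl
  refine eq_of_eventually_eq (μ₁ := net.statLaw.prod net.pathLaw) (μ₂ := net.statLaw)
    (f₁ := fun _ p => evolve t (limitState p.1) p.2)
    (g₁ := fun n p => evolve t (reversedState n p.1) p.2)
    (f₂ := fun n => reversedState (n + t)) (g₂ := fun _ => limitState)
    (fun _ => measurable_evolve (measurable_limitState.comp measurable_fst) measurable_snd t)
    (fun n => measurable_evolve ((hmR n).comp measurable_fst) measurable_snd t)
    (fun n => (h.measurePreserving_reversedState (by positivity)).measurable)
    (fun _ => measurable_limitState) ?_ ?_
    (fun _ => hmp ⟨measurable_limitState, rfl⟩) (fun n => ?_) (fun _ => rfl)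
  · filter_upwards [Measure.quasiMeasurePreserving_fst.ae h.ae_typical] with p hp
    filter_upwards [tendsto_natCast_atTop_atTop.eventually hp.eventually_reversedState] with n hn
    rw [hn]
  · filter_upwards [h.ae_typical] with ξ hξ
    exact (tendsto_atTop_add_const_right _ t tendsto_natCast_atTop_atTop).eventually
      hξ.eventually_reversedState
  · rw [hmp (h.measurePreserving_reversedState (Nat.cast_nonneg n)),
      (h.measurePreserving_reversedState (by positivity)).map_eq,
      h.evolveLaw_add _ (Nat.cast_nonneg n) ht]

end Convergence

/-- The queues forget their initial lengths. -/
lemma eventually_queuesAt_eq_empty {v : net.Paths} (hv : GoodPaths v) {z : net.QState}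
    (hlim : ∀ i, Tendsto (netPath (clocks z) v i) atTop atBot) :
    ∀ᶠ t in atTop, queuesAt t z.1 (clocks z) v = queuesAt t (fun _ => 0) (clocks z) v := by
  have h1 : ∀ᶠ s in atTop, ∀ i, netPath (clocks z) v i s ≤ -(z.1 i : ℤ) :=
    eventually_all.2 fun i => (hlim i).eventually_le_atBot _
  obtain ⟨s, hs, hs0⟩ := (h1.and (eventually_ge_atTop 0)).exists
  filter_upwards [eventually_ge_atTop s] with t ht
  ext i
  rw [queuesAt_eq hv (hs0.trans ht), queuesAt_eq hv (hs0.trans ht)]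
  exact queueLength_eq_zero_start (hv.bddBelow_netPath _ i t) ⟨hs0, ht⟩ (hs i) (Int.natCast_nonneg _)

/-- A law of states with stationary clocks that the evolution leaves invariant. -/
structure Invariant (π : Measure net.QState) : Prop where
  prob : IsProbabilityMeasure π
  clocks_law : π.map clocks = net.equilibriumClocks
  evolve_law : ∀ t, 0 ≤ t → net.evolveLaw π t = π

lemma Assumptions.invariant_equilibriumState (h : net.Assumptions) :
    Invariant net.equilibriumState :=
  ⟨h.isProbabilityMeasure_equilibriumState, h.map_clocks_equilibriumState,
    fun _ ht => h.evolveLaw_equilibriumState ht⟩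

/-- Replacing the queue lengths of an invariant law by zero yields the empty network. -/
lemma Invariant.measurePreserving_empty {π : Measure net.QState} (hπ : Invariant π) :
    MeasurePreserving (fun p : net.QState × net.Paths => (emptyState (clocks p.1), p.2))
      (π.prod net.pathLaw) (net.emptyLaw.prod net.pathLaw) := by
  have := hπ.prob
  have h1 : MeasurePreserving (fun z : net.QState => emptyState (clocks z)) π net.emptyLaw := by
    refine ⟨measurable_emptyState.comp measurable_clocks, ?_⟩
    rw [emptyLaw, ← hπ.clocks_law, Measure.map_map measurable_emptyState measurable_clocks]
    rfl
  exact h1.prod (MeasurePreserving.id net.pathLaw)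

/-- There is at most one invariant law. -/
lemma Invariant.eq_equilibriumState {π : Measure net.QState} (hπ : Invariant π)
    (h : net.Assumptions) : π = net.equilibriumState := by
  have := h.isProbabilityMeasure_statLaw
  have := hπ.prob
  have he := hπ.measurePreserving_empty
  refine eq_of_eventually_eq (μ₁ := π.prod net.pathLaw) (μ₂ := net.statLaw)
    (f₁ := fun n p => evolve n p.1 p.2)
    (g₁ := fun n p => evolve n (emptyState (clocks p.1)) p.2)
    (f₂ := fun n => reversedState n) (g₂ := fun _ => limitState)
    (fun n => measurable_evolve_prod n)
    (fun n => (measurable_evolve_prod (n : ℝ)).comp he.measurable)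
    (fun n => (h.measurePreserving_reversedState (Nat.cast_nonneg n)).measurable)
    (fun _ => measurable_limitState) ?_ ?_
    (fun n => hπ.evolve_law n (Nat.cast_nonneg n)) (fun n => ?_) (fun _ => rfl)
  · filter_upwards [Measure.quasiMeasurePreserving_snd.ae h.ae_goodPaths,
      Measure.quasiMeasurePreserving_snd.ae h.ae_tendsto_netPath] with p h1 h2
    filter_upwards [tendsto_natCast_atTop_atTop.eventually
      (eventually_queuesAt_eq_empty h1 (z := p.1) (h2 _))] with n hn
    unfold evolve emptyState
    rw [clocks_mkState, hn]
    rfl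
  · filter_upwards [h.ae_typical] with ξ hξ
    exact tendsto_natCast_atTop_atTop.eventually hξ.eventually_reversedState
  · rw [(h.measurePreserving_reversedState (Nat.cast_nonneg n)).map_eq, evolveLaw, ← he.map_eq,
      Measure.map_map (measurable_evolve_prod _) he.measurable]
    rfl

/-- The finite-dimensional laws of the queue lengths under an invariant law are those of the
reversed queue. -/
lemma Invariant.map_queuesAt {π : Measure net.QState} (hπ : Invariant π)
    (h : net.Assumptions) {ι : Type*} [Finite ι] {S : ℝ} (hS0 : 0 ≤ S) {s : ι → ℝ} (h0 : ∀ j, 0 ≤ s j)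
    (hS : ∀ j, s j ≤ S) :
    (π.prod net.pathLaw).map (fun p j => queuesAt (s j) p.1.1 (clocks p.1) p.2)
      = (net.equilibriumClocks.prod net.pathLaw).map
        (fun p j => reversedQueues p.1 p.2 (S - s j)) := by
  have := h.isProbabilityMeasure_statLaw
  have := hπ.prob
  have he := hπ.measurePreserving_empty
  set Φ : ℕ → net.QState × net.Paths → ι → Fin d → ℤ :=
    fun n p j => queuesAt (n + s j) p.1.1 (clocks p.1) p.2 with hΦ
  have hq : ∀ n, Measurable (Φ n) := fun n => measurable_pi_lambda _ fun j =>
    measurable_queuesAt (by fun_prop) (measurable_clocks.comp measurable_fst) measurable_snd _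
  have hq0 : Measurable fun (p : net.QState × net.Paths) j =>
      queuesAt (s j) p.1.1 (clocks p.1) p.2 := measurable_pi_lambda _ fun j =>
    measurable_queuesAt (by fun_prop) (measurable_clocks.comp measurable_fst) measurable_snd _
  have hr : Measurable fun (p : (net.Clock → ℝ) × net.Paths) j =>
      reversedQueues p.1 p.2 (S - s j) := measurable_pi_lambda _ fun j =>
    measurable_reversedQueues measurable_fst measurable_snd _
  have hR := fun n : ℕ => h.measurePreserving_reversedStart (L := n + S) (by positivity)
  refine eq_of_eventually_eq (μ₁ := π.prod net.pathLaw) (μ₂ := net.statLaw)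
    (f₁ := Φ) (g₁ := fun n p => Φ n (emptyState (clocks p.1), p.2))
    (f₂ := fun n ξ => Φ n (reversedStart (n + S) ξ))
    (g₂ := fun _ ξ j => reversedQueues (first ξ) (paths ξ) (S - s j))
    hq (fun n => (hq n).comp he.measurable) (fun n => (hq n).comp (hR n).measurable)
    (fun _ => measurable_pi_lambda _ fun j =>
      measurable_reversedQueues measurable_first measurable_paths _) ?_ ?_ (fun n => ?_) (fun n => ?_)
    (fun _ => ?_)
  · filter_upwards [Measure.quasiMeasurePreserving_snd.ae h.ae_goodPaths,
      Measure.quasiMeasurePreserving_snd.ae h.ae_tendsto_netPath] with p h1 h2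
    have h3 := eventually_queuesAt_eq_empty h1 (z := p.1) (h2 _)
    filter_upwards [eventually_all.2 fun j => (tendsto_atTop_add_const_right _ (s j)
      tendsto_natCast_atTop_atTop).eventually h3] with n hn
    ext1 j
    simp only [hΦ, emptyState, clocks_mkState]
    exact hn j
  · filter_upwards [h.ae_typical, ae_all_iff.2 fun j => h.ae_noEpochAt_stat (S - s j)]
      with ξ hξ hne
    filter_upwards [eventually_all.2 fun j => (tendsto_atTop_add_const_right _ S
      tendsto_natCast_atTop_atTop).eventually
        (hξ.eventually_queuesAt (sub_nonneg.2 (hS j)) (hne j))] with n hn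
    ext1 j
    simp only [hΦ, reversedStart, emptyState, clocks_mkState]
    rw [← hn j, show (n : ℝ) + S - (S - s j) = n + s j by ring]
    rfl
  · have h1 := h.map_markov π (t := n) (hq n) hq0 fun z v v' hv hv' => funext fun j =>
      queuesAt_splicePaths hv hv' (Nat.cast_nonneg n) (h0 j) z
    rw [hπ.evolve_law n (Nat.cast_nonneg n)] at h1
    exact h1
  · have h1 := Measure.map_map (hq n) he.measurable (μ := π.prod net.pathLaw)
    have h2 := Measure.map_map (hq n) (hR n).measurable (μ := net.statLaw)
    rw [he.map_eq] at h1
    rw [(hR n).map_eq] at h2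
    exact h1.symm.trans h2
  · have h1 := Measure.map_map hr h.measurePreserving_forget.measurable (μ := net.statLaw)
    rw [h.measurePreserving_forget.map_eq] at h1
    exact h1.symm

/-! ### Stationary distributions -/

lemma measurePreserving_id_toPaths (π : Measure net.QState) [IsProbabilityMeasure π] :
    MeasurePreserving (fun p : net.QState × net.Drive => (p.1, toPaths p.2))
      (π.prod net.driveLaw) (π.prod net.pathLaw) := by
  have : IsProbabilityMeasure net.driveLaw := by unfold driveLaw; infer_instance
  exact (MeasurePreserving.id π).prod measurePreserving_toPaths

lemma Assumptions.ae_goodConfig_drive (h : net.Assumptions) {π : Measure net.QState}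
    [IsProbabilityMeasure π] (hπ : π.map clocks = net.equilibriumClocks) :
    ∀ᵐ p ∂(π.prod net.driveLaw), GoodConfig (clocks p.1) (toPaths p.2) := by
  have := h.isProbabilityMeasure_equilibriumClocks
  have h1 : MeasurePreserving (fun p : net.QState × net.Paths => (clocks p.1, p.2))
      (π.prod net.pathLaw) (net.equilibriumClocks.prod net.pathLaw) :=
    MeasurePreserving.prod ⟨measurable_clocks, hπ⟩ (MeasurePreserving.id net.pathLaw)
  exact (h1.comp (measurePreserving_id_toPaths π)).quasiMeasurePreserving.ae h.ae_goodConfig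

/-- With stationary clocks, the queue process is given by `queuesAt`. -/
lemma IsAutonomousQueue.ae_eq_queuesAt (h : net.Assumptions) {π : Measure net.QState}
    [IsProbabilityMeasure π] (hπ : π.map clocks = net.equilibriumClocks)
    {Y : net.QState × net.Drive → ℝ → Fin d → ℕ} (hY : net.IsAutonomousQueue π Y) :
    ∀ᵐ p ∂(π.prod net.driveLaw), ∀ t, 0 ≤ t → ∀ i,
      (Y p t i : ℤ) = queuesAt t p.1.1 (clocks p.1) (toPaths p.2) i := by
  filter_upwards [hY.solution, h.ae_goodConfig_drive hπ] with p h1 h2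
  exact (isSolution_iff h2).1 h1

lemma IsAutonomousQueue.map_stateAt (h : net.Assumptions) {π : Measure net.QState}
    [IsProbabilityMeasure π] (hπ : π.map clocks = net.equilibriumClocks)
    {Y : net.QState × net.Drive → ℝ → Fin d → ℕ} (hY : net.IsAutonomousQueue π Y) {t : ℝ}
    (ht : 0 ≤ t) : (π.prod net.driveLaw).map (net.stateAt Y t) = net.evolveLaw π t := by
  have h1 := measurePreserving_id_toPaths π
  rw [evolveLaw, ← h1.map_eq, Measure.map_map (measurable_evolve_prod t) h1.measurable]
  refine Measure.map_congr ?_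
  filter_upwards [hY.solution, h.ae_goodConfig_drive hπ] with p h2 h3
  exact stateAt_eq_evolve ht h3 h2

lemma measurable_stateAt {Y : net.QState × net.Drive → ℝ → Fin d → ℕ} {t : ℝ}
    (hY : Measurable fun p => Y p t) : Measurable (net.stateAt Y t) := by
  have h1 : Measurable fun p : net.QState × net.Drive =>
      residualsAt t (clocks p.1) (toPaths p.2) :=
    measurable_residualsAt (measurable_clocks.comp measurable_fst)
      (measurePreserving_toPaths.measurable.comp measurable_snd) t
  exact measurable_mkState.comp (hY.prodMk h1)

/-- In a stationary state the clocks are independent and in equilibrium. -/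
lemma IsStationaryDistribution.map_clocks (h : net.Assumptions) {π : Measure net.QState}
    (hπ : net.IsStationaryDistribution π) : π.map clocks = net.equilibriumClocks := by
  have := hπ.prob
  have : IsProbabilityMeasure net.driveLaw := by unfold driveLaw; infer_instance
  have : IsProbabilityMeasure (π.map clocks) :=
    Measure.isProbabilityMeasure_map measurable_clocks.aemeasurable
  obtain ⟨Y, hY, hinv⟩ := hπ.invariant
  refine eq_pi_equilibriumLaw_of_invariant h.isRenewalLaw h.clockRate_pos ?_ fun t ht => ?_
  · rw [ae_map_iff measurable_clocks.aemeasurable]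
    · filter_upwards [hπ.clocks_pos] with z hz
      rintro (e | i)
      exacts [hz.1 e, hz.2 i]
    · simp only [Set.ofPred_forall]
      exact MeasurableSet.iInter fun k => measurableSet_lt measurable_const (measurable_pi_apply k)
  · have h1 : MeasurePreserving (fun (v : net.Paths) k => (v k).1) net.pathLaw
        (Measure.pi fun k => seqLaw (net.intervalLaw k)) :=
      measurePreserving_pi _ _ fun k => measurePreserving_fst
    have h2 : MeasurePreserving (fun p : net.QState × net.Drive =>
        (clocks p.1, fun k => (toPaths p.2 k).1)) (π.prod net.driveLaw)
        ((π.map clocks).prod (Measure.pi fun k => seqLaw (net.intervalLaw k))) :=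
      MeasurePreserving.prod ⟨measurable_clocks, rfl⟩ (h1.comp measurePreserving_toPaths)
    have h3 : Measurable fun (p : (net.Clock → ℝ) × (net.Clock → ℕ → ℝ)) k =>
        residual (epoch (p.1 k) (p.2 k)) t :=
      measurable_pi_lambda _ fun k => measurable_residual_epoch (by fun_prop) (by fun_prop)
        measurable_const
    rw [← h2.map_eq, Measure.map_map h3 h2.measurable]
    conv_rhs => rw [← hinv t ht, Measure.map_map measurable_clocks
      (measurable_stateAt (hY.measurable t ht))]
    congr 1
    ext p k
    rcases k with e | i <;> rfl

lemma IsStationaryDistribution.invariantLaw (h : net.Assumptions) {π : Measure net.QState}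
    (hπ : net.IsStationaryDistribution π) : Invariant π := by
  have := hπ.prob
  have hc := hπ.map_clocks h
  obtain ⟨Y, hY, hinv⟩ := hπ.invariant
  exact ⟨hπ.prob, hc, fun t ht => (hY.map_stateAt h hc ht).symm.trans (hinv t ht)⟩

lemma Invariant.isStationaryDistribution (h : net.Assumptions) {π : Measure net.QState}
    (hπ : Invariant π) : net.IsStationaryDistribution π := by
  have := hπ.prob
  have hpos : ∀ᵐ z ∂π, ∀ k, 0 < clocks z k := by
    refine ae_of_ae_map (p := fun a => ∀ k, 0 < a k) measurable_clocks.aemeasurable ?_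
    rw [hπ.clocks_law]
    exact h.ae_pos
  have hY : net.IsAutonomousQueue π fun p t i =>
      (queuesAt t p.1.1 (clocks p.1) (toPaths p.2) i).toNat := by
    constructor
    · intro t _
      exact measurable_toNat_comp (measurable_queuesAt (by fun_prop)
        (measurable_clocks.comp measurable_fst)
        (measurePreserving_toPaths.measurable.comp measurable_snd) t)
    · filter_upwards [h.ae_goodConfig_drive hπ.clocks_law] with p hp
      exact (isSolution_iff hp).2 fun t _ i => Int.toNat_of_nonneg (queuesAt_nonneg _ _ _ _)
  refine ⟨hπ.prob, ?_, _, hY, fun t ht => ?_⟩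
  · filter_upwards [hpos] with z hz
    exact ⟨fun e => hz (Sum.inl e), fun i => hz (Sum.inr i)⟩
  · rw [hY.map_stateAt h hπ.clocks_law ht, hπ.evolve_law t ht]

/-- Existence and uniqueness of the stationary distribution. -/
theorem Assumptions.existsUnique_isStationaryDistribution (h : net.Assumptions) :
    ∃! π : Measure net.QState, net.IsStationaryDistribution π :=
  ⟨net.equilibriumState, h.invariant_equilibriumState.isStationaryDistribution h,
    fun _ hπ => (hπ.invariantLaw h).eq_equilibriumState h⟩

end AutonomousNetwork

/-! ### Two-sided stationary renewal processes -/

section TwoSided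

open AutonomousNetwork

/-- Strictly increasing points on the line, numbered such that `x 0` is the first one after `0`. -/
structure GoodPoints (x : ℤ → ℝ) : Prop where
  strictMono : StrictMono x
  tendsto : Tendsto x atTop atTop
  neg : x (-1) < 0
  pos : 0 < x 0

/-- The intervals between the points after `0`. -/
def gaps (x : ℤ → ℝ) (n : ℕ) : ℝ := x (n + 1) - x n

lemma epoch_gaps (x : ℤ → ℝ) (j : ℕ) : epoch (x 0) (gaps x) j = x j := by
  induction j with
  | zero => simp
  | succ _ ih => rw [epoch_succ, ih, gaps]; push_cast; ring

lemma measurable_gaps : Measurable gaps :=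
  measurable_pi_lambda _ fun _ => (measurable_pi_apply _).sub (measurable_pi_apply _)

namespace GoodPoints

variable {x : ℤ → ℝ} (hx : GoodPoints x)
include hx

lemma goodEpochs : GoodEpochs (epoch (x 0) (gaps x)) := by
  constructor
  · intro i j hij
    rw [epoch_gaps, epoch_gaps]
    exact hx.strictMono (by exact_mod_cast hij)
  · have : epoch (x 0) (gaps x) = fun n : ℕ => x n := funext (epoch_gaps x)
    rw [this]
    exact hx.tendsto.comp tendsto_natCast_atTop_atTop

lemma index_nonneg {n : ℤ} (h : 0 ≤ x n) : 0 ≤ n := by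
  by_contra hn
  have := hx.strictMono.monotone (show n ≤ -1 by omega)
  linarith [hx.neg]

lemma ncard_eq {S : Set ℝ} (hS : S ⊆ Set.Ici 0) (p : ℤ → Prop) :
    {n : ℤ | x n ∈ S ∧ p n}.ncard = {n : ℕ | epoch (x 0) (gaps x) n ∈ S ∧ p n}.ncard := by
  rw [← Set.ncard_image_of_injective _ (Nat.cast_injective (R := ℤ))]
  congr 1
  ext n
  simp only [Set.mem_ofPred_eq, Set.mem_image, epoch_gaps]
  constructor
  · rintro ⟨h1, h2⟩
    have h3 := hx.index_nonneg (hS h1)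
    exact ⟨n.toNat, by rw [Int.toNat_of_nonneg h3]; exact ⟨h1, h2⟩, Int.toNat_of_nonneg h3⟩
  · rintro ⟨k, hk, rfl⟩
    exact hk

lemma twoSidedCount_eq {t : ℝ} (ht : 0 ≤ t) (p : ℤ → Prop) :
    twoSidedCount x p t = {n : ℕ | epoch (x 0) (gaps x) n ∈ Set.Iic t ∧ p n}.ncard := by
  rw [twoSidedCount, if_pos ht, hx.ncard_eq (fun y hy => hy.1)]
  congr 2
  ext n
  have h1 := hx.goodEpochs.strictMono.monotone (Nat.zero_le n)
  rw [epoch_zero] at h1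
  have h2 := hx.pos
  simp only [Set.mem_ofPred_eq, Set.mem_Icc, Set.mem_Iic]
  constructor
  · rintro ⟨⟨_, h3⟩, h4⟩; exact ⟨h3, h4⟩
  · rintro ⟨h3, h4⟩; exact ⟨⟨by linarith, h3⟩, h4⟩

/-- The residual time exceeds `s` if and only if there is no point in `(t, t + s]`. -/
lemma ncard_eq_zero_iff {t s : ℝ} (ht : 0 ≤ t) :
    {n : ℤ | x n ∈ Set.Ioc (0 + t) (s + t)}.ncard = 0
      ↔ s < residual (epoch (x 0) (gaps x)) t := by
  have hg := hx.goodEpochs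
  have h := hx.ncard_eq (S := Set.Ioc (0 + t) (s + t)) (fun y hy => by
    have := hy.1; simp only [Set.mem_Ici]; linarith) (fun _ => True)
  simp only [and_true] at h
  rw [h, Set.ncard_eq_zero ((hg.finite (s + t)).subset fun n hn => hn.2), AutonomousNetwork.residual]
  constructor
  · intro h1
    by_contra h2
    have h3 : countUpTo (epoch (x 0) (gaps x)) t
        ∈ {n : ℕ | epoch (x 0) (gaps x) n ∈ Set.Ioc (0 + t) (s + t)} :=
      ⟨by linarith [hg.lt_epoch_countUpTo t], by linarith⟩
    rw [h1] at h3
    exact h3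
  · intro h1
    refine Set.eq_empty_of_forall_notMem fun n hn => ?_
    have h2 : ¬ n < countUpTo (epoch (x 0) (gaps x)) t := by
      rw [hg.lt_countUpTo_iff]
      have := hn.1
      linarith
    have h3 := hg.strictMono.monotone (not_lt.1 h2)
    have := hn.2
    linarith

end GoodPoints

namespace IsStationaryRenewal

variable {Ω : Type*} [MeasurableSpace Ω] {P : Measure Ω} [IsProbabilityMeasure P] {m : Measure ℝ}
  {A : Ω → ℤ → ℝ} (hA : IsStationaryRenewal P m A)
include hA

omit [IsProbabilityMeasure P] in
lemma measurable_points : Measurable A := measurable_pi_lambda _ hA.measurable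

omit [IsProbabilityMeasure P] in
lemma ae_goodPoints : ∀ᵐ ω ∂P, GoodPoints (A ω) := by
  filter_upwards [hA.strictMono, hA.tendsto_atTop, hA.around_zero] with ω h1 h2 h3
  exact ⟨h1, h2, h3.1, h3.2⟩

omit [IsProbabilityMeasure P] in
lemma measurable_first_gaps : Measurable fun ω => (A ω 0, gaps (A ω)) :=
  (hA.measurable 0).prodMk (measurable_gaps.comp hA.measurable_points)

lemma map_gaps [IsProbabilityMeasure m] : P.map (fun ω => gaps (A ω)) = seqLaw m := by
  have h := (iIndepFun_iff_map_fun_eq_infinitePi_map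
    (X := fun (n : ℕ) ω => A ω (n + 1) - A ω n)
    (fun n => (hA.measurable (n + 1)).sub (hA.measurable n))).1 hA.interval_indep
  simp_rw [hA.interval_law] at h
  exact h

lemma map_first_gaps_eq_prod [IsProbabilityMeasure m] :
    P.map (fun ω => (A ω 0, gaps (A ω))) = (P.map fun ω => A ω 0).prod (seqLaw m) := by
  have h0 : Measurable fun x : ℕ → ℝ => x 0 := measurable_pi_apply 0
  have h := hA.indep_past.comp h0 measurable_id
  have h' : IndepFun (fun ω => A ω 0) (fun ω => gaps (A ω)) P := by
    have e : (fun ω => gaps (A ω)) = fun ω (n : ℕ) => A ω (n + 1) - A ω n := rfl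
    rw [e]
    simpa [Function.comp_def] using h
  have h1 : Measurable fun ω => gaps (A ω) := measurable_gaps.comp hA.measurable_points
  have h2 := (indepFun_iff_map_prod_eq_prod_map_map (hA.measurable 0).aemeasurable
    h1.aemeasurable).1 h'
  rw [h2, hA.map_gaps]

/-- By stationarity the residual time at `t` is distributed like the first point. -/
lemma map_residual {t : ℝ} (ht : 0 ≤ t) :
    P.map (fun ω => residual (epoch (A ω 0) (gaps (A ω))) t) = P.map fun ω => A ω 0 := by
  have hres : ∀ t, Measurable fun ω => residual (epoch (A ω 0) (gaps (A ω))) t := fun t =>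
    measurable_residual_epoch (hA.measurable 0) (measurable_gaps.comp hA.measurable_points)
      measurable_const
  have hzero : P.map (fun ω => residual (epoch (A ω 0) (gaps (A ω))) 0) = P.map fun ω => A ω 0 := by
    refine Measure.map_congr ?_
    filter_upwards [hA.ae_goodPoints] with ω hω
    have : countUpTo (epoch (A ω 0) (gaps (A ω))) 0 = 0 :=
      hω.goodEpochs.countUpTo_eq (fun j hj => absurd hj (Nat.not_lt_zero j))
        (by rw [epoch_zero]; exact hω.pos)
    rw [AutonomousNetwork.residual, this, epoch_zero, sub_zero]
  rw [← hzero]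
  have := Measure.isProbabilityMeasure_map (μ := P) (hres t).aemeasurable
  have := Measure.isProbabilityMeasure_map (μ := P) (hres 0).aemeasurable
  refine Measure.ext_of_Iic _ _ fun s => ?_
  rw [← Set.compl_Ioi, prob_compl_eq_one_sub measurableSet_Ioi,
    prob_compl_eq_one_sub measurableSet_Ioi]
  congr 1
  rw [Measure.map_apply (hres t) measurableSet_Ioi, Measure.map_apply (hres 0) measurableSet_Ioi]
  rcases lt_or_ge s 0 with hs | hs
  · have h1 : ∀ t, P ((fun ω => residual (epoch (A ω 0) (gaps (A ω))) t) ⁻¹' Set.Ioi s) = 1 := by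
      intro t
      rw [← measure_univ (μ := P)]
      refine measure_congr ?_
      filter_upwards [hA.ae_goodPoints] with ω hω
      exact eq_iff_iff.2 ⟨fun _ => trivial, fun _ => hs.trans (hω.goodEpochs.residual_pos t)⟩
    rw [h1, h1]
  · -- The number of points in a window is the coordinate `(0, s)` of the stationary count process.
    have hm : ∀ t, Measurable fun ω (I : ℝ × ℝ) =>
        {n : ℤ | A ω n ∈ Set.Ioc (I.1 + t) (I.2 + t)}.ncard := fun t =>
      measurable_pi_lambda _ fun I => measurable_ncard_setOf fun n =>
        hA.measurable n measurableSet_Ioc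
    have hset : MeasurableSet {f : ℝ × ℝ → ℕ | f (0, s) = 0} :=
      measurable_pi_apply (0, s) (measurableSet_singleton 0)
    have key : ∀ t, 0 ≤ t → P ((fun ω => residual (epoch (A ω 0) (gaps (A ω))) t) ⁻¹' Set.Ioi s)
        = P.map (fun ω (I : ℝ × ℝ) => {n : ℤ | A ω n ∈ Set.Ioc (I.1 + t) (I.2 + t)}.ncard)
          {f : ℝ × ℝ → ℕ | f (0, s) = 0} := by
      intro t ht
      rw [Measure.map_apply (hm t) hset]
      refine measure_congr ?_
      filter_upwards [hA.ae_goodPoints] with ω hω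
      exact eq_iff_iff.2 (hω.ncard_eq_zero_iff ht).symm
    rw [key t ht, key 0 le_rfl, hA.stationary t, hA.stationary 0]

/-- The first point after `0` and the later intervals of a stationary renewal process. -/
lemma measurePreserving_first_gaps [IsProbabilityMeasure m] {rate : ℝ} (hm : IsRenewalLaw m rate)
    (hr : 0 < rate) :
    MeasurePreserving (fun ω => (A ω 0, gaps (A ω))) P ((equilibriumLaw m rate).prod (seqLaw m)) := by
  set β := P.map fun ω => A ω 0 with hβ
  have : IsProbabilityMeasure β := Measure.isProbabilityMeasure_map (hA.measurable 0).aemeasurable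
  have := isProbabilityMeasure_equilibriumLaw hm hr
  have hc : ∀ {α : Type} [MeasurableSpace α] (ρ : Measure α) [IsProbabilityMeasure ρ],
      MeasurePreserving (fun (y : α) (_ : Unit) => y) ρ (Measure.pi fun _ => ρ) := by
    intro α _ ρ _
    refine ⟨by fun_prop, (Measure.pi_eq fun s hs => ?_).symm⟩
    rw [Measure.map_apply (by fun_prop) (MeasurableSet.univ_pi hs), Fintype.prod_unique]
    congr 1
    ext y
    simp only [Set.mem_preimage, Set.mem_pi, Set.mem_univ, true_implies]
    exact ⟨fun h => h (), fun h _ => h⟩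
  have hfirst : MeasurePreserving (fun ω => (A ω 0, gaps (A ω))) P (β.prod (seqLaw m)) :=
    ⟨hA.measurable_first_gaps, hA.map_first_gaps_eq_prod⟩
  have hpi : (Measure.pi fun _ : Unit => β) = Measure.pi fun _ => equilibriumLaw m rate := by
    refine eq_pi_equilibriumLaw_of_invariant (fun _ => hm) (fun _ => hr) ?_ fun t ht => ?_
    · refine ae_all_iff.2 fun k => ?_
      refine (measurePreserving_eval (fun _ : Unit => β) k).quasiMeasurePreserving.ae
        (p := fun x => 0 < x) ?_
      rw [hβ, ae_map_iff (hA.measurable 0).aemeasurable measurableSet_Ioi]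
      filter_upwards [hA.ae_goodPoints] with ω hω using hω.pos
    · have h1 := ((hc β).prod (hc (seqLaw m))).comp hfirst
      have h2 : Measurable fun (p : (Unit → ℝ) × (Unit → ℕ → ℝ)) k =>
          residual (epoch (p.1 k) (p.2 k)) t :=
        measurable_pi_lambda _ fun k => measurable_residual_epoch (by fun_prop) (by fun_prop)
          measurable_const
      have h3 : MeasurePreserving (fun ω => residual (epoch (A ω 0) (gaps (A ω))) t) P β :=
        ⟨measurable_residual_epoch (hA.measurable 0) (measurable_gaps.comp hA.measurable_points)
          measurable_const, hA.map_residual ht⟩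
      rw [← h1.map_eq, Measure.map_map h2 h1.measurable, ← ((hc β).comp h3).map_eq]
      rfl
  have e1 := (measurePreserving_eval (fun _ : Unit => β) ()).map_eq
  have e2 := (measurePreserving_eval (fun _ : Unit => equilibriumLaw m rate) ()).map_eq
  rw [hpi] at e1
  rw [← e2.symm.trans e1] at hfirst
  exact hfirst

end IsStationaryRenewal

end TwoSided

/-! ### The stationary input of the network -/

namespace AutonomousNetwork

variable {d : ℕ} {net : AutonomousNetwork d}

/-- The first epochs after `0` of two-sided clocks. -/
def inputClocks (a : net.Src → ℤ → ℝ) (b : Fin d → ℤ → ℝ) : net.Clock → ℝ :=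
  Sum.elim (fun e => a e 0) fun i => b i 0

/-- The intervals and marks after the first epochs of two-sided clocks. -/
def inputPaths (a : net.Src → ℤ → ℝ) (b : Fin d → ℤ → ℝ) (r : Fin d → ℤ → Fin (d + 1)) :
    net.Paths := fun k =>
  Sum.elim (fun e => (gaps (a e), fun _ => 0)) (fun i => (gaps (b i), fun n : ℕ => r i n)) k

/-- After time `0` the two-sided net input is the net input of the clocks after `0`. -/
lemma Xbar_eq_netPath {a : net.Src → ℤ → ℝ} {b : Fin d → ℤ → ℝ} {r : Fin d → ℤ → Fin (d + 1)}
    (ha : ∀ e, GoodPoints (a e)) (hb : ∀ i, GoodPoints (b i)) (i : Fin d) {t : ℝ} (ht : 0 ≤ t) :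
    net.Xbar a b r i t = netPath (inputClocks a b) (inputPaths a b r) i t := by
  unfold Xbar netPath netOf
  congr 1
  · congr 1
    · split_ifs with hi
      · exact (ha _).twoSidedCount_eq ht _
      · rfl
    · exact Finset.sum_congr rfl fun j _ => (hb j).twoSidedCount_eq ht _
  · exact (hb i).twoSidedCount_eq ht _

section Input

variable {Ω : Type*} [MeasurableSpace Ω] {P : Measure Ω} [IsProbabilityMeasure P]
  {A : net.Src → Ω → ℤ → ℝ} {B : Fin d → Ω → ℤ → ℝ} {r : Fin d → Ω → ℤ → Fin (d + 1)}

lemma map_marks (hmeas : ∀ i n, Measurable fun ω => r i ω n)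
    (hlaw : ∀ i n, P.map (fun ω => r i ω n) = (net.route i).toMeasure)
    (hind : iIndepFun (fun (k : Fin d × ℤ) ω => r k.1 ω k.2) P) :
    P.map (fun ω i (n : ℕ) => r i ω n)
      = Measure.pi fun i => seqLaw (net.route i).toMeasure := by
  have hinj : Function.Injective fun k : Fin d × ℕ => (k.1, (k.2 : ℤ)) := by
    rintro ⟨i, n⟩ ⟨j, k⟩ h
    simpa using h
  have h1 := (iIndepFun_iff_map_fun_eq_infinitePi_map
    (fun k : Fin d × ℕ => hmeas k.1 k.2)).1 (hind.precomp hinj)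
  simp only [hlaw] at h1
  have h2 := Measure.infinitePi_map_curry (X := Fin (d + 1))
    (fun (i : Fin d) (_ : ℕ) => (net.route i).toMeasure)
  rw [← Measure.infinitePi_eq_pi, ← h2, ← h1]
  exact (Measure.map_map (g := MeasurableEquiv.curry (Fin d) ℕ (Fin (d + 1)))
    (f := fun ω (k : Fin d × ℕ) => r k.1 ω k.2) (MeasurableEquiv.measurable _)
    (measurable_pi_lambda _ fun k => hmeas k.1 k.2)).symm

/-- Seen from time `0` on, the two-sided input has stationary clocks. -/
lemma IsStationaryInput.measurePreserving (h : net.Assumptions)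
    (hin : net.IsStationaryInput P A B r) :
    MeasurePreserving (fun ω => (inputClocks (fun e => A e ω) (fun i => B i ω),
      inputPaths (fun e => A e ω) (fun i => B i ω) (fun i => r i ω)))
      P (net.equilibriumClocks.prod net.pathLaw) := by
  have := h.isProbabilityMeasure_equilibriumLaw
  have hf : Measurable fun x : ℤ → ℝ => (x 0, gaps x) :=
    (measurable_pi_apply 0).prodMk measurable_gaps
  set p : net.Clock → Measure (ℝ × (ℕ → ℝ)) := fun k =>
    (equilibriumLaw (net.intervalLaw k) (net.clockRate k)).prod (seqLaw (net.intervalLaw k)) with hp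
  have hAm : ∀ e, Measurable (A e) := fun e => (hin.arr e).measurable_points
  have hBm : ∀ i, Measurable (B i) := fun i => (hin.act i).measurable_points
  have hrm : ∀ i, Measurable (r i) := fun i => measurable_pi_lambda _ fun n =>
    hin.mark_measurable i n
  have hA : P.map (fun ω e => (A e ω 0, gaps (A e ω))) = Measure.pi fun e => p (Sum.inl e) := by
    rw [(iIndepFun_iff_map_fun_eq_pi_map (f := fun e ω => (A e ω 0, gaps (A e ω)))
      fun e => (hf.comp (hAm e)).aemeasurable).1
      (hin.arr_indep.comp (fun _ x => (x 0, gaps x)) fun _ => hf)]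
    congr 1
    ext1 e
    exact ((hin.arr e).measurePreserving_first_gaps (h.arr_law e) e.2).map_eq
  have hB : P.map (fun ω i => (B i ω 0, gaps (B i ω))) = Measure.pi fun i => p (Sum.inr i) := by
    rw [(iIndepFun_iff_map_fun_eq_pi_map (f := fun i ω => (B i ω 0, gaps (B i ω)))
      fun i => (hf.comp (hBm i)).aemeasurable).1
      (hin.act_indep.comp (fun _ x => (x 0, gaps x)) fun _ => hf)]
    congr 1
    ext1 i
    exact ((hin.act i).measurePreserving_first_gaps (h.act_law i) (h.mu_pos i)).map_eq
  have hR := map_marks hin.mark_measurable hin.mark_law hin.mark_indep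
  have hfB : Measurable fun (b : Fin d → ℤ → ℝ) i => (b i 0, gaps (b i)) :=
    measurable_pi_lambda _ fun i => hf.comp (measurable_pi_apply i)
  have hfA : Measurable fun (a : net.Src → ℤ → ℝ) e => (a e 0, gaps (a e)) :=
    measurable_pi_lambda _ fun e => hf.comp (measurable_pi_apply e)
  have hfR : Measurable fun (x : Fin d → ℤ → Fin (d + 1)) i (n : ℕ) => x i n := by fun_prop
  have hBall : Measurable fun ω i => B i ω := measurable_pi_lambda _ hBm
  have hAall : Measurable fun ω e => A e ω := measurable_pi_lambda _ hAm
  have hRall : Measurable fun ω i => r i ω := measurable_pi_lambda _ hrm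
  have hBR : P.map (fun ω => ((fun i => (B i ω 0, gaps (B i ω))), fun i (n : ℕ) => r i ω n))
      = (Measure.pi fun i => p (Sum.inr i)).prod
        (Measure.pi fun i => seqLaw (net.route i).toMeasure) := by
    rw [← hB, ← hR]
    exact (indepFun_iff_map_prod_eq_prod_map_map (hfB.comp hBall).aemeasurable
      (hfR.comp hRall).aemeasurable).1 (hin.act_mark_indep.comp hfB hfR)
  have hall : MeasurePreserving (fun ω => ((fun e => (A e ω 0, gaps (A e ω))),
      ((fun i => (B i ω 0, gaps (B i ω))), fun i (n : ℕ) => r i ω n))) P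
      ((Measure.pi fun e => p (Sum.inl e)).prod ((Measure.pi fun i => p (Sum.inr i)).prod
        (Measure.pi fun i => seqLaw (net.route i).toMeasure))) := by
    refine ⟨(hfA.comp hAall).prodMk ((hfB.comp hBall).prodMk (hfR.comp hRall)), ?_⟩
    rw [← hA, ← hBR]
    exact (indepFun_iff_map_prod_eq_prod_map_map (hfA.comp hAall).aemeasurable
      ((hfB.comp hBall).prodMk (hfR.comp hRall)).aemeasurable).1
      (hin.arr_rest_indep.comp hfA (hfB.prodMap hfR))
  have hasm := (measurePreserving_assemble (p := p)
    (q := fun i => seqLaw (net.route i).toMeasure) (b := fun _ => (0 : Fin (d + 1)))).comp hall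
  set q' : net.Clock → Measure (ℕ → Fin (d + 1)) := Sum.elim
    (fun _ => Measure.dirac fun _ => 0) (fun i => seqLaw (net.route i).toMeasure) with hq'
  have : ∀ k, IsProbabilityMeasure (q' k) := by
    rintro (e | i)
    · exact Measure.dirac.isProbabilityMeasure
    · simp only [hq', Sum.elim_inr]; infer_instance
  have hassoc : MeasurePreserving (fun (w : net.Clock → (ℝ × (ℕ → ℝ)) × (ℕ → Fin (d + 1))) k =>
      ((w k).1.1, ((w k).1.2, (w k).2))) (Measure.pi fun k => (p k).prod (q' k))
      (Measure.pi fun k => (equilibriumLaw (net.intervalLaw k) (net.clockRate k)).prod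
        (clockLaw (net.intervalLaw k) (net.markLaw k))) := by
    simp_rw [clockLaw_eq]
    exact measurePreserving_pi _ _ fun k => measurePreserving_prodAssoc _ _ _
  have hsplit := measurePreserving_arrowProdEquivProdArrow ℝ (ClockPath (Fin (d + 1))) net.Clock
    (fun k => equilibriumLaw (net.intervalLaw k) (net.clockRate k))
    (fun k => clockLaw (net.intervalLaw k) (net.markLaw k))
  have hfinal := hsplit.comp (hassoc.comp hasm)
  refine (congrArg (fun f => MeasurePreserving f P _) (funext fun ω => ?_)).mp hfinal
  refine Prod.ext (funext fun k => ?_) (funext fun k => ?_)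
  · rcases k with e | i <;> rfl
  · rcases k with e | i <;> rfl

end Input

end AutonomousNetwork

/-! ### The reversed process and the stationary queue -/

namespace AutonomousNetwork

variable {d : ℕ} {net : AutonomousNetwork d} {Ω : Type*} [MeasurableSpace Ω] {P : Measure Ω}
  [IsProbabilityMeasure P] {A : net.Src → Ω → ℤ → ℝ} {B : Fin d → Ω → ℤ → ℝ}
  {r : Fin d → Ω → ℤ → Fin (d + 1)}

/-- Almost surely the suprema are finite, and the reversed process is the stationary reversed queue
of the input seen after time `0`. -/
lemma IsStationaryInput.ae_bddAbove_and_eq (h : net.Assumptions)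
    (hin : net.IsStationaryInput P A B r) :
    ∀ᵐ ω ∂P, ∀ (i : Fin d) (t : ℝ), 0 ≤ t →
      BddAbove (net.Xbar (fun e => A e ω) (fun j => B j ω) (fun j => r j ω) i '' Set.Ici t) ∧
      net.YbarRev (fun e => A e ω) (fun j => B j ω) (fun j => r j ω) t i
        = reversedQueues (inputClocks (fun e => A e ω) (fun j => B j ω))
          (inputPaths (fun e => A e ω) (fun j => B j ω) (fun j => r j ω)) t i := by
  have := h.isProbabilityMeasure_equilibriumClocks
  have hmp := (hin.measurePreserving h).quasiMeasurePreserving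
  filter_upwards [ae_all_iff.2 fun e => (hin.arr e).ae_goodPoints,
    ae_all_iff.2 fun i => (hin.act i).ae_goodPoints, hmp.ae h.ae_goodConfig,
    hmp.ae (Measure.quasiMeasurePreserving_snd.ae h.ae_tendsto_netPath)] with ω h1 h2 h3 h4 i t ht
  have hb := bddAbove_image_Ici (h4 (inputClocks (fun e => A e ω) (fun j => B j ω)) i)
    (h3.bddAbove_netPath i) ht
  have e := fun (s : ℝ) (hs : 0 ≤ s) =>
    Xbar_eq_netPath (net := net) (r := fun j => r j ω) h1 h2 i hs
  have himg := Set.image_congr fun s (hs : s ∈ Set.Ici t) => e s (ht.trans hs)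
  rw [YbarRev, himg, e t ht]
  exact ⟨hb, (reversedRat_eq hb (h3.paths.netPath_right _ i)).symm⟩

/-- The reversed process and the stationary queue have the same law. -/
theorem IsStationaryInput.identDistrib (h : net.Assumptions)
    (hin : net.IsStationaryInput P A B r) {π : Measure net.QState}
    {Y : net.QState × net.Drive → ℝ → Fin d → ℕ} (hπ : net.IsStationaryDistribution π)
    (hY : net.IsAutonomousQueue π Y) {T S : ℝ} (hT : 0 ≤ T) (hTS : T ≤ S) :
    IdentDistrib
      (fun ω (s : Set.Icc (0 : ℝ) T) =>
        net.YbarRev (fun e => A e ω) (fun j => B j ω) (fun j => r j ω) (S - s))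
      (fun p (s : Set.Icc (0 : ℝ) T) (i : Fin d) => (Y p s i : ℤ)) P (π.prod net.driveLaw) := by
  have := hπ.prob
  have := h.isProbabilityMeasure_equilibriumClocks
  have hinv := hπ.invariantLaw h
  have hmp := hin.measurePreserving h
  have hmd := measurePreserving_id_toPaths π
  set R : (net.Clock → ℝ) × net.Paths → Set.Icc (0 : ℝ) T → Fin d → ℤ :=
    fun p s => reversedQueues p.1 p.2 (S - s) with hR
  set Q : net.QState × net.Paths → Set.Icc (0 : ℝ) T → Fin d → ℤ :=
    fun p s => queuesAt s p.1.1 (clocks p.1) p.2 with hQ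
  have hRm : Measurable R := measurable_pi_lambda _ fun s =>
    measurable_reversedQueues measurable_fst measurable_snd _
  have hQm : Measurable Q := measurable_pi_lambda _ fun s =>
    measurable_queuesAt (by fun_prop) (measurable_clocks.comp measurable_fst) measurable_snd _
  have hYm : Measurable fun p (s : Set.Icc (0 : ℝ) T) (i : Fin d) => (Y p s i : ℤ) :=
    measurable_pi_lambda _ fun s => measurable_pi_lambda _ fun i =>
      (measurable_of_countable (fun n : ℕ => (n : ℤ))).comp
        ((measurable_pi_apply i).comp (hY.measurable s s.2.1))
  have hX : (fun ω (s : Set.Icc (0 : ℝ) T) =>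
      net.YbarRev (fun e => A e ω) (fun j => B j ω) (fun j => r j ω) (S - s)) =ᵐ[P]
      fun ω => R (inputClocks (fun e => A e ω) (fun i => B i ω),
        inputPaths (fun e => A e ω) (fun i => B i ω) (fun i => r i ω)) := by
    filter_upwards [hin.ae_bddAbove_and_eq h] with ω hω
    ext s i
    exact (hω i (S - s) (by linarith [s.2.2])).2
  have hYQ : (fun p (s : Set.Icc (0 : ℝ) T) (i : Fin d) => (Y p s i : ℤ))
      =ᵐ[π.prod net.driveLaw] fun p => Q (p.1, toPaths p.2) := by
    filter_upwards [hY.ae_eq_queuesAt h hinv.clocks_law] with p hp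
    ext s i
    exact hp s s.2.1 i
  have hRC := hRm.comp hmp.measurable
  refine ⟨⟨_, hRC, hX⟩, hYm.aemeasurable, ?_⟩
  rw [Measure.map_congr hX, Measure.map_congr hYQ]
  have e1 := Measure.map_map (μ := P) hRm hmp.measurable
  have e2 := Measure.map_map (μ := π.prod net.driveLaw) hQm hmd.measurable
  rw [hmp.map_eq] at e1
  rw [hmd.map_eq] at e2
  refine e1.symm.trans (Eq.trans ?_ e2)
  have := Measure.isProbabilityMeasure_map (μ := π.prod net.pathLaw) hQm.aemeasurable
  have hfin : ∀ J : Finset (Set.Icc (0 : ℝ) T),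
      IsFiniteMeasure (((π.prod net.pathLaw).map Q).map J.restrict) := fun J => inferInstance
  refine IsProjectiveLimit.unique (P := fun J => ((π.prod net.pathLaw).map Q).map J.restrict)
    (fun J => ?_) (fun J => rfl)
  beta_reduce
  rw [Measure.map_map (Finset.measurable_restrict J) hRm,
    Measure.map_map (Finset.measurable_restrict J) hQm]
  exact (hinv.map_queuesAt h (hT.trans hTS) (s := fun j : J => ((j : Set.Icc (0 : ℝ) T) : ℝ))
    (fun j => j.1.2.1) (fun j => j.1.2.2.trans hTS)).symm

end AutonomousNetwork

end

theorem mainTheorem3 {d : ℕ} (net : AutonomousNetwork d) (hnet : net.Assumptions) :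
    (∃! π : Measure net.QState, net.IsStationaryDistribution π) ∧
    ∀ (Ω : Type*) [MeasurableSpace Ω] (P : Measure Ω) [IsProbabilityMeasure P]
      (A : net.Src → Ω → ℤ → ℝ) (B : Fin d → Ω → ℤ → ℝ) (r : Fin d → Ω → ℤ → Fin (d + 1)),
      net.IsStationaryInput P A B r →
      (∀ᵐ ω ∂P, ∀ (i : Fin d) (t : ℝ), 0 ≤ t →
        BddAbove (net.Xbar (fun e => A e ω) (fun j => B j ω) (fun j => r j ω) i '' Set.Ici t)) ∧
      ∀ (π : Measure net.QState) (Y : net.QState × net.Drive → ℝ → Fin d → ℕ),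
        net.IsStationaryDistribution π → net.IsAutonomousQueue π Y →
        ∀ T S : ℝ, 0 ≤ T → T ≤ S →
          IdentDistrib
            (fun ω (s : Set.Icc (0 : ℝ) T) =>
              net.YbarRev (fun e => A e ω) (fun j => B j ω) (fun j => r j ω) (S - s))
            (fun p (s : Set.Icc (0 : ℝ) T) (i : Fin d) => (Y p s i : ℤ))
            P (π.prod net.driveLaw) := by
  refine ⟨hnet.existsUnique_isStationaryDistribution, fun Ω _ P _ A B r hin => ⟨?_, ?_⟩⟩
  · filter_upwards [hin.ae_bddAbove_and_eq hnet] with ω hω i t ht using (hω i t ht).1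
  · intro π Y hπ hY T S hT hTS
    exact hin.identDistrib hnet hπ hY hT hTS
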